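/- **Setting.** Let $q(x,t)$ be a complex-valued potential of the modified Zakharov--Shabat problem $$\Phi_x=X\Phi,\qquad X=ik^2\sigma_3+kQ,\qquad Q=\begin{pmatrix}0&q\\-q^*&0\end{pmatrix},\quad \sigma_3=\mathrm{diag}(1,-1),$$ associated with the derivative nonlinear Schrödinger equation $iq_t+q_{xx}-i(|q|^2q)_x=0$ with zero boundary condition $q\to0$ as $x\to\pm\infty$. Fix a time $t$ and suppose that $q(\cdot,t)$ is $C^1$ and that $q(\cdot,t)$ and $q_x(\cdot,t)$ belong to $L^1(\mathbb R)$ (that $q$ solves the equation is not needed). Put $$\theta(x,t;k)=k^2(x-2k^2t),\quad \Sigma=\mathbb R\cup i\mathbb R,\quad D^{\pm}=\{k\in\mathbb C:\pm\,\mathrm{Re}(k)\,\mathrm{Im}(k)>0\},\quad v_0=\tfrac12\int_{-\infty}^{\infty}|q(y,t)|^2\,dy .$$ For $k\in\Sigma$ let $\Phi_\pm(x,t;k)=e^{i\theta\sigma_3}+o(1)$ as $x\to\pm\infty$ be the Jost solutions, $\Phi_{\pm j}$ the $j$-th column of $\Phi_\pm$, $S(k)=(s_{ij}(k))$ the scattering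 matrix, defined by $\Phi_+=\Phi_-S(k)$, and $\rho=s_{21}/s_{11}$, $\tilde\rho=s_{12}/s_{22}$ the reflection coefficients. The columns $\Phi_{+1},\Phi_{-2}$ extend to $D^+$ and $\Phi_{-1},\Phi_{+2}$ to $D^-$ as the solutions with $e^{-i\theta}\Phi_{+1}\to(1,0)^T$ and $e^{i\theta}\Phi_{+2}\to(0,1)^T$ as $x\to+\infty$, and $e^{-i\theta}\Phi_{-1}\to(1,0)^T$ and $e^{i\theta}\Phi_{-2}\to(0,1)^T$ as $x\to-\infty$; put $s_{11}=\det(\Phi_{+1},\Phi_{-2})$ on $D^+\cup\Sigma$ and $s_{22}=\det(\Phi_{-1},\Phi_{+2})$ on $D^-\cup\Sigma$. Suppose that $s_{11}(k)\neq0$ for all $k\in\Sigma$ (no spectral singularities), and that the zeros of $s_{11}$ in the open first quadrant are exactly the $N\ge0$ distinct points $k_1,\dots,k_N$, each of them a double zero: $s_{11}(k_n)=s_{11}'(k_n)=0\ne s_{11}''(k_n)$. Put $\eta_n=k_n$ and $\eta_{N+n}=-k_n$ for $1\le n\le N$, and $\widehat\eta_n=\eta_n^*$ (complex conjugate) for $1\le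 n\le 2N$. **Claim.** 1. $s_{11}$ (resp. $s_{22}$) is analytic in $D^+$ (resp. $D^-$), continuous on $D^+\cup\Sigma$ (resp. $D^-\cup\Sigma$), and equal on $\Sigma$ to the corresponding diagonal entry of $S$. 2. (Trace formula.) With $\Sigma$ oriented so that $D^+$ lies on its left, and with the principal logarithm, $$s_{11}(k)=\exp\Big(-\frac1{2\pi i}\int_\Sigma\frac{\log[1-\rho(\zeta)\tilde\rho(\zeta)]}{\zeta-k}\,d\zeta\Big)\prod_{n=1}^{2N}\Big(\frac{k-\eta_n}{k-\widehat\eta_n}\Big)^2e^{-iv_0},\qquad k\in D^+,$$ $$s_{22}(k)=\exp\Big(\frac1{2\pi i}\int_\Sigma\frac{\log[1-\rho(\zeta)\tilde\rho(\zeta)]}{\zeta-k}\,d\zeta\Big)\prod_{n=1}^{2N}\Big(\frac{k-\widehat\eta_n}{k-\eta_n}\Big)^2e^{iv_0},\qquad k\in D^-,$$ where the integrals converge absolutely. 3. $s_{11}(0)=1$; and if the potential is reflectionless, i.e. $\rho=\tilde\rho=0$ on $\Sigma$, then there is an integer $j$ such that $$v_0=8\sum_{n=1}^{N}\arg(k_n)+2j\pi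 .$$ -/

import Mathlib

open MeasureTheory Filter Topology Set

noncomputable section

namespace DNLS

/-- The Pauli matrix `σ₃`. -/
def pauli3 : Matrix (Fin 2) (Fin 2) ℂ := !![1, 0; 0, -1]

/-- The potential matrix `Q` of the Lax pair (with `σ = -1`). -/
def potentialMatrix (q : ℝ → ℝ → ℂ) (x t : ℝ) : Matrix (Fin 2) (Fin 2) ℂ :=
  !![0, q x t; -(starRingEnd ℂ) (q x t), 0]

/-- The matrix `X = i k² σ₃ + k Q` of the modified Zakharov-Shabat problem `Φ_x = X Φ`. -/
def laxX (q : ℝ → ℝ → ℂ) (x t : ℝ) (k : ℂ) : Matrix (Fin 2) (Fin 2) ℂ :=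
  (Complex.I * k ^ 2) • pauli3 + k • potentialMatrix q x t

/-- The phase `θ(x,t;k) = k² (x - 2 k² t)`. -/
def theta (x t : ℝ) (k : ℂ) : ℂ := k ^ 2 * ((x : ℂ) - 2 * k ^ 2 * (t : ℂ))

/-- The contour `Σ = ℝ ∪ iℝ`, as a set. -/
def contour : Set ℂ := {k | k.im = 0 ∨ k.re = 0}

/-- `D⁺`, the union of the open first and third quadrants. -/
def Dplus : Set ℂ := {k | 0 < k.re * k.im}

/-- `D⁻`, the union of the open second and fourth quadrants. -/
def Dminus : Set ℂ := {k | k.re * k.im < 0}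

/-- `φ` is the `j`-th column of the Jost solution normalised at the end `l` of the line
(`l = atTop` for `x → +∞`, `l = atBot` for `x → -∞`): it solves `φ_x = X φ`, and the `j`-th column
`e^{∓ iθ} φ` of the modified Jost solution tends to the `j`-th unit vector.

For `k ∈ Σ` the phase is unimodular and the second condition is `Φ = e^{iθσ₃} + o(1)`.
For integrable continuous `q(·,t)` such a `φ` exists and is unique for both columns and both ends
if `k ∈ Σ`; for `(atTop, 0)` and `(atBot, 1)` if `k ∈ D⁺`; for `(atBot, 0)` and `(atTop, 1)` if
`k ∈ D⁻`; there it is the analytic continuation of the Jost column from `Σ`. -/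
structure IsJostColumn (q : ℝ → ℝ → ℂ) (t : ℝ) (k : ℂ) (l : Filter ℝ) (j : Fin 2)
    (φ : ℝ → Fin 2 → ℂ) : Prop where
  ode : ∀ x : ℝ, HasDerivAt φ ((laxX q x t k).mulVec (φ x)) x
  asymptotics : Tendsto (fun x : ℝ => Complex.exp (-(Complex.I * theta x t k * pauli3 j j)) • φ x) l
    (𝓝 (Pi.single j 1))

/-- The `j`-th column of the Jost solution `Φ₊(·,t;k)` (`l = atTop`) or `Φ₋(·,t;k)` (`l = atBot`). -/
def jostColumn (q : ℝ → ℝ → ℂ) (t : ℝ) (k : ℂ) (l : Filter ℝ) (j : Fin 2) : ℝ → Fin 2 → ℂ :=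
  Classical.epsilon (IsJostColumn q t k l j)

/-- The matrix Jost solution `Φ₊(x,t;k)` (`l = atTop`) or `Φ₋(x,t;k)` (`l = atBot`), `k ∈ Σ`. -/
def jostMatrix (q : ℝ → ℝ → ℂ) (t : ℝ) (k : ℂ) (l : Filter ℝ) (x : ℝ) :
    Matrix (Fin 2) (Fin 2) ℂ :=
  Matrix.of fun i j => jostColumn q t k l j x i

/-- The scattering matrix `S(k)`, `k ∈ Σ`: the matrix, constant in `x`, with
`Φ₊(x,t;k) = Φ₋(x,t;k) S(k)`. -/
def scatteringMatrix (q : ℝ → ℝ → ℂ) (t : ℝ) (k : ℂ) : Matrix (Fin 2) (Fin 2) ℂ :=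
  Classical.epsilon fun S => ∀ x : ℝ, jostMatrix q t k atTop x = jostMatrix q t k atBot x * S

/-- The Wronskian `det [φ, ψ]` of two vectors in `ℂ²`. -/
def wronskian (φ ψ : Fin 2 → ℂ) : ℂ := φ 0 * ψ 1 - φ 1 * ψ 0

/-- The scattering coefficient `s₁₁ = Wr(Φ₊₁, Φ₋₂)` on `D⁺ ∪ Σ`
(the Wronskian does not depend on `x` as `X` is traceless). -/
def s11 (q : ℝ → ℝ → ℂ) (t : ℝ) (k : ℂ) : ℂ :=
  wronskian (jostColumn q t k atTop 0 0) (jostColumn q t k atBot 1 0)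

/-- The scattering coefficient `s₂₂ = Wr(Φ₋₁, Φ₊₂)` on `D⁻ ∪ Σ`. -/
def s22 (q : ℝ → ℝ → ℂ) (t : ℝ) (k : ℂ) : ℂ :=
  wronskian (jostColumn q t k atBot 0 0) (jostColumn q t k atTop 1 0)

/-- The reflection coefficient `ρ = s₂₁ / s₁₁` on `Σ`. -/
def rho (q : ℝ → ℝ → ℂ) (t : ℝ) (k : ℂ) : ℂ :=
  scatteringMatrix q t k 1 0 / scatteringMatrix q t k 0 0

/-- The reflection coefficient `ρ̃ = s₁₂ / s₂₂` on `Σ`. -/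
def rhoTilde (q : ℝ → ℝ → ℂ) (t : ℝ) (k : ℂ) : ℂ :=
  scatteringMatrix q t k 0 1 / scatteringMatrix q t k 1 1

/-- The potential is reflectionless: both reflection coefficients vanish on `Σ`. -/
def IsReflectionless (q : ℝ → ℝ → ℂ) (t : ℝ) : Prop :=
  ∀ k ∈ contour, rho q t k = 0 ∧ rhoTilde q t k = 0

/-- `v₀ = ½ ∫ |q(y,t)|² dy`. -/
def v0 (q : ℝ → ℝ → ℂ) (t : ℝ) : ℝ := (1 / 2) * ∫ y : ℝ, ‖q y t‖ ^ 2

/-- `f` is absolutely integrable along `Σ`, i.e. along each of its four rays. -/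
def ContourIntegrable (f : ℂ → ℂ) : Prop :=
  IntegrableOn (fun r : ℝ => f r) (Ioi 0) ∧
  IntegrableOn (fun r : ℝ => f (Complex.I * r)) (Ioi 0) ∧
  IntegrableOn (fun r : ℝ => f (-r)) (Ioi 0) ∧
  IntegrableOn (fun r : ℝ => f (-(Complex.I * r))) (Ioi 0)

/-- `∫_Σ f(ζ) dζ`, with `Σ` oriented so that `D⁺` lies on its left: the real half-axes
are traversed from `0` to `±∞`, the imaginary ones from `±i∞` to `0`. -/
def contourIntegral (f : ℂ → ℂ) : ℂ :=
  (∫ r in Ioi (0 : ℝ), f r) - Complex.I * (∫ r in Ioi (0 : ℝ), f (Complex.I * r))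
    - (∫ r in Ioi (0 : ℝ), f (-r)) + Complex.I * (∫ r in Ioi (0 : ℝ), f (-(Complex.I * r)))

/-- The integrand `log[1 - ρ(ζ) ρ̃(ζ)] / (ζ - k)` of the trace formula
(principal logarithm; `1 - ρ ρ̃` is a positive real number on `Σ`). -/
def traceIntegrand (q : ℝ → ℝ → ℂ) (t : ℝ) (k ζ : ℂ) : ℂ :=
  Complex.log (1 - rho q t ζ * rhoTilde q t ζ) / (ζ - k)

/-- `η₁, …, η_{2N} = k₁, …, k_N, -k₁, …, -k_N`. -/
def eta {N : ℕ} (k : Fin N → ℂ) : Fin (N + N) → ℂ := Fin.append k (fun n => -k n)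

end DNLS

end

/-!
In the variable `z = k²` the first Jost column at `+∞` is `e^{iθ} (u, k v)`, where `u` and `v` are
sums of Neumann series of iterated Volterra integrals, holomorphic for `Im z > 0` and continuous
for `Im z ≥ 0`. Complex conjugation and reflection in `x` carry it to the other three columns, so
`s₁₁` is a function `a` of `z` and `s₂₂(k)` is the conjugate of `s₁₁` at the conjugate of `k`.

The coupling `k q` of the system grows with `k`. The gauge transformation by `exp (i/2 ∫_x^∞
|q|²)` replaces it by couplings built from `q` and `q_x` alone, and one integration by parts then
gives `a(z) = e^{-iv₀} + O(1/z)`. Dividing `a` by `e^{-iv₀}` and by the Blaschke product of its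
zeros leaves a zero-free function which tends to `1`; its logarithm is recovered from `log |a|` on
the real line by the Schwarz formula. As `det S = 1` and `s₂₂` is the conjugate of `s₁₁` on `Σ`,
the integrand is `log (1 - ρ ρ̃) = -2 log |a|`, and `ζ ↦ ζ²` maps the rays of `Σ` in pairs onto
the real half-lines, which turns the integral over `Σ` into an integral over `ℝ`.

A reflectionless `a` is `e^{-iv₀}` times its Blaschke product. Since `a(0) = 1`, comparing
arguments at `z = 0` determines `v₀` modulo `2π`.
-/

noncomputable section

namespace DNLS

section ParametricIntegral

variable {α E : Type*} [MeasurableSpace α] {μ : Measure α} [NormedAddCommGroup E]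

theorem aestronglyMeasurable_deriv_param {𝕜 : Type*} [NontriviallyNormedField 𝕜]
    [NormedSpace 𝕜 E] {F : 𝕜 → α → E} {z₀ : 𝕜}
    (hmeas : ∀ᶠ z in 𝓝 z₀, AEStronglyMeasurable (F z) μ)
    (hdiff : ∀ a, DifferentiableAt 𝕜 (fun z => F z a) z₀) :
    AEStronglyMeasurable (fun a => deriv (fun z => F z a) z₀) μ := by
  classical
  refine aestronglyMeasurable_of_tendsto_ae (𝓝[≠] z₀)
    (f := fun z a => if AEStronglyMeasurable (F z) μ then slope (fun z => F z a) z₀ z else 0)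
    (fun z => ?_) (Eventually.of_forall fun a => ?_)
  · split_ifs with hz
    · simp only [slope_def_module]
      exact (hz.sub hmeas.self_of_nhds).const_smul (z - z₀)⁻¹
    · exact aestronglyMeasurable_const
  · refine (hasDerivAt_iff_tendsto_slope.1 (hdiff a).hasDerivAt).congr' ?_
    filter_upwards [hmeas.filter_mono nhdsWithin_le_nhds] with z hz
    rw [if_pos hz]

-- Cauchy's estimate turns the bound on the integrand into a bound on its derivative.
theorem differentiableOn_integral_of_dominated [NormedSpace ℂ E]
    {F : ℂ → α → E} {U : Set ℂ} (hU : IsOpen U) {bound : α → ℝ}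
    (hmeas : ∀ z ∈ U, AEStronglyMeasurable (F z) μ)
    (hbound : ∀ᵐ a ∂μ, ∀ z ∈ U, ‖F z a‖ ≤ bound a) (hint : Integrable bound μ)
    (hdiff : ∀ a, DifferentiableOn ℂ (fun z => F z a) U) :
    DifferentiableOn ℂ (fun z => ∫ a, F z a ∂μ) U := by
  intro z₀ hz₀
  obtain ⟨ε, hε, hball⟩ := Metric.isOpen_iff.1 hU z₀ hz₀
  have hdiffAt : ∀ a, ∀ z ∈ U, DifferentiableAt ℂ (fun z => F z a) z :=
    fun a z hz => (hdiff a).differentiableAt (hU.mem_nhds hz)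
  have hclosedBall : ∀ z ∈ Metric.ball z₀ (ε / 2), Metric.closedBall z (ε / 4) ⊆ U := by
    refine fun z hz => (Metric.closedBall_subset_ball' ?_).trans hball
    linarith [Metric.mem_ball.1 hz]
  have hderiv_le : ∀ᵐ a ∂μ, ∀ z ∈ Metric.ball z₀ (ε / 2),
      ‖deriv (fun z => F z a) z‖ ≤ bound a / (ε / 4) := by
    filter_upwards [hbound] with a ha z hz
    have hsub := hclosedBall z hz
    exact Complex.norm_deriv_le_of_forall_mem_sphere_norm_le (by positivity)
      ((hdiff a).diffContOnCl_ball hsub)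
      fun w hw => ha w (hsub (Metric.sphere_subset_closedBall hw))
  exact (hasDerivAt_integral_of_dominated_loc_of_deriv_le (Metric.ball_mem_nhds z₀ (half_pos hε))
    (mem_of_superset (hU.mem_nhds hz₀) hmeas)
    (hint.mono' (hmeas z₀ hz₀) (hbound.mono fun a ha => ha z₀ hz₀))
    (aestronglyMeasurable_deriv_param (mem_of_superset (hU.mem_nhds hz₀) hmeas)
      fun a => hdiffAt a z₀ hz₀)
    hderiv_le (hint.div_const _) (Eventually.of_forall fun a z hz =>
      (hdiffAt a z (hball (Metric.ball_subset_ball (by linarith) hz))).hasDerivAt)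
    ).2.differentiableAt.differentiableWithinAt

end ParametricIntegral

section Ioi

variable {E : Type*} [NormedAddCommGroup E] [NormedSpace ℝ E] [CompleteSpace E]

theorem hasDerivAt_integral_Ioi {h : ℝ → E} (hh : Continuous h)
    (hi : ∀ x, IntegrableOn h (Ioi x)) (x : ℝ) :
    HasDerivAt (fun x => ∫ y in Ioi x, h y) (-h x) x := by
  have hsplit : (fun x => ∫ y in Ioi x, h y) =
      fun x => (∫ y in Ioi 0, h y) - ∫ y in (0 : ℝ)..x, h y := by
    funext x
    rw [← intervalIntegral.integral_Ioi_sub_Ioi' (hi 0) (hi x), sub_sub_cancel]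
  rw [hsplit]
  exact (hh.integral_hasStrictDerivAt 0 x).hasDerivAt.const_sub _

theorem norm_sub_le_integral_Ioi_of_hasDerivAt {f f' : ℝ → E} {b : ℝ → ℝ} {l : E} {x : ℝ}
    (hf : ∀ y, HasDerivAt f (f' y) y) (hb : IntegrableOn b (Ioi x)) (hfb : ∀ y, ‖f' y‖ ≤ b y)
    (hl : Tendsto f atTop (𝓝 l)) : ‖f x - l‖ ≤ ∫ y in Ioi x, b y := by
  have hf' : f' = deriv f := funext fun y => (hf y).deriv.symm
  have hint : IntegrableOn f' (Ioi x) :=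
    hb.mono' (hf' ▸ aestronglyMeasurable_deriv f _) (Eventually.of_forall hfb)
  rw [norm_sub_rev, ← integral_Ioi_of_hasDerivAt_of_tendsto' (fun y _ => hf y) hint hl]
  exact norm_integral_le_of_norm_le hb (Eventually.of_forall hfb)

end Ioi

section Volterra

/-- The Volterra operator on `[x, ∞)` with kernel `exp (c (y - x))`; `-volterra c g` is the
solution of `u' = -c u + g` which vanishes at `+∞`. -/
def volterra (c : ℂ) (g : ℝ → ℂ) (x : ℝ) : ℂ := ∫ y in Ioi x, Complex.exp (c * (y - x)) * g y

variable {c : ℂ} {g : ℝ → ℂ} {x : ℝ}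

theorem norm_volterra_integrand_le (hc : c.re ≤ 0) {y : ℝ} (hxy : x ≤ y) :
    ‖Complex.exp (c * (y - x)) * g y‖ ≤ ‖g y‖ := by
  refine (norm_mul_le _ _).trans (mul_le_of_le_one_left (norm_nonneg _) ?_)
  rw [Complex.norm_exp, Real.exp_le_one_iff, ← Complex.ofReal_sub, Complex.re_mul_ofReal]
  exact mul_nonpos_of_nonpos_of_nonneg hc (sub_nonneg.2 hxy)

theorem ae_norm_volterra_integrand_le (hc : c.re ≤ 0) :
    ∀ᵐ y : ℝ ∂volume.restrict (Ioi x), ‖Complex.exp (c * (y - x)) * g y‖ ≤ ‖g y‖ := by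
  filter_upwards [ae_restrict_mem measurableSet_Ioi] with y hy
  exact norm_volterra_integrand_le hc (le_of_lt hy)

theorem norm_volterra_le (hc : c.re ≤ 0) {b : ℝ → ℝ} (hb : IntegrableOn b (Ioi x))
    (hgb : ∀ y, ‖g y‖ ≤ b y) : ‖volterra c g x‖ ≤ ∫ y in Ioi x, b y :=
  norm_integral_le_of_norm_le hb
    ((ae_norm_volterra_integrand_le hc).mono fun y hy => hy.trans (hgb y))

theorem volterra_eq_exp_mul (c : ℂ) (g : ℝ → ℂ) (x : ℝ) :
    volterra c g x = Complex.exp (-c * x) * ∫ y in Ioi x, Complex.exp (c * y) * g y := by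
  rw [volterra, ← integral_const_mul]
  refine integral_congr_ae (Eventually.of_forall fun y => ?_)
  simp only [← mul_assoc, ← Complex.exp_add]
  ring_nf

theorem integrableOn_exp_mul (hc : c.re ≤ 0) (hg : Continuous g) (hgi : Integrable g) (x : ℝ) :
    IntegrableOn (fun y : ℝ => Complex.exp (c * y) * g y) (Ioi x) := by
  have hint : IntegrableOn (fun y : ℝ => Complex.exp (c * (y - x)) * g y) (Ioi x) :=
    hgi.norm.integrableOn.mono' (Continuous.aestronglyMeasurable (by fun_prop))
      (ae_norm_volterra_integrand_le hc)
  refine (hint.const_mul (Complex.exp (c * x))).congr (Eventually.of_forall fun y => ?_)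
  simp only [← mul_assoc, ← Complex.exp_add]
  ring_nf

theorem hasDerivAt_volterra (hc : c.re ≤ 0) (hg : Continuous g) (hgi : Integrable g) (x : ℝ) :
    HasDerivAt (volterra c g) (-c * volterra c g x - g x) x := by
  rw [funext (volterra_eq_exp_mul c g)]
  have hexp : HasDerivAt (fun x : ℝ => Complex.exp (-c * x)) (Complex.exp (-c * x) * (-c * 1)) x :=
    ((Complex.ofRealCLM.hasDerivAt (x := x)).const_mul (-c)).cexp
  refine (hexp.mul (hasDerivAt_integral_Ioi (by fun_prop)
    (integrableOn_exp_mul hc hg hgi) x)).congr_deriv ?_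
  have hcancel : Complex.exp (-c * x) * Complex.exp (c * x) = 1 := by
    rw [← Complex.exp_add, neg_mul, neg_add_cancel, Complex.exp_zero]
  linear_combination (-(g x)) * hcancel

end Volterra

section VolterraParam

variable {S : Set ℂ} {c : ℂ → ℂ} {g : ℂ → ℝ → ℂ} {b : ℝ → ℝ}

theorem continuousOn_volterra_param (hc : ∀ z ∈ S, (c z).re ≤ 0) (hcc : ContinuousOn c S)
    (hg : ∀ z ∈ S, Continuous (g z)) (hb : Integrable b) (hgb : ∀ z ∈ S, ∀ y, ‖g z y‖ ≤ b y)
    (hgc : ∀ y, ContinuousOn (fun z => g z y) S) (x : ℝ) :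
    ContinuousOn (fun z => volterra (c z) (g z) x) S := by
  refine continuousOn_of_dominated (bound := b) (fun z hz => ?_) (fun z hz => ?_) hb.integrableOn
    (Eventually.of_forall fun y => ?_)
  · have := hg z hz
    exact Continuous.aestronglyMeasurable (by fun_prop)
  · exact (ae_norm_volterra_integrand_le (hc z hz)).mono fun y hy => hy.trans (hgb z hz y)
  · exact (hcc.mul continuousOn_const).cexp.mul (hgc y)

theorem differentiableOn_volterra_param (hS : IsOpen S) (hc : ∀ z ∈ S, (c z).re ≤ 0)
    (hcd : DifferentiableOn ℂ c S) (hg : ∀ z ∈ S, Continuous (g z)) (hb : Integrable b)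
    (hgb : ∀ z ∈ S, ∀ y, ‖g z y‖ ≤ b y) (hgd : ∀ y, DifferentiableOn ℂ (fun z => g z y) S)
    (x : ℝ) : DifferentiableOn ℂ (fun z => volterra (c z) (g z) x) S := by
  refine differentiableOn_integral_of_dominated hS (bound := b) (fun z hz => ?_) ?_
    hb.integrableOn fun y => ?_
  · have := hg z hz
    exact Continuous.aestronglyMeasurable (by fun_prop)
  · filter_upwards [ae_restrict_mem measurableSet_Ioi] with y hy z hz
    exact (norm_volterra_integrand_le (hc z hz) (le_of_lt hy)).trans (hgb z hz y)
  · exact (hcd.mul (differentiableOn_const _)).cexp.mul (hgd y)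

end VolterraParam

section TailMass

/-- The mass `∫_x^∞ W` of `W` to the right of `x`. -/
def tailMass (W : ℝ → ℝ) (x : ℝ) : ℝ := ∫ y in Ioi x, W y

variable {W : ℝ → ℝ}

theorem tailMass_nonneg (hW : ∀ y, 0 ≤ W y) (x : ℝ) : 0 ≤ tailMass W x :=
  integral_nonneg hW

theorem tailMass_le (hW : ∀ y, 0 ≤ W y) (hi : Integrable W) (x : ℝ) : tailMass W x ≤ ∫ y, W y :=
  setIntegral_le_integral hi (Eventually.of_forall hW)

theorem tendsto_tailMass_atTop (W : ℝ → ℝ) : Tendsto (tailMass W) atTop (𝓝 0) :=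
  tendsto_integral_Ioi_zero tendsto_id

theorem hasDerivAt_tailMass (hc : Continuous W) (hi : Integrable W) (x : ℝ) :
    HasDerivAt (tailMass W) (-W x) x :=
  hasDerivAt_integral_Ioi hc (fun _ => hi.integrableOn) x

theorem continuous_tailMass (hc : Continuous W) (hi : Integrable W) : Continuous (tailMass W) :=
  continuous_iff_continuousAt.2 fun x => (hasDerivAt_tailMass hc hi x).continuousAt

variable (hW : ∀ y, 0 ≤ W y) (hc : Continuous W) (hi : Integrable W)
include hW hc hi

theorem integrable_mul_tailMass_pow (n : ℕ) : Integrable fun y => W y * tailMass W y ^ n := by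
  refine (hi.mul_const ((∫ y, W y) ^ n)).mono'
    (hc.mul ((continuous_tailMass hc hi).pow n)).aestronglyMeasurable
    (Eventually.of_forall fun y => ?_)
  have hmass := tailMass_nonneg hW y
  have hWy := hW y
  rw [Real.norm_of_nonneg (by positivity)]
  gcongr
  exact tailMass_le hW hi y

theorem integral_mul_tailMass_pow (n : ℕ) (x : ℝ) :
    ∫ y in Ioi x, W y * tailMass W y ^ n = tailMass W x ^ (n + 1) / (n + 1) := by
  have hderiv : ∀ y, HasDerivAt (fun y => -(tailMass W y ^ (n + 1) / (n + 1)))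
      (W y * tailMass W y ^ n) y := by
    intro y
    refine (((hasDerivAt_tailMass hc hi y).pow (n + 1)).div_const ((n : ℝ) + 1)).neg.congr_deriv ?_
    have : (n : ℝ) + 1 ≠ 0 := by positivity
    push_cast
    field_simp
  have hlim : Tendsto (fun y => -(tailMass W y ^ (n + 1) / ((n : ℝ) + 1))) atTop (𝓝 0) := by
    simpa using (((tendsto_tailMass_atTop W).pow (n + 1)).div_const ((n : ℝ) + 1)).neg
  rw [integral_Ioi_of_hasDerivAt_of_tendsto' (fun y _ => hderiv y)
    (integrable_mul_tailMass_pow hW hc hi n).integrableOn hlim, zero_sub, neg_neg]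

end TailMass

section VolterraIterate

/-- The iterates of the Volterra operators `g ↦ -volterra (c n) (w n * g)`, applied to the
constant function `1`. -/
def volterraIterate (c : ℕ → ℂ) (w : ℕ → ℝ → ℂ) : ℕ → ℝ → ℂ
  | 0 => fun _ => 1
  | n + 1 => fun x => -volterra (c n) (fun y => w n y * volterraIterate c w n y) x

variable {c : ℕ → ℂ} {w : ℕ → ℝ → ℂ} {W : ℝ → ℝ}

section Bounds

variable (hc : ∀ n, (c n).re ≤ 0) (hW : ∀ n y, ‖w n y‖ ≤ W y) (hWc : Continuous W)
  (hWi : Integrable W)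
include hc hW hWc hWi

theorem norm_volterraIterate_le (n : ℕ) (x : ℝ) :
    ‖volterraIterate c w n x‖ ≤ tailMass W x ^ n / n.factorial := by
  have hW0 : ∀ y, 0 ≤ W y := fun y => (norm_nonneg _).trans (hW 0 y)
  induction n generalizing x with
  | zero => simp [volterraIterate]
  | succ n ih =>
    have hint : IntegrableOn (fun y => (W y * tailMass W y ^ n) / n.factorial) (Ioi x) :=
      ((integrable_mul_tailMass_pow hW0 hWc hWi n).div_const _).integrableOn
    have hbound : ∀ y, ‖w n y * volterraIterate c w n y‖ ≤
        (W y * tailMass W y ^ n) / n.factorial := fun y => by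
      rw [norm_mul, mul_div_assoc]
      exact mul_le_mul (hW n y) (ih y) (norm_nonneg _) (hW0 y)
    calc ‖volterraIterate c w (n + 1) x‖
        ≤ ∫ y in Ioi x, (W y * tailMass W y ^ n) / n.factorial := by
          rw [volterraIterate, norm_neg]
          exact norm_volterra_le (hc n) hint hbound
      _ = tailMass W x ^ (n + 1) / (n + 1).factorial := by
          rw [integral_div, integral_mul_tailMass_pow hW0 hWc hWi, Nat.factorial_succ, div_div]
          push_cast
          rfl

theorem norm_volterraIterate_le_const (n : ℕ) (x : ℝ) :
    ‖volterraIterate c w n x‖ ≤ (∫ y, W y) ^ n / n.factorial := by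
  have hW0 : ∀ y, 0 ≤ W y := fun y => (norm_nonneg _).trans (hW 0 y)
  refine (norm_volterraIterate_le hc hW hWc hWi n x).trans ?_
  have := tailMass_nonneg hW0 x
  gcongr
  exact tailMass_le hW0 hWi x

theorem norm_mul_volterraIterate_le (n : ℕ) (x : ℝ) :
    ‖w n x * volterraIterate c w n x‖ ≤ W x * ((∫ y, W y) ^ n / n.factorial) := by
  rw [norm_mul]
  exact mul_le_mul (hW n x) (norm_volterraIterate_le_const hc hW hWc hWi n x) (norm_nonneg _)
    ((norm_nonneg _).trans (hW n x))

theorem tendsto_volterraIterate_succ_atTop (n : ℕ) :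
    Tendsto (volterraIterate c w (n + 1)) atTop (𝓝 0) := by
  refine squeeze_zero_norm (norm_volterraIterate_le hc hW hWc hWi (n + 1)) ?_
  simpa using ((tendsto_tailMass_atTop W).pow (n + 1)).div_const ((n + 1).factorial : ℝ)

theorem summable_volterraIterate_comp {σ : ℕ → ℕ} (hσ : Function.Injective σ) (x : ℝ) :
    Summable fun n => volterraIterate c w (σ n) x :=
  .of_norm_bounded ((Real.summable_pow_div_factorial (∫ y, W y)).comp_injective hσ)
    fun n => norm_volterraIterate_le_const hc hW hWc hWi (σ n) x

theorem tendsto_tsum_volterraIterate_succ_atTop {σ : ℕ → ℕ} (hσ : Function.Injective σ) :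
    Tendsto (fun x => ∑' n, volterraIterate c w (σ n + 1) x) atTop (𝓝 0) := by
  have h := tendsto_tsum_of_dominated_convergence (𝓕 := atTop)
    (f := fun x n => volterraIterate c w (σ n + 1) x) (g := fun _ => 0)
    ((Real.summable_pow_div_factorial (∫ y, W y)).comp_injective
      ((add_left_injective 1).comp hσ))
    (fun n => tendsto_volterraIterate_succ_atTop hc hW hWc hWi (σ n))
    (Eventually.of_forall fun x n => norm_volterraIterate_le_const hc hW hWc hWi (σ n + 1) x)
  rwa [tsum_zero] at h

variable (hw : ∀ n, Continuous (w n))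
include hw

theorem integrable_mul_volterraIterate {n : ℕ} (hcont : Continuous (volterraIterate c w n)) :
    Integrable fun y => w n y * volterraIterate c w n y :=
  (hWi.mul_const _).mono' ((hw n).mul hcont).aestronglyMeasurable
    (Eventually.of_forall (norm_mul_volterraIterate_le hc hW hWc hWi n))

theorem continuous_volterraIterate (n : ℕ) : Continuous (volterraIterate c w n) := by
  induction n with
  | zero => exact continuous_const
  | succ n ih =>
    exact continuous_iff_continuousAt.2 fun x => (hasDerivAt_volterra (hc n) ((hw n).mul ih)
      (integrable_mul_volterraIterate hc hW hWc hWi hw ih) x).neg.continuousAt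

theorem hasDerivAt_volterraIterate_succ (n : ℕ) (x : ℝ) :
    HasDerivAt (volterraIterate c w (n + 1))
      (-c n * volterraIterate c w (n + 1) x + w n x * volterraIterate c w n x) x := by
  have hcont := continuous_volterraIterate hc hW hWc hWi hw n
  have hderiv := (hasDerivAt_volterra (hc n) (g := fun y => w n y * volterraIterate c w n y)
    ((hw n).mul hcont) (integrable_mul_volterraIterate hc hW hWc hWi hw hcont) x).neg
  refine hderiv.congr_deriv ?_
  rw [volterraIterate]
  ring

theorem hasDerivAt_tsum_volterraIterate_succ {σ : ℕ → ℕ} (hσ : Function.Injective σ) {B : ℝ}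
    (hB : ∀ n, ‖c n‖ ≤ B) (x : ℝ) :
    HasDerivAt (fun x => ∑' n, volterraIterate c w (σ n + 1) x)
      (∑' n, (-c (σ n) * volterraIterate c w (σ n + 1) x +
        w (σ n) x * volterraIterate c w (σ n) x)) x := by
  obtain ⟨M, hM⟩ := isCompact_Icc.exists_bound_of_continuousOn (s := Icc (x - 1) (x + 1))
    hWc.continuousOn
  have hexp := Real.summable_pow_div_factorial (∫ y, W y)
  have hx : x ∈ Ioo (x - 1) (x + 1) := by simp
  refine hasDerivAt_tsum_of_isPreconnected
    (u := fun n => B * ((∫ y, W y) ^ (σ n + 1) / (σ n + 1).factorial) +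
      M * ((∫ y, W y) ^ σ n / (σ n).factorial))
    (((hexp.comp_injective ((add_left_injective 1).comp hσ)).mul_left B).add
      ((hexp.comp_injective hσ).mul_left M)) isOpen_Ioo isPreconnected_Ioo
    (fun n y _ => hasDerivAt_volterraIterate_succ hc hW hWc hWi hw (σ n) y) (fun n y hy => ?_) hx
    (summable_volterraIterate_comp hc hW hWc hWi ((add_left_injective 1).comp hσ) x) hx
  have hWM : W y ≤ M := (le_abs_self _).trans (hM y (Ioo_subset_Icc_self hy))
  have hWI : 0 ≤ ∫ y, W y := integral_nonneg fun y => (norm_nonneg _).trans (hW 0 y)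
  refine (norm_add_le _ _).trans (add_le_add ?_ ?_)
  · rw [norm_mul, norm_neg]
    exact mul_le_mul (hB _) (norm_volterraIterate_le_const hc hW hWc hWi _ y) (norm_nonneg _)
      ((norm_nonneg _).trans (hB 0))
  · exact (norm_mul_volterraIterate_le hc hW hWc hWi _ y).trans (by gcongr)

end Bounds

section Param

variable {S : Set ℂ} {c : ℂ → ℕ → ℂ} {w : ℂ → ℕ → ℝ → ℂ}
  (hc : ∀ z ∈ S, ∀ n, (c z n).re ≤ 0) (hW : ∀ z ∈ S, ∀ n y, ‖w z n y‖ ≤ W y)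
  (hWc : Continuous W) (hWi : Integrable W) (hw : ∀ z ∈ S, ∀ n, Continuous (w z n))
include hc hW hWc hWi hw

theorem continuousOn_volterraIterate_param (hcc : ∀ n, ContinuousOn (fun z => c z n) S)
    (hwc : ∀ n y, ContinuousOn (fun z => w z n y) S) (n : ℕ) (x : ℝ) :
    ContinuousOn (fun z => volterraIterate (c z) (w z) n x) S := by
  induction n generalizing x with
  | zero => exact continuousOn_const
  | succ n ih =>
    exact (continuousOn_volterra_param (fun z hz => hc z hz n) (hcc n)
      (fun z hz => (hw z hz n).mul
        (continuous_volterraIterate (hc z hz) (hW z hz) hWc hWi (hw z hz) n))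
      (hWi.mul_const _) (fun z hz => norm_mul_volterraIterate_le (hc z hz) (hW z hz) hWc hWi n)
      (fun y => (hwc n y).mul (ih y)) x).neg

theorem differentiableOn_volterraIterate_param (hS : IsOpen S)
    (hcd : ∀ n, DifferentiableOn ℂ (fun z => c z n) S)
    (hwd : ∀ n y, DifferentiableOn ℂ (fun z => w z n y) S) (n : ℕ) (x : ℝ) :
    DifferentiableOn ℂ (fun z => volterraIterate (c z) (w z) n x) S := by
  induction n generalizing x with
  | zero => exact differentiableOn_const _
  | succ n ih =>
    exact (differentiableOn_volterra_param hS (fun z hz => hc z hz n) (hcd n)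
      (fun z hz => (hw z hz n).mul
        (continuous_volterraIterate (hc z hz) (hW z hz) hWc hWi (hw z hz) n))
      (hWi.mul_const _) (fun z hz => norm_mul_volterraIterate_le (hc z hz) (hW z hz) hWc hWi n)
      (fun y => (hwd n y).mul (ih y)) x).neg

theorem continuousOn_tsum_volterraIterate_param (hcc : ∀ n, ContinuousOn (fun z => c z n) S)
    (hwc : ∀ n y, ContinuousOn (fun z => w z n y) S) {σ : ℕ → ℕ} (hσ : Function.Injective σ)
    (x : ℝ) : ContinuousOn (fun z => ∑' n, volterraIterate (c z) (w z) (σ n) x) S :=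
  continuousOn_tsum
    (fun n => continuousOn_volterraIterate_param hc hW hWc hWi hw hcc hwc (σ n) x)
    ((Real.summable_pow_div_factorial (∫ y, W y)).comp_injective hσ)
    fun n z hz => norm_volterraIterate_le_const (hc z hz) (hW z hz) hWc hWi (σ n) x

theorem differentiableOn_tsum_volterraIterate_param (hS : IsOpen S)
    (hcd : ∀ n, DifferentiableOn ℂ (fun z => c z n) S)
    (hwd : ∀ n y, DifferentiableOn ℂ (fun z => w z n y) S) {σ : ℕ → ℕ}
    (hσ : Function.Injective σ) (x : ℝ) :
    DifferentiableOn ℂ (fun z => ∑' n, volterraIterate (c z) (w z) (σ n) x) S :=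
  Complex.differentiableOn_tsum_of_summable_norm
    ((Real.summable_pow_div_factorial (∫ y, W y)).comp_injective hσ)
    (fun n => differentiableOn_volterraIterate_param hc hW hWc hWi hw hS hcd hwd (σ n) x) hS
    fun n z hz => norm_volterraIterate_le_const (hc z hz) (hW z hz) hWc hWi (σ n) x

end Param

end VolterraIterate

section Energy

theorem le_mul_exp_integral_of_hasDerivAt_ge {f f' K : ℝ → ℝ} {l : ℝ} (hK : Continuous K)
    (hKi : Integrable K) (hK0 : ∀ x, 0 ≤ K x) (hf : ∀ x, HasDerivAt f (f' x) x)
    (hf' : ∀ x, -(K x * f x) ≤ f' x) (hl : Tendsto f atTop (𝓝 l)) (hl0 : 0 ≤ l) (x : ℝ) :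
    f x ≤ l * Real.exp (∫ y, K y) := by
  have hderiv : ∀ x, HasDerivAt (fun x => f x * Real.exp (-tailMass K x))
      (f' x * Real.exp (-tailMass K x) + f x * (Real.exp (-tailMass K x) * - -K x)) x :=
    fun x => (hf x).mul (hasDerivAt_tailMass hK hKi x).neg.exp
  have hmono : Monotone fun x => f x * Real.exp (-tailMass K x) := by
    refine monotone_of_deriv_nonneg (fun x => (hderiv x).differentiableAt) fun x => ?_
    have : 0 ≤ (f' x + K x * f x) * Real.exp (-tailMass K x) :=
      mul_nonneg (by linarith [hf' x]) (Real.exp_pos _).le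
    rw [(hderiv x).deriv]
    linarith
  have hlim : Tendsto (fun x => f x * Real.exp (-tailMass K x)) atTop (𝓝 l) := by
    simpa using hl.mul (tendsto_tailMass_atTop K).neg.rexp
  calc f x = f x * Real.exp (-tailMass K x) * Real.exp (tailMass K x) := by
        rw [mul_assoc, ← Real.exp_add, neg_add_cancel, Real.exp_zero, mul_one]
    _ ≤ l * Real.exp (∫ y, K y) := by
        gcongr
        · exact hmono.ge_of_tendsto hlim x
        · exact tailMass_le hK0 hKi x

variable {p r u v : ℝ → ℂ} {e : ℂ}

theorem norm_sq_add_norm_sq_le_of_hasDerivAt {l : ℝ} (hp : Continuous p) (hpi : Integrable p)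
    (hr : Continuous r) (hri : Integrable r) (he : 0 ≤ e.re)
    (hu : ∀ x, HasDerivAt u (p x * v x) x) (hv : ∀ x, HasDerivAt v (e * v x + r x * u x) x)
    (hl : Tendsto (fun x => ‖u x‖ ^ 2 + ‖v x‖ ^ 2) atTop (𝓝 l)) (x : ℝ) :
    ‖u x‖ ^ 2 + ‖v x‖ ^ 2 ≤ l * Real.exp (∫ y, (‖p y‖ + ‖r y‖)) := by
  refine le_mul_exp_integral_of_hasDerivAt_ge (K := fun y => ‖p y‖ + ‖r y‖) (by fun_prop)
    (hpi.norm.add hri.norm) (fun y => by positivity)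
    (fun y => (hu y).norm_sq.add (hv y).norm_sq) (fun y => ?_) hl
    (ge_of_tendsto' hl fun y => by positivity) x
  have hinner : ∀ a b c : ℂ, -(‖a‖ * (‖c‖ * ‖b‖)) ≤ inner ℝ a (c * b) := fun a b c => by
    rw [← norm_mul]
    exact neg_le_of_abs_le (abs_real_inner_le_norm _ _)
  have hdissipative : 0 ≤ inner ℝ (v y) (e * v y) := by
    rw [Complex.inner, mul_assoc, Complex.mul_conj, Complex.re_mul_ofReal]
    exact mul_nonneg he (Complex.normSq_nonneg _)
  rw [inner_add_right]
  change -((‖p y‖ + ‖r y‖) * (‖u y‖ ^ 2 + ‖v y‖ ^ 2)) ≤ _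
  linarith [hinner (u y) (v y) (p y), hinner (v y) (u y) (r y),
    mul_nonneg (add_nonneg (norm_nonneg (p y)) (norm_nonneg (r y)))
      (sq_nonneg (‖u y‖ - ‖v y‖))]

end Energy

section JostPair

/-- `(u, v)` is the Jost solution at `+∞` of the system `u' = p v`, `v' = e v + r u` with
off-diagonal coupling: the solution tending to `(1, 0)`. -/
structure IsJostPair (p r : ℝ → ℂ) (e : ℂ) (u v : ℝ → ℂ) : Prop where
  hasDerivAt_fst : ∀ x, HasDerivAt u (p x * v x) x
  hasDerivAt_snd : ∀ x, HasDerivAt v (e * v x + r x * u x) x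
  tendsto_fst : Tendsto u atTop (𝓝 1)
  tendsto_snd : Tendsto v atTop (𝓝 0)

variable {p r u v : ℝ → ℂ} {e : ℂ}

theorem IsJostPair.const_mul_snd {k : ℂ} (h : IsJostPair (fun x => k * p x) r e u v) :
    IsJostPair p (fun x => k * r x) e u fun x => k * v x where
  hasDerivAt_fst x := (h.hasDerivAt_fst x).congr_deriv (by ring)
  hasDerivAt_snd x := ((h.hasDerivAt_snd x).const_mul k).congr_deriv (by ring)
  tendsto_fst := h.tendsto_fst
  tendsto_snd := by simpa using h.tendsto_snd.const_mul k

-- Integration by parts in `u' = p v`: the oscillating part is an exact derivative, up to terms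
-- carrying the small factor `e⁻¹`.
theorem IsJostPair.hasDerivAt_fst_sub_mul_snd_div (h : IsJostPair p r e u v) (hne : e ≠ 0)
    {p' : ℝ → ℂ} (hp' : ∀ x, HasDerivAt p (p' x) x) (x : ℝ) :
    HasDerivAt (fun x => u x - p x * v x / e)
      (-((p' x * v x + p x * (r x * u x)) / e)) x :=
  ((h.hasDerivAt_fst x).sub (((hp' x).mul (h.hasDerivAt_snd x)).div_const e)).congr_deriv
    (by field_simp; ring)

section Bounds

variable (hp : Continuous p) (hpi : Integrable p) (hr : Continuous r) (hri : Integrable r)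
  (he : 0 ≤ e.re)
include hp hpi hr hri he

theorem IsJostPair.unique {u' v' : ℝ → ℂ} (h : IsJostPair p r e u v)
    (h' : IsJostPair p r e u' v') : u = u' ∧ v = v' := by
  have hlim : Tendsto (fun x => ‖u x - u' x‖ ^ 2 + ‖v x - v' x‖ ^ 2) atTop (𝓝 0) := by
    simpa using ((h.tendsto_fst.sub h'.tendsto_fst).norm.pow 2).add
      ((h.tendsto_snd.sub h'.tendsto_snd).norm.pow 2)
  have hzero : ∀ x, ‖u x - u' x‖ ^ 2 + ‖v x - v' x‖ ^ 2 ≤ 0 := fun x => by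
    simpa using norm_sq_add_norm_sq_le_of_hasDerivAt hp hpi hr hri he
      (u := fun x => u x - u' x) (v := fun x => v x - v' x)
      (fun y => ((h.hasDerivAt_fst y).sub (h'.hasDerivAt_fst y)).congr_deriv (by ring))
      (fun y => ((h.hasDerivAt_snd y).sub (h'.hasDerivAt_snd y)).congr_deriv (by ring)) hlim x
  constructor <;> funext x <;> rw [← sub_eq_zero, ← norm_eq_zero, ← sq_eq_zero_iff] <;>
    linarith [hzero x, sq_nonneg ‖u x - u' x‖, sq_nonneg ‖v x - v' x‖]

theorem IsJostPair.norm_le (h : IsJostPair p r e u v) (x : ℝ) :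
    ‖u x‖ ≤ Real.exp (∫ y, (‖p y‖ + ‖r y‖)) ∧ ‖v x‖ ≤ Real.exp (∫ y, (‖p y‖ + ‖r y‖)) := by
  have hlim : Tendsto (fun x => ‖u x‖ ^ 2 + ‖v x‖ ^ 2) atTop (𝓝 1) := by
    simpa using (h.tendsto_fst.norm.pow 2).add (h.tendsto_snd.norm.pow 2)
  have henergy := norm_sq_add_norm_sq_le_of_hasDerivAt hp hpi hr hri he h.hasDerivAt_fst
    h.hasDerivAt_snd hlim x
  have hone : 1 ≤ Real.exp (∫ y, (‖p y‖ + ‖r y‖)) :=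
    Real.one_le_exp (integral_nonneg fun y => by positivity)
  constructor <;> nlinarith [sq_nonneg ‖u x‖, sq_nonneg ‖v x‖]

theorem IsJostPair.norm_fst_sub_one_le (h : IsJostPair p r e u v) (hne : e ≠ 0) {p' : ℝ → ℂ}
    (hp' : ∀ x, HasDerivAt p (p' x) x) (hp'i : Integrable p') {P : ℝ} (hP : ∀ x, ‖p x‖ ≤ P)
    (x : ℝ) : ‖u x - 1‖ ≤
      Real.exp (∫ y, (‖p y‖ + ‖r y‖)) * ((∫ y, (‖p' y‖ + P * ‖r y‖)) + P) / ‖e‖ := by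
  set M := Real.exp (∫ y, (‖p y‖ + ‖r y‖))
  have hM := h.norm_le hp hpi hr hri he
  have hP0 : 0 ≤ P := (norm_nonneg _).trans (hP 0)
  have hbound : ∀ y, ‖-((p' y * v y + p y * (r y * u y)) / e)‖ ≤
      M / ‖e‖ * (‖p' y‖ + P * ‖r y‖) := fun y => by
    rw [norm_neg, norm_div, div_mul_eq_mul_div]
    gcongr
    calc ‖p' y * v y + p y * (r y * u y)‖ ≤ ‖p' y‖ * M + P * (‖r y‖ * M) := by
          refine (norm_add_le _ _).trans ?_
          rw [norm_mul, norm_mul, norm_mul]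
          gcongr
          exacts [(hM y).2, hP y, (hM y).1]
      _ = M * (‖p' y‖ + P * ‖r y‖) := by ring
  have hpv : Tendsto (fun y => p y * v y) atTop (𝓝 0) :=
    h.tendsto_snd.zero_mul_isBoundedUnder_le (isBoundedUnder_of ⟨P, hP⟩) |>.congr
      fun y => mul_comm _ _
  have hlim : Tendsto (fun y => u y - p y * v y / e) atTop (𝓝 1) := by
    simpa using h.tendsto_fst.sub (hpv.div_const e)
  have hint : Integrable fun y => ‖p' y‖ + P * ‖r y‖ := hp'i.norm.add (hri.norm.const_mul P)
  have htail : ∫ y in Ioi x, (‖p' y‖ + P * ‖r y‖) ≤ ∫ y, (‖p' y‖ + P * ‖r y‖) :=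
    setIntegral_le_integral hint (Eventually.of_forall fun y => by positivity)
  calc ‖u x - 1‖ = ‖(u x - p x * v x / e - 1) + p x * v x / e‖ := by ring_nf
    _ ≤ M / ‖e‖ * (∫ y, (‖p' y‖ + P * ‖r y‖)) + P * M / ‖e‖ := by
        refine (norm_add_le _ _).trans (add_le_add ?_ ?_)
        · refine (norm_sub_le_integral_Ioi_of_hasDerivAt (h.hasDerivAt_fst_sub_mul_snd_div hne hp')
            (hint.const_mul _).integrableOn hbound hlim).trans ?_
          rw [integral_const_mul]
          gcongr
        · rw [norm_div, norm_mul]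
          gcongr
          exacts [hP x, (hM x).2]
    _ = M * ((∫ y, (‖p' y‖ + P * ‖r y‖)) + P) / ‖e‖ := by ring

end Bounds

/-- The rates for which the Volterra iterates are the terms of the Neumann series of the Jost
pair: the even iterates contribute to `u`, the odd ones to `v`. -/
def jostRate (e : ℂ) (n : ℕ) : ℂ := if Even n then -e else 0

/-- The weights that accompany the rates `jostRate`. -/
def jostWeight (p r : ℝ → ℂ) (n : ℕ) : ℝ → ℂ := if Even n then r else p

/-- The first component of the Jost solution at `+∞`, by its Neumann series. -/
def jostFst (p r : ℝ → ℂ) (e : ℂ) (x : ℝ) : ℂ :=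
  ∑' n, volterraIterate (jostRate e) (jostWeight p r) (2 * n) x

/-- The second component of the Jost solution at `+∞`, by its Neumann series. -/
def jostSnd (p r : ℝ → ℂ) (e : ℂ) (x : ℝ) : ℂ :=
  ∑' n, volterraIterate (jostRate e) (jostWeight p r) (2 * n + 1) x

@[simp] theorem jostRate_two_mul (e : ℂ) (n : ℕ) : jostRate e (2 * n) = -e :=
  if_pos (even_two_mul n)

@[simp] theorem jostRate_two_mul_add_one (e : ℂ) (n : ℕ) : jostRate e (2 * n + 1) = 0 :=
  if_neg (Nat.not_even_two_mul_add_one n)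

@[simp] theorem jostWeight_two_mul (p r : ℝ → ℂ) (n : ℕ) : jostWeight p r (2 * n) = r :=
  if_pos (even_two_mul n)

@[simp] theorem jostWeight_two_mul_add_one (p r : ℝ → ℂ) (n : ℕ) :
    jostWeight p r (2 * n + 1) = p :=
  if_neg (Nat.not_even_two_mul_add_one n)

theorem jostRate_re_nonpos (he : 0 ≤ e.re) (n : ℕ) : (jostRate e n).re ≤ 0 := by
  rw [jostRate]
  split_ifs <;> simp [he]

theorem norm_jostRate_le (e : ℂ) (n : ℕ) : ‖jostRate e n‖ ≤ ‖e‖ := by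
  rw [jostRate]
  split_ifs <;> simp

theorem norm_jostWeight_le (p r : ℝ → ℂ) (n : ℕ) (x : ℝ) :
    ‖jostWeight p r n x‖ ≤ ‖p x‖ + ‖r x‖ := by
  rw [jostWeight]
  split_ifs <;> simp

theorem continuous_jostWeight (hp : Continuous p) (hr : Continuous r) (n : ℕ) :
    Continuous (jostWeight p r n) := by
  rw [jostWeight]
  split_ifs <;> assumption

theorem injective_two_mul_add (m : ℕ) : Function.Injective fun n : ℕ => 2 * n + m :=
  fun a b (h : 2 * a + m = 2 * b + m) => by lia

theorem jostFst_zero_left (r : ℝ → ℂ) (e : ℂ) (x : ℝ) : jostFst 0 r e x = 1 := by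
  rw [jostFst, tsum_eq_single 0]
  · rfl
  · intro n hn
    obtain ⟨m, rfl⟩ := Nat.exists_eq_succ_of_ne_zero hn
    change -volterra _ _ x = 0
    simp [volterra]

variable (hp : Continuous p) (hpi : Integrable p) (hr : Continuous r) (hri : Integrable r)
  (he : 0 ≤ e.re)
include hp hpi hr hri he

theorem isJostPair_jost : IsJostPair p r e (jostFst p r e) (jostSnd p r e) := by
  have hc := jostRate_re_nonpos he
  have hW := norm_jostWeight_le p r
  have hWc : Continuous fun x => ‖p x‖ + ‖r x‖ := by fun_prop
  have hWi : Integrable fun x => ‖p x‖ + ‖r x‖ := hpi.norm.add hri.norm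
  have hw := continuous_jostWeight hp hr
  have hsum_even : ∀ x, Summable fun n =>
      volterraIterate (jostRate e) (jostWeight p r) (2 * n) x :=
    summable_volterraIterate_comp hc hW hWc hWi (injective_two_mul_add 0)
  have hsum_odd := summable_volterraIterate_comp hc hW hWc hWi (injective_two_mul_add 1)
  have hfst : jostFst p r e = fun x =>
      1 + ∑' n, volterraIterate (jostRate e) (jostWeight p r) (2 * n + 1 + 1) x :=
    funext fun x => (hsum_even x).tsum_eq_zero_add
  refine ⟨fun x => ?_, fun x => ?_, ?_, ?_⟩
  · rw [hfst, jostSnd, ← tsum_mul_left]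
    refine ((hasDerivAt_tsum_volterraIterate_succ hc hW hWc hWi hw (injective_two_mul_add 1)
      (norm_jostRate_le e) x).const_add 1).congr_deriv (tsum_congr fun n => ?_)
    simp
  · rw [jostSnd, jostFst, ← tsum_mul_left, ← tsum_mul_left,
      ← ((hsum_odd x).mul_left e).tsum_add ((hsum_even x).mul_left (r x))]
    refine (hasDerivAt_tsum_volterraIterate_succ hc hW hWc hWi hw (injective_two_mul_add 0)
      (norm_jostRate_le e) x).congr_deriv (tsum_congr fun n => ?_)
    simp
  · rw [hfst]
    simpa using (tendsto_tsum_volterraIterate_succ_atTop hc hW hWc hWi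
      (injective_two_mul_add 1)).const_add 1
  · exact tendsto_tsum_volterraIterate_succ_atTop hc hW hWc hWi (injective_two_mul_add 0)

end JostPair

section SpectralParameter

/-- The first component of the Jost solution `e^{-iθ} Φ₊₁` as a function of `z = k²`. It is even
in `k`. -/
def jostEven (q : ℝ → ℂ) (z : ℂ) : ℝ → ℂ :=
  jostFst (fun x => z * q x) (fun x => -(starRingEnd ℂ) (q x)) (-(2 * Complex.I * z))

/-- The second component of the Jost solution `e^{-iθ} Φ₊₁`, divided by `k`, as a function of
`z = k²`. -/
def jostOdd (q : ℝ → ℂ) (z : ℂ) : ℝ → ℂ :=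
  jostSnd (fun x => z * q x) (fun x => -(starRingEnd ℂ) (q x)) (-(2 * Complex.I * z))

theorem jostEven_zero (q : ℝ → ℂ) (x : ℝ) : jostEven q 0 x = 1 := by
  have : (fun x => 0 * q x) = 0 := funext fun x => zero_mul (q x)
  rw [jostEven, this, jostFst_zero_left]

theorem neg_two_I_mul_re_nonneg {z : ℂ} (hz : 0 ≤ z.im) : 0 ≤ (-(2 * Complex.I * z)).re := by
  simpa using hz

variable {q : ℝ → ℂ}

theorem integrable_conj (hi : Integrable q) : Integrable fun x => (starRingEnd ℂ) (q x) :=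
  (Complex.conjCLE : ℂ →L[ℝ] ℂ).integrable_comp hi

theorem norm_jostWeight_mul_conj_le {R : ℝ} {z : ℂ} (hz : ‖z‖ ≤ R) (n : ℕ) (y : ℝ) :
    ‖jostWeight (fun x => z * q x) (fun x => -(starRingEnd ℂ) (q x)) n y‖ ≤ (R + 1) * ‖q y‖ := by
  refine (norm_jostWeight_le _ _ n y).trans ?_
  rw [norm_mul, norm_neg, RCLike.norm_conj, add_one_mul]
  gcongr

theorem continuousOn_of_forall_ball {f : ℂ → ℂ}
    (h : ∀ R : ℝ, ContinuousOn f {z | 0 ≤ z.im ∧ ‖z‖ ≤ R}) : ContinuousOn f {z | 0 ≤ z.im} := by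
  intro z hz
  refine ((h (‖z‖ + 1)) z ⟨hz, by linarith⟩).mono_of_mem_nhdsWithin ?_
  filter_upwards [self_mem_nhdsWithin, mem_nhdsWithin_of_mem_nhds
    ((isOpen_lt continuous_norm continuous_const).mem_nhds (lt_add_one ‖z‖))] with w hw hw'
  exact ⟨hw, le_of_lt hw'⟩

theorem isOpen_upperHalfBall (R : ℝ) : IsOpen {z : ℂ | 0 < z.im ∧ ‖z‖ < R} :=
  (isOpen_lt continuous_const Complex.continuous_im).inter
    (isOpen_lt continuous_norm continuous_const)

theorem differentiableOn_of_forall_ball {f : ℂ → ℂ}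
    (h : ∀ R : ℝ, DifferentiableOn ℂ f {z | 0 < z.im ∧ ‖z‖ < R}) :
    DifferentiableOn ℂ f {z | 0 < z.im} := fun z hz =>
  ((h (‖z‖ + 1)).differentiableAt ((isOpen_upperHalfBall _).mem_nhds
    ⟨hz, lt_add_one _⟩)).differentiableWithinAt

variable (hc : Continuous q) (hi : Integrable q)
include hc hi

theorem isJostPair_jostEven_jostOdd {z : ℂ} (hz : 0 ≤ z.im) :
    IsJostPair (fun x => z * q x) (fun x => -(starRingEnd ℂ) (q x)) (-(2 * Complex.I * z))
      (jostEven q z) (jostOdd q z) :=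
  isJostPair_jost (by fun_prop) (hi.const_mul z) (by fun_prop) (integrable_conj hi).neg
    (neg_two_I_mul_re_nonneg hz)

theorem continuousOn_tsum_jostIterate {σ : ℕ → ℕ} (hσ : Function.Injective σ) (x : ℝ) :
    ContinuousOn (fun z => ∑' n, volterraIterate (jostRate (-(2 * Complex.I * z)))
      (jostWeight (fun x => z * q x) (fun x => -(starRingEnd ℂ) (q x))) (σ n) x)
      {z | 0 ≤ z.im} := by
  refine continuousOn_of_forall_ball fun R =>
    continuousOn_tsum_volterraIterate_param (W := fun y => (R + 1) * ‖q y‖)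
      (c := fun z => jostRate (-(2 * Complex.I * z)))
      (w := fun z => jostWeight (fun x => z * q x) fun x => -(starRingEnd ℂ) (q x))
      (fun z hz => jostRate_re_nonpos (neg_two_I_mul_re_nonneg hz.1))
      (fun z hz => norm_jostWeight_mul_conj_le hz.2) (by fun_prop) (hi.norm.const_mul (R + 1))
      (fun _ _ => continuous_jostWeight (by fun_prop) (by fun_prop))
      (fun n => ?_) (fun n y => ?_) hσ x
  · unfold jostRate
    split_ifs <;> fun_prop
  · unfold jostWeight
    split_ifs <;> fun_prop

theorem differentiableOn_tsum_jostIterate {σ : ℕ → ℕ} (hσ : Function.Injective σ) (x : ℝ) :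
    DifferentiableOn ℂ (fun z => ∑' n, volterraIterate (jostRate (-(2 * Complex.I * z)))
      (jostWeight (fun x => z * q x) (fun x => -(starRingEnd ℂ) (q x))) (σ n) x)
      {z | 0 < z.im} := by
  refine differentiableOn_of_forall_ball fun R =>
    differentiableOn_tsum_volterraIterate_param (W := fun y => (R + 1) * ‖q y‖)
      (c := fun z => jostRate (-(2 * Complex.I * z)))
      (w := fun z => jostWeight (fun x => z * q x) fun x => -(starRingEnd ℂ) (q x))
      (fun z hz => jostRate_re_nonpos (neg_two_I_mul_re_nonneg hz.1.le))
      (fun z hz => norm_jostWeight_mul_conj_le hz.2.le) (by fun_prop) (hi.norm.const_mul (R + 1))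
      (fun _ _ => continuous_jostWeight (by fun_prop) (by fun_prop)) (isOpen_upperHalfBall R)
      (fun n => ?_) (fun n y => ?_) hσ x
  · unfold jostRate
    split_ifs <;> fun_prop
  · unfold jostWeight
    split_ifs <;> fun_prop

theorem continuousOn_jostEven (x : ℝ) : ContinuousOn (fun z => jostEven q z x) {z | 0 ≤ z.im} :=
  continuousOn_tsum_jostIterate hc hi (injective_two_mul_add 0) x

theorem continuousOn_jostOdd (x : ℝ) : ContinuousOn (fun z => jostOdd q z x) {z | 0 ≤ z.im} :=
  continuousOn_tsum_jostIterate hc hi (injective_two_mul_add 1) x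

theorem differentiableOn_jostEven (x : ℝ) :
    DifferentiableOn ℂ (fun z => jostEven q z x) {z | 0 < z.im} :=
  differentiableOn_tsum_jostIterate hc hi (injective_two_mul_add 0) x

theorem differentiableOn_jostOdd (x : ℝ) :
    DifferentiableOn ℂ (fun z => jostOdd q z x) {z | 0 < z.im} :=
  differentiableOn_tsum_jostIterate hc hi (injective_two_mul_add 1) x

end SpectralParameter

section Sobolev

variable {E : Type*} [NormedAddCommGroup E] [NormedSpace ℝ E] {f : ℝ → E}
  (hf : Differentiable ℝ f) (hi : Integrable f) (hi' : Integrable (deriv f))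
include hf hi hi'

theorem tendsto_zero_atTop_of_integrable_deriv : Tendsto f atTop (𝓝 0) :=
  tendsto_zero_of_hasDerivAt_of_integrableOn_Ioi (a := 0) (fun x _ => (hf x).hasDerivAt)
    hi'.integrableOn hi.integrableOn

variable [CompleteSpace E]

theorem norm_le_integral_norm_deriv (x : ℝ) : ‖f x‖ ≤ ∫ y, ‖deriv f y‖ := by
  have h := norm_sub_le_integral_Ioi_of_hasDerivAt (x := x) (fun y => (hf y).hasDerivAt)
    hi'.norm.integrableOn (fun y => le_rfl) (tendsto_zero_atTop_of_integrable_deriv hf hi hi')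
  rw [sub_zero] at h
  exact h.trans (setIntegral_le_integral hi'.norm (Eventually.of_forall fun _ => norm_nonneg _))

theorem integrable_norm_sq : Integrable fun y => ‖f y‖ ^ 2 := by
  have hc := hf.continuous
  refine (hi.norm.const_mul (∫ y, ‖deriv f y‖)).mono' (Continuous.aestronglyMeasurable
    (by fun_prop)) (Eventually.of_forall fun y => ?_)
  rw [Real.norm_of_nonneg (by positivity), sq]
  gcongr
  exact norm_le_integral_norm_deriv hf hi hi' y

end Sobolev

section Gauge

/-- The phase `exp (i/2 ∫_x^∞ |q|²)`. Conjugating by it removes the diagonal terms from the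
equations for the pair `e^{-iθ} Φ₊₁₁` and `2 i k e^{-iθ} Φ₊₂₁ + q̄ e^{-iθ} Φ₊₁₁`. -/
def gaugePhase (q : ℝ → ℂ) (x : ℝ) : ℂ :=
  Complex.exp (Complex.I / 2 * tailMass (fun y => ‖q y‖ ^ 2) x)

theorem norm_gaugePhase (q : ℝ → ℂ) (x : ℝ) : ‖gaugePhase q x‖ = 1 := by
  simp [gaugePhase, Complex.norm_exp]

theorem gaugePhase_ne_zero (q : ℝ → ℂ) (x : ℝ) : gaugePhase q x ≠ 0 := Complex.exp_ne_zero _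

theorem tendsto_gaugePhase_atTop (q : ℝ → ℂ) : Tendsto (gaugePhase q) atTop (𝓝 1) := by
  have h := (((Complex.continuous_ofReal.tendsto _).comp
    (tendsto_tailMass_atTop fun y => ‖q y‖ ^ 2)).const_mul (Complex.I / 2)).cexp
  rw [Complex.ofReal_zero, mul_zero, Complex.exp_zero] at h
  exact h

variable {q : ℝ → ℂ} (hq : ContDiff ℝ 1 q) (hi : Integrable q) (hi' : Integrable (deriv q))

/-- The coupling of the first to the second component after the gauge transformation. -/
def gaugedFst (q : ℝ → ℂ) (x : ℝ) : ℂ := -(Complex.I / 2) * q x * gaugePhase q x ^ 2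

/-- The coupling of the second to the first component after the gauge transformation. -/
def gaugedSnd (q : ℝ → ℂ) (x : ℝ) : ℂ :=
  ((starRingEnd ℂ) (deriv q x) + Complex.I / 2 * ‖q x‖ ^ 2 * (starRingEnd ℂ) (q x)) *
    (gaugePhase q x)⁻¹ ^ 2

theorem norm_gaugedFst_le (q : ℝ → ℂ) (x : ℝ) : ‖gaugedFst q x‖ ≤ ‖q x‖ := by
  simp only [gaugedFst, norm_mul, norm_neg, norm_div, norm_pow, norm_gaugePhase, Complex.norm_I,
    Complex.norm_ofNat]
  linarith [norm_nonneg (q x)]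

include hq hi hi'

theorem hasDerivAt_gaugePhase (x : ℝ) :
    HasDerivAt (gaugePhase q) (-(Complex.I / 2) * ‖q x‖ ^ 2 * gaugePhase q x) x := by
  have hc := hq.continuous
  have h := hasDerivAt_tailMass (W := fun y => ‖q y‖ ^ 2) (by fun_prop)
    (integrable_norm_sq (hq.differentiable one_ne_zero) hi hi') x
  refine (h.ofReal_comp.const_mul (Complex.I / 2)).cexp.congr_deriv ?_
  rw [gaugePhase]
  push_cast
  ring

theorem continuous_gaugePhase : Continuous (gaugePhase q) :=
  continuous_iff_continuousAt.2 fun x => (hasDerivAt_gaugePhase hq hi hi' x).continuousAt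

theorem hasDerivAt_gaugedFst (x : ℝ) : HasDerivAt (gaugedFst q)
    (-(Complex.I / 2) * (deriv q x - Complex.I * ‖q x‖ ^ 2 * q x) * gaugePhase q x ^ 2) x := by
  refine (((hq.differentiable one_ne_zero x).hasDerivAt.const_mul (-(Complex.I / 2))).mul
    ((hasDerivAt_gaugePhase hq hi hi' x).pow 2)).congr_deriv ?_
  simp only [Nat.cast_ofNat, Pi.pow_apply]
  ring

theorem continuous_gaugedSnd : Continuous (gaugedSnd q) := by
  have hE := continuous_gaugePhase hq hi hi'
  have hc := hq.continuous
  unfold gaugedSnd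
  exact Continuous.mul (by fun_prop) ((hE.inv₀ (gaugePhase_ne_zero q)).pow 2)

theorem differentiable_gaugedFst : Differentiable ℝ (gaugedFst q) :=
  fun x => (hasDerivAt_gaugedFst hq hi hi' x).differentiableAt

theorem continuous_gaugedFst : Continuous (gaugedFst q) :=
  (differentiable_gaugedFst hq hi hi').continuous

theorem integrable_gaugedFst : Integrable (gaugedFst q) :=
  hi.norm.mono' (continuous_gaugedFst hq hi hi').aestronglyMeasurable
    (Eventually.of_forall (norm_gaugedFst_le q))

theorem isJostPair_gauge {z : ℂ} (hz : 0 ≤ z.im) :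
    IsJostPair (gaugedFst q) (gaugedSnd q) (-(2 * Complex.I * z))
      (fun x => gaugePhase q x * jostEven q z x)
      (fun x => (gaugePhase q x)⁻¹ *
        (2 * Complex.I * (z * jostOdd q z x) + (starRingEnd ℂ) (q x) * jostEven q z x)) := by
  have hE := hasDerivAt_gaugePhase hq hi hi'
  have hq' := fun x => (hq.differentiable one_ne_zero x).hasDerivAt
  obtain ⟨ha, hb, hal, hbl⟩ := isJostPair_jostEven_jostOdd hq.continuous hi hz
  have hEl := tendsto_gaugePhase_atTop q
  have hql := (tendsto_zero_atTop_of_integrable_deriv (hq.differentiable one_ne_zero) hi hi').star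
  refine ⟨fun x => ?_, fun x => ?_, ?_, ?_⟩
  · refine ((hE x).mul (ha x)).congr_deriv ?_
    have := gaugePhase_ne_zero q x
    rw [gaugedFst, ← Complex.mul_conj']
    field_simp
    linear_combination 2 * (z * q x * jostOdd q z x) * Complex.I_sq
  · have h := ((hE x).inv (gaugePhase_ne_zero q x)).mul
      ((((hb x).const_mul z).const_mul (2 * Complex.I)).add ((hq' x).star.mul (ha x)))
    refine h.congr_deriv ?_
    have := gaugePhase_ne_zero q x
    simp only [gaugedSnd, ← Complex.mul_conj', Complex.star_def, Pi.add_apply, Pi.mul_apply,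
      Pi.inv_apply]
    field_simp
    linear_combination 2 * (q x * (starRingEnd ℂ) (q x) * z * jostOdd q z x) * Complex.I_sq
  · simpa using hEl.mul hal
  · simpa using (hEl.inv₀ one_ne_zero).mul
      (((hbl.const_mul z).const_mul (2 * Complex.I)).add (hql.mul hal))

theorem integrable_norm_deriv_add_norm_pow_three :
    Integrable fun x => ‖deriv q x‖ + ‖q x‖ ^ 3 := by
  have hd := hq.differentiable one_ne_zero
  have hc := hq.continuous
  refine hi'.norm.add (((integrable_norm_sq hd hi hi').mul_const (∫ y, ‖deriv q y‖)).mono'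
    (Continuous.aestronglyMeasurable (by fun_prop)) (Eventually.of_forall fun x => ?_))
  rw [Real.norm_of_nonneg (by positivity), pow_succ]
  gcongr
  exact norm_le_integral_norm_deriv hd hi hi' x

theorem integrable_gaugedSnd : Integrable (gaugedSnd q) := by
  refine (integrable_norm_deriv_add_norm_pow_three hq hi hi').mono'
    (continuous_gaugedSnd hq hi hi').aestronglyMeasurable (Eventually.of_forall fun x => ?_)
  simp only [gaugedSnd, norm_mul, norm_pow, norm_inv, norm_gaugePhase, inv_one, one_pow, mul_one]
  refine (norm_add_le _ _).trans ?_
  simp only [norm_mul, norm_pow, norm_div, Complex.norm_I, Complex.norm_ofNat, RCLike.norm_conj,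
    Complex.norm_real, norm_norm]
  linarith [pow_nonneg (norm_nonneg (q x)) 3]

theorem integrable_deriv_gaugedFst : Integrable (deriv (gaugedFst q)) := by
  have hE := continuous_gaugePhase hq hi hi'
  have hc := hq.continuous
  rw [funext fun x => (hasDerivAt_gaugedFst hq hi hi' x).deriv]
  refine (integrable_norm_deriv_add_norm_pow_three hq hi hi').mono'
    (Continuous.aestronglyMeasurable (by fun_prop)) (Eventually.of_forall fun x => ?_)
  simp only [norm_mul, norm_pow, norm_gaugePhase, norm_neg, norm_div, Complex.norm_I,
    Complex.norm_ofNat, one_pow, mul_one]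
  have h := norm_sub_le (deriv q x) (Complex.I * ‖q x‖ ^ 2 * q x)
  simp only [norm_mul, norm_pow, Complex.norm_I, Complex.norm_real, norm_norm, one_mul] at h
  linarith [pow_nonneg (norm_nonneg (q x)) 3, norm_nonneg (deriv q x)]

theorem norm_gauge_le {z : ℂ} (hz : 0 ≤ z.im) (x : ℝ) :
    ‖gaugePhase q x * jostEven q z x‖ ≤ Real.exp (∫ y, (‖gaugedFst q y‖ + ‖gaugedSnd q y‖)) ∧
    ‖(gaugePhase q x)⁻¹ *
      (2 * Complex.I * (z * jostOdd q z x) + (starRingEnd ℂ) (q x) * jostEven q z x)‖ ≤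
        Real.exp (∫ y, (‖gaugedFst q y‖ + ‖gaugedSnd q y‖)) :=
  (isJostPair_gauge hq hi hi' hz).norm_le (continuous_gaugedFst hq hi hi')
    (integrable_gaugedFst hq hi hi') (continuous_gaugedSnd hq hi hi')
    (integrable_gaugedSnd hq hi hi') (neg_two_I_mul_re_nonneg hz) x

theorem exists_norm_mul_jostOdd_le :
    ∃ C, 0 ≤ C ∧ ∀ z : ℂ, 0 ≤ z.im → ∀ x, ‖z * jostOdd q z x‖ ≤ C := by
  set P := ∫ y, ‖deriv q y‖
  set M := Real.exp (∫ y, (‖gaugedFst q y‖ + ‖gaugedSnd q y‖))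
  have hP0 : 0 ≤ P := integral_nonneg fun _ => norm_nonneg _
  refine ⟨M + P * M, add_nonneg (Real.exp_nonneg _) (mul_nonneg hP0 (Real.exp_nonneg _)),
    fun z hz x => ?_⟩
  obtain ⟨hfst, hsnd⟩ := norm_gauge_le hq hi hi' hz x
  rw [norm_mul, norm_gaugePhase, one_mul] at hfst
  rw [norm_mul, norm_inv, norm_gaugePhase, inv_one, one_mul] at hsnd
  have hle : ‖2 * Complex.I * (z * jostOdd q z x)‖ ≤ M + P * M := by
    refine (norm_le_add_norm_add _ ((starRingEnd ℂ) (q x) * jostEven q z x)).trans ?_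
    rw [norm_mul ((starRingEnd ℂ) (q x)), RCLike.norm_conj]
    gcongr
    exact norm_le_integral_norm_deriv (hq.differentiable one_ne_zero) hi hi' x
  simp only [norm_mul, Complex.norm_ofNat, Complex.norm_I, mul_one] at hle ⊢
  nlinarith [norm_nonneg z, norm_nonneg (jostOdd q z x)]

-- The gauged couplings do not depend on `z`, so for large `z` the oscillation `e^{-2izx}` alone
-- forces the first gauged component towards `1`.
theorem exists_norm_jostEven_sub_le : ∃ C, 0 ≤ C ∧ ∀ z : ℂ, 0 ≤ z.im → z ≠ 0 → ∀ x,
    ‖jostEven q z x - (gaugePhase q x)⁻¹‖ ≤ C / ‖z‖ := by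
  set P := ∫ y, ‖deriv q y‖
  set M := Real.exp (∫ y, (‖gaugedFst q y‖ + ‖gaugedSnd q y‖))
  set A := (∫ y, (‖deriv (gaugedFst q) y‖ + P * ‖gaugedSnd q y‖)) + P
  have hP0 : 0 ≤ P := integral_nonneg fun _ => norm_nonneg _
  have hA0 : 0 ≤ A := add_nonneg (integral_nonneg fun _ => by positivity) hP0
  refine ⟨M * A / 2, div_nonneg (mul_nonneg (Real.exp_nonneg _) hA0) two_pos.le,
    fun z hz hz0 x => ?_⟩
  have h := (isJostPair_gauge hq hi hi' hz).norm_fst_sub_one_le (continuous_gaugedFst hq hi hi')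
    (integrable_gaugedFst hq hi hi') (continuous_gaugedSnd hq hi hi')
    (integrable_gaugedSnd hq hi hi') (neg_two_I_mul_re_nonneg hz) (by simpa using hz0)
    (fun x => (differentiable_gaugedFst hq hi hi' x).hasDerivAt)
    (integrable_deriv_gaugedFst hq hi hi') (fun x => (norm_gaugedFst_le q x).trans
      (norm_le_integral_norm_deriv (hq.differentiable one_ne_zero) hi hi' x)) x
  calc ‖jostEven q z x - (gaugePhase q x)⁻¹‖ = ‖gaugePhase q x * jostEven q z x - 1‖ := by
        rw [← one_mul ‖jostEven q z x - _‖, ← norm_gaugePhase q x, ← norm_mul, mul_sub,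
          mul_inv_cancel₀ (gaugePhase_ne_zero q x)]
    _ ≤ M * A / ‖-(2 * Complex.I * z)‖ := h
    _ = M * A / 2 / ‖z‖ := by
        rw [norm_neg, norm_mul, norm_mul, Complex.norm_ofNat, Complex.norm_I, mul_one, div_div]

end Gauge

section Transmission

/-- The potential `x ↦ q̄(-x)` seen from the other end of the line: it exchanges the Jost solutions
at `-∞` with those at `+∞`. -/
def conjReflect (p : ℝ → ℂ) (x : ℝ) : ℂ := (starRingEnd ℂ) (p (-x))

/-- The scattering coefficient `s₁₁` as a function of `z = k²`. -/
def transmission (p : ℝ → ℂ) (z : ℂ) : ℂ :=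
  jostEven p z 0 * jostEven (conjReflect p) z 0 -
    z * (jostOdd p z 0 * jostOdd (conjReflect p) z 0)

theorem norm_conjReflect (p : ℝ → ℂ) (x : ℝ) : ‖conjReflect p x‖ = ‖p (-x)‖ := RCLike.norm_conj _

theorem transmission_zero (p : ℝ → ℂ) : transmission p 0 = 1 := by
  simp [transmission, jostEven_zero]

variable {p : ℝ → ℂ}

theorem continuous_conjReflect (hp : Continuous p) : Continuous (conjReflect p) :=
  Complex.continuous_conj.comp (hp.comp continuous_neg)

theorem integrable_conjReflect (hp : Integrable p) : Integrable (conjReflect p) :=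
  integrable_conj hp.comp_neg

theorem contDiff_conjReflect {n : WithTop ℕ∞} (hp : ContDiff ℝ n p) :
    ContDiff ℝ n (conjReflect p) :=
  Complex.conjCLE.contDiff.comp (hp.comp contDiff_neg)

theorem deriv_conjReflect (hp : Differentiable ℝ p) :
    deriv (conjReflect p) = fun x => -conjReflect (deriv p) x := by
  funext x
  have h := ((hp (-x)).hasDerivAt.scomp x (hasDerivAt_neg x)).star
  simp only [neg_smul, one_smul, star_neg] at h
  exact h.deriv

theorem integrable_deriv_conjReflect (hp : Differentiable ℝ p) (hi' : Integrable (deriv p)) :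
    Integrable (deriv (conjReflect p)) := by
  rw [deriv_conjReflect hp]
  exact (integrable_conjReflect hi').neg

theorem continuousOn_transmission (hc : Continuous p) (hi : Integrable p) :
    ContinuousOn (transmission p) {z | 0 ≤ z.im} := by
  have hc' := continuous_conjReflect hc
  have hi' := integrable_conjReflect hi
  exact ((continuousOn_jostEven hc hi 0).mul (continuousOn_jostEven hc' hi' 0)).sub
    (continuousOn_id.mul ((continuousOn_jostOdd hc hi 0).mul (continuousOn_jostOdd hc' hi' 0)))

theorem differentiableOn_transmission (hc : Continuous p) (hi : Integrable p) :
    DifferentiableOn ℂ (transmission p) {z | 0 < z.im} := by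
  have hc' := continuous_conjReflect hc
  have hi' := integrable_conjReflect hi
  exact ((differentiableOn_jostEven hc hi 0).mul (differentiableOn_jostEven hc' hi' 0)).sub
    (differentiableOn_id.mul
      ((differentiableOn_jostOdd hc hi 0).mul (differentiableOn_jostOdd hc' hi' 0)))

theorem gaugePhase_mul_gaugePhase_conjReflect (h : Integrable fun y => ‖p y‖ ^ 2) :
    gaugePhase p 0 * gaugePhase (conjReflect p) 0 =
      Complex.exp (Complex.I / 2 * ↑(∫ y, ‖p y‖ ^ 2)) := by
  have hleft : tailMass (fun y => ‖conjReflect p y‖ ^ 2) 0 = ∫ y in Iic 0, ‖p y‖ ^ 2 := by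
    simp only [tailMass, norm_conjReflect]
    rw [integral_comp_neg_Ioi 0 fun y => ‖p y‖ ^ 2, neg_zero]
  rw [gaugePhase, gaugePhase, hleft, ← Complex.exp_add, ← mul_add, ← Complex.ofReal_add, add_comm,
    tailMass, intervalIntegral.integral_Iic_add_Ioi h.integrableOn h.integrableOn]

theorem exists_norm_transmission_sub_le (hp : ContDiff ℝ 1 p) (hi : Integrable p)
    (hi' : Integrable (deriv p)) : ∃ C, ∀ z : ℂ, 0 ≤ z.im → z ≠ 0 →
    ‖transmission p z - Complex.exp (-(Complex.I / 2 * ↑(∫ y, ‖p y‖ ^ 2)))‖ ≤ C / ‖z‖ := by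
  have hd := hp.differentiable one_ne_zero
  have hpr := contDiff_conjReflect hp
  have hir := integrable_conjReflect hi
  have hir' := integrable_deriv_conjReflect hd hi'
  obtain ⟨A₁, hA₁, ha₁⟩ := exists_norm_jostEven_sub_le hp hi hi'
  obtain ⟨A₂, -, ha₂⟩ := exists_norm_jostEven_sub_le hpr hir hir'
  obtain ⟨B₁, hB₁, hb₁⟩ := exists_norm_mul_jostOdd_le hp hi hi'
  obtain ⟨B₂, -, hb₂⟩ := exists_norm_mul_jostOdd_le hpr hir hir'
  set M := Real.exp (∫ y, (‖gaugedFst (conjReflect p) y‖ + ‖gaugedSnd (conjReflect p) y‖))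
  refine ⟨A₁ * M + A₂ + B₁ * B₂, fun z hz hz0 => ?_⟩
  have hM : ‖jostEven (conjReflect p) z 0‖ ≤ M := by
    simpa only [norm_mul, norm_gaugePhase, one_mul] using (norm_gauge_le hpr hir hir' hz 0).1
  have hodd : ‖z * (jostOdd p z 0 * jostOdd (conjReflect p) z 0)‖ ≤ B₁ * B₂ / ‖z‖ :=
    calc _ = ‖z * jostOdd p z 0‖ * ‖z * jostOdd (conjReflect p) z 0‖ / ‖z‖ := by
          rw [← norm_mul, ← norm_div]
          congr 1
          field_simp
      _ ≤ B₁ * B₂ / ‖z‖ := by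
          gcongr
          exacts [hb₁ z hz 0, hb₂ z hz 0]
  rw [Complex.exp_neg, ← gaugePhase_mul_gaugePhase_conjReflect (integrable_norm_sq hd hi hi')]
  set E₁ := gaugePhase p 0 with hE₁
  set E₂ := gaugePhase (conjReflect p) 0
  calc ‖transmission p z - (E₁ * E₂)⁻¹‖
      = ‖(jostEven p z 0 - E₁⁻¹) * jostEven (conjReflect p) z 0 +
          E₁⁻¹ * (jostEven (conjReflect p) z 0 - E₂⁻¹) -
          z * (jostOdd p z 0 * jostOdd (conjReflect p) z 0)‖ := by
        rw [transmission, mul_inv]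
        ring_nf
    _ ≤ A₁ / ‖z‖ * M + 1 * (A₂ / ‖z‖) + B₁ * B₂ / ‖z‖ := by
        refine (norm_sub_le _ _).trans (add_le_add ((norm_add_le _ _).trans ?_) hodd)
        rw [norm_mul, norm_mul, norm_inv, hE₁, norm_gaugePhase, inv_one]
        gcongr
        exacts [ha₁ z hz hz0 0, ha₂ z hz hz0 0]
    _ = (A₁ * M + A₂ + B₁ * B₂) / ‖z‖ := by ring

end Transmission

section JostColumns

@[simp] theorem pauli3_zero_zero : pauli3 0 0 = 1 := rfl

@[simp] theorem pauli3_one_one : pauli3 1 1 = -1 := rfl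

theorem theta_conj (x t : ℝ) (k : ℂ) :
    theta x t ((starRingEnd ℂ) k) = (starRingEnd ℂ) (theta x t k) := by
  simp [theta, map_ofNat]

theorem theta_neg_neg (x t : ℝ) (k : ℂ) : theta (-x) (-t) k = -theta x t k := by
  simp only [theta]
  push_cast
  ring

theorem hasDerivAt_exp_theta (t : ℝ) (k c : ℂ) (x : ℝ) :
    HasDerivAt (fun x : ℝ => Complex.exp (c * theta x t k))
      (c * k ^ 2 * Complex.exp (c * theta x t k)) x := by
  have htheta : HasDerivAt (fun x : ℝ => theta x t k) (k ^ 2) x := by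
    simpa [theta] using (((Complex.ofRealCLM.hasDerivAt (x := x)).sub_const
      (2 * k ^ 2 * (t : ℂ))).const_mul (k ^ 2))
  exact (htheta.const_mul c).cexp.congr_deriv (by ring)

/-- The involution `φ ↦ ±(-φ̄₂, φ̄₁)`, which exchanges the first and second Jost columns and the
spectral parameters `k` and `k̄`; the sign is that of the `j`-th diagonal entry of `σ₃`. -/
def conjColumn (j : Fin 2) (φ : ℝ → Fin 2 → ℂ) (x : ℝ) : Fin 2 → ℂ :=
  pauli3 j j • ![-(starRingEnd ℂ) (φ x 1), (starRingEnd ℂ) (φ x 0)]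

/-- The involution `φ(x) ↦ (φ₂(-x), φ₁(-x))`, which exchanges the two ends of the line. -/
def reflectColumn (φ : ℝ → Fin 2 → ℂ) (x : ℝ) (i : Fin 2) : ℂ := φ (-x) i.rev

theorem conjColumn_rev_conjColumn (j : Fin 2) (φ : ℝ → Fin 2 → ℂ) :
    conjColumn j.rev (conjColumn j φ) = φ := by
  ext x i
  fin_cases j <;> fin_cases i <;> simp [conjColumn]

theorem conjColumn_eq_iff {j : Fin 2} {φ ψ : ℝ → Fin 2 → ℂ} :
    conjColumn j φ = ψ ↔ φ = conjColumn j.rev ψ := by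
  constructor
  · rintro rfl
    exact (conjColumn_rev_conjColumn j φ).symm
  · rintro rfl
    simpa using conjColumn_rev_conjColumn j.rev ψ

theorem reflectColumn_involutive : Function.Involutive reflectColumn := fun φ => by
  ext x i
  simp [reflectColumn]

variable {q : ℝ → ℝ → ℂ} {t : ℝ} {k : ℂ} {l l' : Filter ℝ} {j : Fin 2} {φ ψ : ℝ → Fin 2 → ℂ}

theorem isJostColumn_iff : IsJostColumn q t k l j φ ↔
    (∀ x, HasDerivAt (fun x => φ x 0) (Complex.I * k ^ 2 * φ x 0 + k * q x t * φ x 1) x) ∧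
    (∀ x, HasDerivAt (fun x => φ x 1)
      (-(k * (starRingEnd ℂ) (q x t)) * φ x 0 - Complex.I * k ^ 2 * φ x 1) x) ∧
    Tendsto (fun x => Complex.exp (-(Complex.I * theta x t k * pauli3 j j)) * φ x 0) l
      (𝓝 (Pi.single (M := fun _ => ℂ) j 1 0)) ∧
    Tendsto (fun x => Complex.exp (-(Complex.I * theta x t k * pauli3 j j)) * φ x 1) l
      (𝓝 (Pi.single (M := fun _ => ℂ) j 1 1)) := by
  have hode : ∀ x, (laxX q x t k).mulVec (φ x) =
      ![Complex.I * k ^ 2 * φ x 0 + k * q x t * φ x 1,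
        -(k * (starRingEnd ℂ) (q x t)) * φ x 0 - Complex.I * k ^ 2 * φ x 1] := fun x => by
    ext i
    fin_cases i <;>
      simp only [laxX, pauli3, potentialMatrix, Matrix.mulVec, dotProduct, Fin.zero_eta, Fin.mk_one,
        Fin.sum_univ_two, Matrix.add_apply, Matrix.smul_apply, smul_eq_mul, Matrix.of_apply,
        Matrix.cons_val', Matrix.cons_val_fin_one, Matrix.cons_val_zero, Matrix.cons_val_one] <;>
      ring
  rw [← and_assoc, ← forall_and]
  refine ⟨fun ⟨h, h'⟩ => ⟨fun x => ?_, tendsto_pi_nhds.1 h' 0, tendsto_pi_nhds.1 h' 1⟩,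
    fun ⟨h, h'⟩ => ⟨fun x => ?_, tendsto_pi_nhds.2 (Fin.forall_fin_two.2 h')⟩⟩
  · exact Fin.forall_fin_two.1 (hasDerivAt_pi.1 (hode x ▸ h x))
  · exact hasDerivAt_pi.2 (Fin.forall_fin_two.2 (hode x ▸ h x))

theorem IsJostColumn.conj (h : IsJostColumn q t k l j φ) :
    IsJostColumn q t ((starRingEnd ℂ) k) l j.rev (conjColumn j φ) := by
  rw [isJostColumn_iff] at h ⊢
  obtain ⟨hd0, hd1, hl0, hl1⟩ := h
  have hexp : ∀ x, Complex.exp (-(Complex.I * (starRingEnd ℂ) (theta x t k) * pauli3 j.rev j.rev)) =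
      (starRingEnd ℂ) (Complex.exp (-(Complex.I * theta x t k * pauli3 j j))) := fun x => by
    rw [← Complex.exp_conj]
    fin_cases j <;> simp
  simp only [theta_conj, hexp]
  refine ⟨fun x => ?_, fun x => ?_, ?_, ?_⟩
  · refine ((hd1 x).star.neg.const_mul (pauli3 j j)).congr_deriv ?_
    simp only [conjColumn, Pi.smul_apply, smul_eq_mul, Matrix.cons_val_zero, Matrix.cons_val_one,
      star_sub, star_neg, star_mul', star_pow, RCLike.star_def, Complex.conj_I, Complex.conj_conj]
    ring
  · refine ((hd0 x).star.const_mul (pauli3 j j)).congr_deriv ?_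
    simp only [conjColumn, Pi.smul_apply, smul_eq_mul, Matrix.cons_val_zero, Matrix.cons_val_one,
      star_add, star_mul', star_pow, RCLike.star_def, Complex.conj_I]
    ring
  · have := hl1.star.neg.const_mul (pauli3 j j)
    fin_cases j <;> simpa [conjColumn] using this
  · have := hl0.star.const_mul (pauli3 j j)
    fin_cases j <;> simpa [conjColumn] using this

theorem IsJostColumn.reflect (h : IsJostColumn q t k l j φ) (hl : Tendsto Neg.neg l' l) :
    IsJostColumn (fun x _ => conjReflect (fun y => q y t) x) (-t) k l' j.rev
      (reflectColumn φ) := by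
  rw [isJostColumn_iff] at h ⊢
  obtain ⟨hd0, hd1, hl0, hl1⟩ := h
  have hexp : ∀ x, Complex.exp (-(Complex.I * theta x (-t) k * pauli3 j.rev j.rev)) =
      Complex.exp (-(Complex.I * theta (-x) t k * pauli3 j j)) := fun x => by
    have htheta := theta_neg_neg (-x) t k
    rw [neg_neg] at htheta
    rw [htheta]
    fin_cases j <;> simp
  simp only [hexp]
  refine ⟨fun x => ?_, fun x => ?_, ?_, ?_⟩
  · refine ((hd1 (-x)).scomp x (hasDerivAt_neg x)).congr_deriv ?_
    simp [reflectColumn, conjReflect]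
  · refine ((hd0 (-x)).scomp x (hasDerivAt_neg x)).congr_deriv ?_
    simp only [reflectColumn, conjReflect, Complex.conj_conj, neg_smul, one_smul, Fin.rev_zero,
      Fin.reduceLast, Fin.reduceRev]
    ring
  · have := hl1.comp hl
    fin_cases j <;> simpa [reflectColumn, Function.comp_def] using this
  · have := hl0.comp hl
    fin_cases j <;> simpa [reflectColumn, Function.comp_def] using this

theorem isJostColumn_conj_iff : IsJostColumn q t ((starRingEnd ℂ) k) l j.rev (conjColumn j φ) ↔
    IsJostColumn q t k l j φ :=
  ⟨fun h => by simpa [conjColumn_rev_conjColumn] using h.conj, fun h => h.conj⟩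

theorem isJostColumn_reflect_iff :
    IsJostColumn (fun x _ => conjReflect (fun y => q y t) x) (-t) k atTop j.rev
      (reflectColumn φ) ↔ IsJostColumn q t k atBot j φ := by
  refine ⟨fun h => ?_, fun h => h.reflect tendsto_neg_atTop_atBot⟩
  have := h.reflect tendsto_neg_atBot_atTop
  simp only [conjReflect, neg_neg, Complex.conj_conj, Fin.rev_rev,
    reflectColumn_involutive φ] at this
  exact ⟨this.ode, this.asymptotics⟩

theorem hasDerivAt_exp_theta_mul_iff {c : ℂ} {f : ℝ → ℂ} {d : ℂ} {x : ℝ} :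
    HasDerivAt (fun x => Complex.exp (c * theta x t k) * f x)
      (Complex.exp (c * theta x t k) * (c * k ^ 2 * f x + d)) x ↔ HasDerivAt f d x := by
  refine ⟨fun h => ?_, fun h => ((hasDerivAt_exp_theta t k c x).mul h).congr_deriv (by ring)⟩
  have hinv : ∀ x, Complex.exp (-c * theta x t k) * Complex.exp (c * theta x t k) = 1 := fun x => by
    rw [neg_mul, ← Complex.exp_add, neg_add_cancel, Complex.exp_zero]
  have hmul := ((hasDerivAt_exp_theta t k (-c) x).mul h).congr_deriv (g' := d)
    (by linear_combination d * hinv x)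
  refine hmul.congr_of_eventuallyEq (Eventually.of_forall fun y => ?_)
  simp only [Pi.mul_apply]
  linear_combination -f y * hinv y

theorem isJostColumn_atTop_zero_iff : IsJostColumn q t k atTop 0 φ ↔
    IsJostPair (fun x => k * q x t) (fun x => k * -(starRingEnd ℂ) (q x t))
      (-(2 * Complex.I * k ^ 2)) (fun x => Complex.exp (-Complex.I * theta x t k) * φ x 0)
      (fun x => Complex.exp (-Complex.I * theta x t k) * φ x 1) := by
  have hode0 (x : ℝ) : HasDerivAt (fun x => φ x 0)
        (Complex.I * k ^ 2 * φ x 0 + k * q x t * φ x 1) x ↔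
      HasDerivAt (fun x => Complex.exp (-Complex.I * theta x t k) * φ x 0)
        (k * q x t * (Complex.exp (-Complex.I * theta x t k) * φ x 1)) x := by
    rw [← hasDerivAt_exp_theta_mul_iff (c := -Complex.I) (k := k) (t := t)]
    ring_nf
  have hode1 (x : ℝ) : HasDerivAt (fun x => φ x 1)
        (-(k * (starRingEnd ℂ) (q x t)) * φ x 0 - Complex.I * k ^ 2 * φ x 1) x ↔
      HasDerivAt (fun x => Complex.exp (-Complex.I * theta x t k) * φ x 1)
        (-(2 * Complex.I * k ^ 2) * (Complex.exp (-Complex.I * theta x t k) * φ x 1) +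
          k * -(starRingEnd ℂ) (q x t) * (Complex.exp (-Complex.I * theta x t k) * φ x 0)) x := by
    rw [← hasDerivAt_exp_theta_mul_iff (c := -Complex.I) (k := k) (t := t)]
    ring_nf
  rw [isJostColumn_iff, forall_congr' hode0, forall_congr' hode1]
  simp only [pauli3_zero_zero, mul_one, ← neg_mul,
    Pi.single_eq_same, Pi.single_eq_of_ne (one_ne_zero : (1 : Fin 2) ≠ 0)]
  exact ⟨fun ⟨h0, h1, h2, h3⟩ => ⟨h0, h1, h2, h3⟩, fun ⟨h0, h1, h2, h3⟩ => ⟨h0, h1, h2, h3⟩⟩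

/-- The explicit Jost column `Φ₊₁` for the potential `p`. -/
def explicitColumn (p : ℝ → ℂ) (t : ℝ) (k : ℂ) (x : ℝ) : Fin 2 → ℂ :=
  Complex.exp (Complex.I * theta x t k) • ![jostEven p (k ^ 2) x, k * jostOdd p (k ^ 2) x]

theorem exp_theta_mul_explicitColumn (p : ℝ → ℂ) (t : ℝ) (k : ℂ) (x : ℝ) :
    Complex.exp (-Complex.I * theta x t k) • explicitColumn p t k x =
      ![jostEven p (k ^ 2) x, k * jostOdd p (k ^ 2) x] := by
  rw [explicitColumn, smul_smul, neg_mul, ← Complex.exp_add, neg_add_cancel, Complex.exp_zero,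
    one_smul]

theorem wronskian_explicitColumn (p : ℝ → ℂ) (t : ℝ) (k : ℂ) :
    wronskian (explicitColumn p t k 0)
      (reflectColumn (explicitColumn (conjReflect p) (-t) k) 0) = transmission p (k ^ 2) := by
  have h : Complex.exp (Complex.I * theta 0 t k) * Complex.exp (Complex.I * theta 0 (-t) k) =
      1 := by
    rw [← Complex.exp_add]
    simp [theta]
  have hrev0 : Fin.rev (0 : Fin 2) = 1 := rfl
  have hrev1 : Fin.rev (1 : Fin 2) = 0 := rfl
  simp only [wronskian, explicitColumn, reflectColumn, transmission, neg_zero, hrev0, hrev1,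
    Pi.smul_apply, smul_eq_mul, Matrix.cons_val_zero, Matrix.cons_val_one]
  linear_combination (jostEven p (k ^ 2) 0 * jostEven (conjReflect p) (k ^ 2) 0 -
    k ^ 2 * (jostOdd p (k ^ 2) 0 * jostOdd (conjReflect p) (k ^ 2) 0)) * h

theorem sq_im_eq_zero_of_mem_contour (hk : k ∈ contour) : (k ^ 2).im = 0 := by
  rw [sq, Complex.mul_im]
  rcases hk with h | h <;> rw [h] <;> ring

theorem jostColumn_eq_of_iff (h : ∀ ψ, IsJostColumn q t k l j ψ ↔ ψ = φ) :
    jostColumn q t k l j = φ :=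
  (h _).1 (Classical.epsilon_spec (p := IsJostColumn q t k l j) ⟨φ, (h φ).2 rfl⟩)

theorem conj_sq_im (k : ℂ) : ((starRingEnd ℂ) k ^ 2).im = -(k ^ 2).im := by
  rw [← map_pow, Complex.conj_im]

section Explicit

variable (hc : Continuous fun x => q x t) (hi : Integrable fun x => q x t)
include hc hi

theorem isJostColumn_atTop_zero_iff_eq (hk : 0 ≤ (k ^ 2).im) :
    IsJostColumn q t k atTop 0 φ ↔ φ = explicitColumn (fun x => q x t) t k := by
  have hpair := isJostPair_jostEven_jostOdd hc hi hk
  simp only [sq k, mul_assoc k k] at hpair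
  replace hpair := hpair.const_mul_snd
  simp only [← sq k] at hpair
  have hexplicit (x : ℝ) := exp_theta_mul_explicitColumn (fun x => q x t) t k x
  rw [isJostColumn_atTop_zero_iff]
  constructor
  · intro h
    have heq := h.unique (by fun_prop) (hi.const_mul k) (by fun_prop)
      ((integrable_conj hi).neg.const_mul k) (neg_two_I_mul_re_nonneg hk) hpair
    funext x
    refine smul_right_injective _ (Complex.exp_ne_zero (-Complex.I * theta x t k))
      (Eq.trans ?_ (hexplicit x).symm)
    exact funext (Fin.forall_fin_two.2 ⟨congrFun heq.1 x, congrFun heq.2 x⟩)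
  · rintro rfl
    convert hpair using 1
    · exact funext fun x => congrFun (hexplicit x) 0
    · exact funext fun x => congrFun (hexplicit x) 1

theorem isJostColumn_atBot_one_iff_eq (hk : 0 ≤ (k ^ 2).im) :
    IsJostColumn q t k atBot 1 φ ↔
      φ = reflectColumn (explicitColumn (conjReflect fun x => q x t) (-t) k) := by
  rw [← isJostColumn_reflect_iff, reflectColumn_involutive.eq_iff.symm]
  exact isJostColumn_atTop_zero_iff_eq (continuous_conjReflect hc) (integrable_conjReflect hi) hk

theorem isJostColumn_atTop_one_iff_eq (hk : (k ^ 2).im ≤ 0) :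
    IsJostColumn q t k atTop 1 φ ↔
      φ = conjColumn 0 (explicitColumn (fun x => q x t) t ((starRingEnd ℂ) k)) := by
  rw [← isJostColumn_conj_iff]
  exact (isJostColumn_atTop_zero_iff_eq hc hi (by rwa [conj_sq_im, neg_nonneg])).trans
    conjColumn_eq_iff

theorem isJostColumn_atBot_zero_iff_eq (hk : (k ^ 2).im ≤ 0) :
    IsJostColumn q t k atBot 0 φ ↔ φ = conjColumn 1 (reflectColumn
      (explicitColumn (conjReflect fun x => q x t) (-t) ((starRingEnd ℂ) k))) := by
  rw [← isJostColumn_conj_iff]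
  exact (isJostColumn_atBot_one_iff_eq hc hi (by rwa [conj_sq_im, neg_nonneg])).trans
    conjColumn_eq_iff

theorem s11_eq_transmission (hk : 0 ≤ (k ^ 2).im) :
    s11 q t k = transmission (fun x => q x t) (k ^ 2) := by
  rw [s11, jostColumn_eq_of_iff fun _ => isJostColumn_atTop_zero_iff_eq hc hi hk,
    jostColumn_eq_of_iff fun _ => isJostColumn_atBot_one_iff_eq hc hi hk,
    wronskian_explicitColumn]

theorem s22_eq_conj_transmission (hk : (k ^ 2).im ≤ 0) :
    s22 q t k = (starRingEnd ℂ) (transmission (fun x => q x t) ((starRingEnd ℂ) (k ^ 2))) := by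
  rw [s22, jostColumn_eq_of_iff fun _ => isJostColumn_atTop_one_iff_eq hc hi hk,
    jostColumn_eq_of_iff fun _ => isJostColumn_atBot_zero_iff_eq hc hi hk, map_pow,
    ← wronskian_explicitColumn _ t]
  simp only [wronskian, conjColumn, pauli3_zero_zero, pauli3_one_one, Pi.smul_apply, smul_eq_mul,
    Matrix.cons_val_zero, Matrix.cons_val_one, map_sub, map_mul]
  ring

theorem isJostColumn_jostColumn_of_mem_contour (hk : k ∈ contour) (hl : l = atTop ∨ l = atBot)
    (j : Fin 2) : IsJostColumn q t k l j (jostColumn q t k l j) := by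
  have hk := sq_im_eq_zero_of_mem_contour hk
  refine Classical.epsilon_spec (p := IsJostColumn q t k l j) ?_
  rcases hl with rfl | rfl <;> fin_cases j
  · exact ⟨_, (isJostColumn_atTop_zero_iff_eq hc hi hk.ge).2 rfl⟩
  · exact ⟨_, (isJostColumn_atTop_one_iff_eq hc hi hk.le).2 rfl⟩
  · exact ⟨_, (isJostColumn_atBot_zero_iff_eq hc hi hk.le).2 rfl⟩
  · exact ⟨_, (isJostColumn_atBot_one_iff_eq hc hi hk.ge).2 rfl⟩

end Explicit

end JostColumns

section Scattering

variable {q : ℝ → ℝ → ℂ} {t : ℝ} {k : ℂ}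

theorem wronskian_const {l l' : Filter ℝ} {j j' : Fin 2} {φ ψ : ℝ → Fin 2 → ℂ}
    (hφ : IsJostColumn q t k l j φ) (hψ : IsJostColumn q t k l' j' ψ) (x y : ℝ) :
    wronskian (φ x) (ψ x) = wronskian (φ y) (ψ y) := by
  rw [isJostColumn_iff] at hφ hψ
  obtain ⟨d0, d1, -, -⟩ := hφ
  obtain ⟨d0', d1', -, -⟩ := hψ
  have hd : ∀ x, HasDerivAt (fun x => wronskian (φ x) (ψ x)) 0 x := fun x =>
    (((d0 x).mul (d1' x)).sub ((d1 x).mul (d0' x))).congr_deriv (by ring)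
  exact is_const_of_deriv_eq_zero (fun x => (hd x).differentiableAt) (fun x => (hd x).deriv) x y

theorem wronskian_eq_one {l : Filter ℝ} [l.NeBot] {φ ψ : ℝ → Fin 2 → ℂ}
    (hφ : IsJostColumn q t k l 0 φ) (hψ : IsJostColumn q t k l 1 ψ) (x : ℝ) :
    wronskian (φ x) (ψ x) = 1 := by
  have hconst : Tendsto (fun y => wronskian (φ y) (ψ y)) l (𝓝 (wronskian (φ x) (ψ x))) :=
    tendsto_const_nhds.congr fun y => wronskian_const hφ hψ x y
  refine tendsto_nhds_unique hconst ?_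
  rw [isJostColumn_iff] at hφ hψ
  obtain ⟨-, -, l0, l1⟩ := hφ
  obtain ⟨-, -, l0', l1'⟩ := hψ
  have hlim := (l0.mul l1').sub (l1.mul l0')
  rw [Pi.single_eq_same, Pi.single_eq_same, Pi.single_eq_of_ne one_ne_zero, zero_mul, mul_one,
    sub_zero] at hlim
  refine hlim.congr fun y => ?_
  have hexp : Complex.exp (-(Complex.I * theta y t k * pauli3 0 0)) *
      Complex.exp (-(Complex.I * theta y t k * pauli3 1 1)) = 1 := by
    rw [← Complex.exp_add]
    simp
  rw [wronskian]
  linear_combination (φ y 0 * ψ y 1 - φ y 1 * ψ y 0) * hexp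

theorem adjugate_jostMatrix_mul_jostMatrix (q : ℝ → ℝ → ℂ) (t : ℝ) (k : ℂ) (l l' : Filter ℝ)
    (x : ℝ) : (jostMatrix q t k l x).adjugate * jostMatrix q t k l' x =
      !![wronskian (jostColumn q t k l' 0 x) (jostColumn q t k l 1 x),
        wronskian (jostColumn q t k l' 1 x) (jostColumn q t k l 1 x);
        wronskian (jostColumn q t k l 0 x) (jostColumn q t k l' 0 x),
        wronskian (jostColumn q t k l 0 x) (jostColumn q t k l' 1 x)] := by
  ext i j
  fin_cases i <;> fin_cases j <;>
    simp only [jostMatrix, Matrix.adjugate_fin_two, Matrix.mul_apply, wronskian, Fin.sum_univ_two,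
      Fin.zero_eta, Fin.mk_one, Matrix.of_apply, Matrix.cons_val', Matrix.cons_val_fin_one,
      Matrix.cons_val_zero, Matrix.cons_val_one] <;>
    ring

section Contour

variable (hc : Continuous fun x => q x t) (hi : Integrable fun x => q x t) (hk : k ∈ contour)
include hc hi hk

theorem det_jostMatrix {l : Filter ℝ} (hl : l = atTop ∨ l = atBot) (x : ℝ) :
    (jostMatrix q t k l x).det = 1 := by
  have : l.NeBot := by rcases hl with rfl | rfl <;> infer_instance
  have hjost := isJostColumn_jostColumn_of_mem_contour hc hi hk hl
  rw [← wronskian_eq_one (hjost 0) (hjost 1) x, Matrix.det_fin_two, wronskian]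
  simp only [jostMatrix, Matrix.of_apply]
  ring

theorem scatteringMatrix_eq : scatteringMatrix q t k =
    (jostMatrix q t k atBot 0).adjugate * jostMatrix q t k atTop 0 := by
  have htop := isJostColumn_jostColumn_of_mem_contour hc hi hk (.inl rfl)
  have hbot := isJostColumn_jostColumn_of_mem_contour hc hi hk (.inr rfl)
  have hex : ∃ S, ∀ x, jostMatrix q t k atTop x = jostMatrix q t k atBot x * S := by
    refine ⟨(jostMatrix q t k atBot 0).adjugate * jostMatrix q t k atTop 0, fun x => ?_⟩
    rw [adjugate_jostMatrix_mul_jostMatrix, wronskian_const (htop 0) (hbot 1) 0 x,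
      wronskian_const (htop 1) (hbot 1) 0 x, wronskian_const (hbot 0) (htop 0) 0 x,
      wronskian_const (hbot 0) (htop 1) 0 x, ← adjugate_jostMatrix_mul_jostMatrix, ← mul_assoc,
      Matrix.mul_adjugate, det_jostMatrix hc hi hk (.inr rfl), one_smul, one_mul]
  have hS : jostMatrix q t k atTop 0 = jostMatrix q t k atBot 0 * scatteringMatrix q t k :=
    Classical.epsilon_spec hex 0
  rw [hS, ← mul_assoc, Matrix.adjugate_mul, det_jostMatrix hc hi hk (.inr rfl), one_smul, one_mul]

theorem s11_eq_scatteringMatrix : s11 q t k = scatteringMatrix q t k 0 0 := by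
  rw [scatteringMatrix_eq hc hi hk, adjugate_jostMatrix_mul_jostMatrix]
  rfl

theorem s22_eq_scatteringMatrix : s22 q t k = scatteringMatrix q t k 1 1 := by
  rw [scatteringMatrix_eq hc hi hk, adjugate_jostMatrix_mul_jostMatrix]
  rfl

theorem det_scatteringMatrix : (scatteringMatrix q t k).det = 1 := by
  rw [scatteringMatrix_eq hc hi hk, Matrix.det_mul, Matrix.det_adjugate,
    det_jostMatrix hc hi hk (.inr rfl), det_jostMatrix hc hi hk (.inl rfl), one_pow, one_mul]

theorem s22_eq_conj_s11 : s22 q t k = (starRingEnd ℂ) (s11 q t k) := by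
  have him := sq_im_eq_zero_of_mem_contour hk
  rw [s22_eq_conj_transmission hc hi him.le, s11_eq_transmission hc hi him.ge,
    Complex.conj_eq_iff_im.2 him]

theorem log_one_sub_rho_mul_rhoTilde (hs : scatteringMatrix q t k 0 0 ≠ 0) :
    Complex.log (1 - rho q t k * rhoTilde q t k) =
      ((-(2 * Real.log ‖transmission (fun x => q x t) (k ^ 2)‖) : ℝ) : ℂ) := by
  have hdet := det_scatteringMatrix hc hi hk
  have h11 := s11_eq_scatteringMatrix hc hi hk
  have h22 := s22_eq_scatteringMatrix hc hi hk
  rw [s22_eq_conj_s11 hc hi hk, h11] at h22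
  have hs' : scatteringMatrix q t k 1 1 ≠ 0 := h22 ▸ (map_ne_zero _).2 hs
  have hrho : 1 - rho q t k * rhoTilde q t k =
      (scatteringMatrix q t k 0 0 * scatteringMatrix q t k 1 1)⁻¹ := by
    rw [Matrix.det_fin_two] at hdet
    rw [rho, rhoTilde]
    field_simp
    linear_combination hdet
  rw [hrho, ← h22, Complex.mul_conj, Complex.normSq_eq_norm_sq, ← Complex.ofReal_inv,
    ← Complex.ofReal_log (by positivity), Real.log_inv, Real.log_pow, ← h11,
    s11_eq_transmission hc hi (sq_im_eq_zero_of_mem_contour hk).ge]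
  push_cast
  rfl

end Contour

end Scattering

section Logarithm

theorem isPreconnected_norm_gt {R : ℝ} (hR : 0 < R) : IsPreconnected {z : ℂ | R < ‖z‖} := by
  have himage : {z : ℂ | R < ‖z‖} = Complex.exp '' {z : ℂ | Real.log R < z.re} := by
    ext z
    constructor
    · intro hz
      refine ⟨Complex.log z, ?_, Complex.exp_log (norm_pos_iff.1 (hR.trans hz))⟩
      rw [mem_ofPred_eq, Complex.log_re]
      exact Real.log_lt_log hR hz
    · rintro ⟨w, hw, rfl⟩
      rw [mem_ofPred_eq, Complex.norm_exp]
      exact (Real.log_lt_iff_lt_exp hR).1 hw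
  rw [himage]
  exact (convex_halfSpace_re_gt _).isPreconnected.image _ Complex.continuous_exp.continuousOn

theorem exists_continuous_exp_eq {F : ℂ → ℂ} (hc : Continuous F) (h0 : ∀ z, F z ≠ 0) :
    ∃ G : ℂ → ℂ, Continuous G ∧ ∀ z, Complex.exp (G z) = F z := by
  have hlift := Complex.isCoveringMapOn_exp.existsUnique_continuousMap_lifts ⟨F, hc⟩ (a₀ := 0)
    (Complex.exp_log (h0 0)) h0
  obtain ⟨G, ⟨-, hG⟩, -⟩ := hlift
  exact ⟨G, G.continuous, congrFun hG⟩

theorem exists_continuous_exp_eq_of_tendsto_one {F : ℂ → ℂ} (hc : Continuous F)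
    (h0 : ∀ z, F z ≠ 0) (hl : Tendsto F (Bornology.cobounded ℂ) (𝓝 1)) :
    ∃ G : ℂ → ℂ, Continuous G ∧ (∀ z, Complex.exp (G z) = F z) ∧
      Tendsto G (Bornology.cobounded ℂ) (𝓝 0) := by
  obtain ⟨g, hg, hgF⟩ := exists_continuous_exp_eq hc h0
  have hslit : ∀ᶠ z in Bornology.cobounded ℂ, F z ∈ Complex.slitPlane :=
    hl (Complex.isOpen_slitPlane.mem_nhds Complex.one_mem_slitPlane)
  rw [← comap_norm_atTop, eventually_comap] at hslit
  obtain ⟨R, hR, hslit⟩ := (atTop_basis_Ioi' 0).eventually_iff.1 hslit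
  -- Outside a disc, `g` differs from the principal logarithm by a constant multiple of `2πi`.
  have hmaps : MapsTo (fun z => g z - Complex.log (F z)) {z | R < ‖z‖} (Complex.exp ⁻¹' {1}) :=
    fun z _ => by
      rw [mem_preimage, Complex.exp_sub, hgF, Complex.exp_log (h0 z), div_self (h0 z)]
      rfl
  have hcont : ContinuousOn (fun z => g z - Complex.log (F z)) {z | R < ‖z‖} :=
    hg.continuousOn.sub (hc.continuousOn.clog fun z hz => hslit hz z rfl)
  have hconst : (fun z => g z - Complex.log (F z)) '' {z | R < ‖z‖} |>.Subsingleton :=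
    ((countable_singleton 1).preimage_cexp).isTotallyDisconnected _ hmaps.image_subset
      ((isPreconnected_norm_gt hR).image _ hcont)
  obtain ⟨z₀, hz₀⟩ := NormedSpace.exists_lt_norm ℂ ℂ R
  have hc1 : Complex.exp (g z₀ - Complex.log (F z₀)) = 1 := hmaps hz₀
  refine ⟨fun z => g z - (g z₀ - Complex.log (F z₀)), hg.sub continuous_const, fun z => ?_, ?_⟩
  · rw [Complex.exp_sub, hgF, hc1, div_one]
  · have hlog := hl.clog Complex.one_mem_slitPlane
    rw [Complex.log_one] at hlog
    refine hlog.congr' ?_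
    filter_upwards [tendsto_norm_cobounded_atTop.eventually_gt_atTop R] with z hz
    have hgz : g z - Complex.log (F z) = g z₀ - Complex.log (F z₀) :=
      hconst (mem_image_of_mem _ hz) (mem_image_of_mem _ hz₀)
    linear_combination -hgz

theorem differentiableAt_of_exp_eq {F G : ℂ → ℂ} {z : ℂ} (hG : ContinuousAt G z)
    (hF : DifferentiableAt ℂ F z) (h : ∀ᶠ w in 𝓝 z, Complex.exp (G w) = F w) :
    DifferentiableAt ℂ G z :=
  (HasDerivAt.of_comp_left hG (Complex.hasDerivAt_exp _) hF.hasDerivAt (Complex.exp_ne_zero _)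
    h).differentiableAt

end Logarithm

section UpperHalfPlane

/-- Neighbourhoods of infinity in the closed upper half-plane. -/
def upperInfty : Filter ℂ := Bornology.cobounded ℂ ⊓ 𝓟 {z | 0 ≤ z.im}

theorem tendsto_norm_upperInfty : Tendsto (fun z : ℂ => ‖z‖) upperInfty atTop :=
  tendsto_norm_cobounded_atTop.mono_left inf_le_left

theorem eventually_upperInfty_iff {p : ℂ → Prop} :
    (∀ᶠ z in upperInfty, p z) ↔ ∃ R > 0, ∀ z : ℂ, 0 ≤ z.im → R < ‖z‖ → p z := by
  rw [upperInfty, eventually_inf_principal, ← comap_norm_atTop, eventually_comap,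
    (atTop_basis_Ioi' 0).eventually_iff]
  exact exists_congr fun R => and_congr_right fun _ =>
    ⟨fun h z hz hzR => h hzR z rfl hz, fun h _ hr z hzr hz => h z hz (hzr ▸ hr)⟩

/-- The reflection of the lower half-plane onto the upper one, which extends functions on the closed
upper half-plane to the whole plane. -/
def foldUp (z : ℂ) : ℂ := z.re + |z.im| * Complex.I

theorem foldUp_of_nonneg {z : ℂ} (hz : 0 ≤ z.im) : foldUp z = z := by
  rw [foldUp, abs_of_nonneg hz, Complex.re_add_im]

theorem foldUp_im_nonneg (z : ℂ) : 0 ≤ (foldUp z).im := by simp [foldUp]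

theorem norm_foldUp (z : ℂ) : ‖foldUp z‖ = ‖z‖ := by
  rw [foldUp, Complex.norm_add_mul_I, sq_abs, Complex.norm_eq_sqrt_sq_add_sq]

theorem continuous_foldUp : Continuous foldUp := by
  have := Complex.continuous_re
  have := Complex.continuous_im
  unfold foldUp
  fun_prop

theorem tendsto_foldUp : Tendsto foldUp (Bornology.cobounded ℂ) upperInfty := by
  refine tendsto_inf.2 ⟨?_, tendsto_principal.2 (Eventually.of_forall foldUp_im_nonneg)⟩
  rw [← tendsto_norm_atTop_iff_cobounded]
  simpa only [norm_foldUp] using tendsto_norm_cobounded_atTop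

theorem exists_exp_eq_of_tendsto_one {F : ℂ → ℂ} (hc : ContinuousOn F {z | 0 ≤ z.im})
    (hd : DifferentiableOn ℂ F {z | 0 < z.im}) (h0 : ∀ z : ℂ, 0 ≤ z.im → F z ≠ 0)
    (hl : Tendsto F upperInfty (𝓝 1)) :
    ∃ G : ℂ → ℂ, ContinuousOn G {z | 0 ≤ z.im} ∧ DifferentiableOn ℂ G {z | 0 < z.im} ∧
      (∀ z : ℂ, 0 ≤ z.im → Complex.exp (G z) = F z) ∧ Tendsto G upperInfty (𝓝 0) := by
  obtain ⟨G, hG, hGF, hGl⟩ := exists_continuous_exp_eq_of_tendsto_one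
    (hc.comp_continuous continuous_foldUp foldUp_im_nonneg)
    (fun z => h0 _ (foldUp_im_nonneg z)) (hl.comp tendsto_foldUp)
  have hGF' : ∀ z : ℂ, 0 ≤ z.im → Complex.exp (G z) = F z := fun z hz => by
    rw [hGF, Function.comp_apply, foldUp_of_nonneg hz]
  refine ⟨G, hG.continuousOn, fun z hz => ?_, hGF', hGl.mono_left inf_le_left⟩
  have hnhds := (Complex.isOpen_im_gt 0).mem_nhds hz
  refine (differentiableAt_of_exp_eq hG.continuousAt (hd.differentiableAt hnhds)
    ?_).differentiableWithinAt
  filter_upwards [hnhds] with w hw using hGF' w (le_of_lt hw)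

theorem norm_integral_real_line_le {h : ℂ → ℂ} (hc : ContinuousOn h {z | 0 ≤ z.im})
    (hd : DifferentiableOn ℂ h {z | 0 < z.im}) {R C : ℝ} (hR : 0 < R)
    (hC : ∀ z : ℂ, 0 ≤ z.im → R ≤ ‖z‖ → ‖h z‖ ≤ C) :
    ‖∫ x in (-R)..R, h x‖ ≤ 4 * (C * R) := by
  have hrect := Complex.integral_boundary_rect_eq_zero_of_continuousOn_of_differentiableOn h
    (-R : ℂ) (R + R * Complex.I) (hc.mono ?_) (hd.mono ?_)
  · simp only [Complex.neg_re, Complex.neg_im, Complex.add_re, Complex.add_im, Complex.mul_re,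
      Complex.mul_im, Complex.ofReal_re, Complex.ofReal_im, Complex.I_re, Complex.I_im, mul_zero,
      mul_one, sub_zero, neg_zero, zero_add, add_zero, Complex.ofReal_zero, zero_mul,
      smul_eq_mul] at hrect
    have htop : ‖∫ x : ℝ in (-R)..R, h (x + R * Complex.I)‖ ≤ C * |R - -R| := by
      refine intervalIntegral.norm_integral_le_of_norm_le_const fun x _ => hC _ (by simp [hR.le]) ?_
      simpa [abs_of_pos hR] using Complex.abs_im_le_norm (x + R * Complex.I)
    have hside : ∀ r : ℝ, |r| = R →
        ‖∫ y : ℝ in (0 : ℝ)..R, h (r + y * Complex.I)‖ ≤ C * |R - 0| := fun r hr => by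
      refine intervalIntegral.norm_integral_le_of_norm_le_const fun y hy => hC _ ?_ ?_
      · rw [uIoc_of_le hR.le] at hy
        simp [hy.1.le]
      · simpa [hr] using Complex.abs_re_le_norm (r + y * Complex.I)
    have hright := hside R (abs_of_pos hR)
    have hleft := hside (-R) (by rw [abs_neg, abs_of_pos hR])
    rw [sub_neg_eq_add, abs_of_pos (add_pos hR hR)] at htop
    rw [sub_zero, abs_of_pos hR] at hright hleft
    have heq : ∫ x : ℝ in (-R)..R, h x = (∫ x : ℝ in (-R)..R, h (x + R * Complex.I)) -
        Complex.I * (∫ y : ℝ in (0 : ℝ)..R, h (R + y * Complex.I)) +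
        Complex.I * (∫ y : ℝ in (0 : ℝ)..R, h ((-R : ℝ) + y * Complex.I)) := by
      linear_combination hrect
    rw [heq]
    refine (norm_add_le_of_le (norm_sub_le _ _) le_rfl).trans ?_
    rw [norm_mul, norm_mul, Complex.norm_I, one_mul, one_mul]
    linarith
  · intro z hz
    have him : z.im ∈ Icc 0 R := by simpa [hR.le] using hz.2
    exact him.1
  · intro z hz
    have him : z.im ∈ Ioo 0 R := by simpa [hR.le] using hz.2
    exact him.1

theorem tendsto_integral_real_line_zero {h : ℂ → ℂ} (hc : ContinuousOn h {z | 0 ≤ z.im})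
    (hd : DifferentiableOn ℂ h {z | 0 < z.im})
    (hl : Tendsto (fun z => z * h z) upperInfty (𝓝 0)) :
    Tendsto (fun R : ℝ => ∫ x in (-R)..R, h x) atTop (𝓝 0) := by
  refine Metric.tendsto_atTop.2 fun ε hε => ?_
  obtain ⟨R₀, hR₀, hsmall⟩ := eventually_upperInfty_iff.1
    (Metric.tendsto_nhds.1 hl (ε / 8) (by positivity))
  refine ⟨R₀ + 1, fun R hR => ?_⟩
  have hRpos : 0 < R := by linarith
  rw [dist_zero_right]
  refine (norm_integral_real_line_le hc hd hRpos (C := ε / 8 / R) fun z hz hzR => ?_).trans_lt ?_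
  · have hzh := hsmall z hz (by linarith)
    rw [dist_zero_right, norm_mul] at hzh
    rw [le_div_iff₀ hRpos, mul_comm]
    exact (mul_le_mul_of_nonneg_right hzR (norm_nonneg _)).trans hzh.le
  · rw [div_mul_cancel₀ _ hRpos.ne']
    linarith

theorem tendsto_inv_sub_upperInfty (w : ℂ) : Tendsto (fun z => (z - w)⁻¹) upperInfty (𝓝 0) :=
  tendsto_inv₀_cobounded.comp ((tendsto_sub_const_cobounded w).mono_left inf_le_left)

theorem tendsto_div_sub_upperInfty (w : ℂ) : Tendsto (fun z => z / (z - w)) upperInfty (𝓝 1) := by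
  have h := ((tendsto_inv_sub_upperInfty w).const_mul w).const_add 1
  rw [mul_zero, add_zero] at h
  refine h.congr' ?_
  filter_upwards [tendsto_norm_upperInfty.eventually_gt_atTop ‖w‖] with z hz
  have : z - w ≠ 0 := sub_ne_zero.2 fun h => hz.ne' (congrArg norm h)
  field_simp
  ring

theorem ofReal_sub_ne_zero {w : ℂ} (hw : w.im ≠ 0) (x : ℝ) : (x : ℂ) - w ≠ 0 := fun h =>
  hw (by simpa using congrArg Complex.im h)

theorem sub_conj_ne_zero {w z : ℂ} (hw : 0 < w.im) (hz : 0 ≤ z.im) :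
    z - (starRingEnd ℂ) w ≠ 0 := fun h => by
  have him := congrArg Complex.im h
  rw [Complex.sub_im, Complex.conj_im, Complex.zero_im] at him
  linarith

end UpperHalfPlane

section Schwarz

theorem inv_sub_sub_inv_sub_conj {w : ℂ} (hw : 0 < w.im) (x : ℝ) :
    ((x : ℂ) - w)⁻¹ - ((x : ℂ) - (starRingEnd ℂ) w)⁻¹ =
      2 * Real.pi * Complex.I *
        (ProbabilityTheory.cauchyPDFReal w.re w.im.toNNReal x : ℂ) := by
  have hne := ofReal_sub_ne_zero hw.ne' x
  have hne' := sub_conj_ne_zero hw (Complex.ofReal_im x).ge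
  have hnormSq : (((x - w.re) ^ 2 + w.im ^ 2 : ℝ) : ℂ) = (x - w) * (x - (starRingEnd ℂ) w) := by
    rw [← Complex.conj_ofReal x, ← map_sub, Complex.conj_ofReal, Complex.mul_conj,
      Complex.normSq_apply]
    simp [sq]
  have hsub := Complex.sub_conj w
  rw [ProbabilityTheory.cauchyPDFReal_def, Real.coe_toNNReal _ hw.le, Complex.ofReal_mul,
    Complex.ofReal_inv, hnormSq, inv_sub_inv hne hne']
  push_cast at hsub ⊢
  have hpi : (Real.pi : ℂ) ≠ 0 := Complex.ofReal_ne_zero.2 Real.pi_ne_zero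
  field_simp
  linear_combination hsub

theorem tendsto_integral_poisson {w : ℂ} (hw : 0 < w.im) :
    Tendsto (fun R : ℝ => ∫ x in (-R)..R, (((x : ℂ) - w)⁻¹ - ((x : ℂ) - (starRingEnd ℂ) w)⁻¹))
      atTop (𝓝 (2 * Real.pi * Complex.I)) := by
  have hγ : w.im.toNNReal ≠ 0 := (Real.toNNReal_pos.2 hw).ne'
  have h := intervalIntegral_tendsto_integral
    ((ProbabilityTheory.integrable_cauchyPDFReal (γ := w.im.toNNReal) w.re).ofReal.const_mul
      (2 * Real.pi * Complex.I)) tendsto_neg_atTop_atBot tendsto_id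
  rw [integral_const_mul, integral_ofReal, ProbabilityTheory.integral_cauchyPDFReal_eq_one _ hγ,
    RCLike.ofReal_one, mul_one] at h
  simp only [inv_sub_sub_inv_sub_conj hw]
  exact h

variable {G : ℂ → ℂ} {w : ℂ}

theorem continuous_comp_ofReal {f : ℂ → ℂ} (hf : ContinuousOn f {z | 0 ≤ z.im}) :
    Continuous fun x : ℝ => f x :=
  hf.comp_continuous Complex.continuous_ofReal fun x => (Complex.ofReal_im x).ge

theorem continuousOn_inv_sub_conj (hw : 0 < w.im) :
    ContinuousOn (fun z => (z - (starRingEnd ℂ) w)⁻¹) {z | 0 ≤ z.im} :=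
  (continuousOn_id.sub continuousOn_const).inv₀ fun _ hz => sub_conj_ne_zero hw hz

theorem differentiableOn_inv_sub_conj (hw : 0 < w.im) :
    DifferentiableOn ℂ (fun z => (z - (starRingEnd ℂ) w)⁻¹) {z | 0 < z.im} :=
  (differentiableOn_id.sub (differentiableOn_const _)).inv fun _ hz =>
    sub_conj_ne_zero hw (le_of_lt hz)

theorem tendsto_integral_mul_inv_sub_conj (hc : ContinuousOn G {z | 0 ≤ z.im})
    (hd : DifferentiableOn ℂ G {z | 0 < z.im}) (hl : Tendsto G upperInfty (𝓝 0)) (hw : 0 < w.im) :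
    Tendsto (fun R : ℝ => ∫ x in (-R)..R, G x * ((x : ℂ) - (starRingEnd ℂ) w)⁻¹) atTop (𝓝 0) := by
  refine tendsto_integral_real_line_zero (hc.mul (continuousOn_inv_sub_conj hw))
    (hd.mul (differentiableOn_inv_sub_conj hw)) ?_
  have h := hl.mul (tendsto_div_sub_upperInfty ((starRingEnd ℂ) w))
  rw [zero_mul] at h
  refine h.congr fun z => ?_
  rw [Pi.mul_apply]
  ring

theorem continuous_poisson (hw : 0 < w.im) :
    Continuous fun x : ℝ => ((x : ℂ) - w)⁻¹ - ((x : ℂ) - (starRingEnd ℂ) w)⁻¹ :=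
  ((Complex.continuous_ofReal.sub continuous_const).inv₀ (ofReal_sub_ne_zero hw.ne')).sub
    (continuous_comp_ofReal (continuousOn_inv_sub_conj hw))

theorem continuousOn_dslope_upper (hc : ContinuousOn G {z | 0 ≤ z.im})
    (hd : DifferentiableOn ℂ G {z | 0 < z.im}) (hw : 0 < w.im) :
    ContinuousOn (dslope G w) {z | 0 ≤ z.im} := by
  have hnhds := (Complex.isOpen_im_gt 0).mem_nhds hw
  exact (continuousOn_dslope (mem_of_superset hnhds fun z (hz : 0 < z.im) => hz.le)).2
    ⟨hc, hd.differentiableAt hnhds⟩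

theorem tendsto_integral_dslope_mul_inv_sub_conj (hc : ContinuousOn G {z | 0 ≤ z.im})
    (hd : DifferentiableOn ℂ G {z | 0 < z.im}) (hl : Tendsto G upperInfty (𝓝 0)) (hw : 0 < w.im) :
    Tendsto (fun R : ℝ => ∫ x in (-R)..R, dslope G w x * ((x : ℂ) - (starRingEnd ℂ) w)⁻¹) atTop
      (𝓝 0) := by
  have hnhds := (Complex.isOpen_im_gt 0).mem_nhds hw
  refine tendsto_integral_real_line_zero (h := fun z => dslope G w z * (z - (starRingEnd ℂ) w)⁻¹)
    ((continuousOn_dslope_upper hc hd hw).mul (continuousOn_inv_sub_conj hw))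
    (((Complex.differentiableOn_dslope hnhds).2 hd).mul (differentiableOn_inv_sub_conj hw)) ?_
  have h := (tendsto_div_sub_upperInfty ((starRingEnd ℂ) w)).mul
    ((hl.sub_const (G w)).mul (tendsto_inv_sub_upperInfty w))
  rw [mul_zero, mul_zero] at h
  refine h.congr' ?_
  filter_upwards [tendsto_norm_upperInfty.eventually_gt_atTop ‖w‖] with z hz
  rw [dslope_of_ne _ fun h => hz.ne' (congrArg norm h), slope_def_field]
  ring

theorem tendsto_integral_mul_poisson (hc : ContinuousOn G {z | 0 ≤ z.im})
    (hd : DifferentiableOn ℂ G {z | 0 < z.im}) (hl : Tendsto G upperInfty (𝓝 0)) (hw : 0 < w.im) :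
    Tendsto (fun R : ℝ => ∫ x in (-R)..R,
      G x * (((x : ℂ) - w)⁻¹ - ((x : ℂ) - (starRingEnd ℂ) w)⁻¹)) atTop
      (𝓝 (2 * Real.pi * Complex.I * G w)) := by
  have hdslope : Continuous fun x : ℝ => dslope G w x * ((x : ℂ) - (starRingEnd ℂ) w)⁻¹ :=
    continuous_comp_ofReal
      ((continuousOn_dslope_upper hc hd hw).mul (continuousOn_inv_sub_conj hw))
  have h := ((tendsto_integral_poisson hw).mul_const (G w)).add
    ((tendsto_integral_dslope_mul_inv_sub_conj hc hd hl hw).const_mul (w - (starRingEnd ℂ) w))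
  rw [mul_zero, add_zero] at h
  refine h.congr fun R => ?_
  rw [← intervalIntegral.integral_mul_const, ← intervalIntegral.integral_const_mul,
    ← intervalIntegral.integral_add (((continuous_poisson hw).intervalIntegrable _ _).mul_const _)
      ((hdslope.intervalIntegrable _ _).const_mul _)]
  refine intervalIntegral.integral_congr fun x _ => ?_
  have hne := ofReal_sub_ne_zero hw.ne' x
  have hne' := sub_conj_ne_zero hw (Complex.ofReal_im x).ge
  rw [dslope_of_ne _ (sub_ne_zero.1 hne), slope_def_field]
  field_simp
  ring

theorem tendsto_schwarz_integral (hc : ContinuousOn G {z | 0 ≤ z.im})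
    (hd : DifferentiableOn ℂ G {z | 0 < z.im}) (hl : Tendsto G upperInfty (𝓝 0)) (hw : 0 < w.im) :
    Tendsto (fun R : ℝ => ∫ x in (-R)..R, ((2 * (G x).re : ℝ) : ℂ) / ((x : ℂ) - w)) atTop
      (𝓝 (2 * Real.pi * Complex.I * G w)) := by
  have hconj : Continuous fun x : ℝ => G x * ((x : ℂ) - (starRingEnd ℂ) w)⁻¹ :=
    continuous_comp_ofReal (hc.mul (continuousOn_inv_sub_conj hw))
  have hpoisson : Continuous fun x : ℝ =>
      G x * (((x : ℂ) - w)⁻¹ - ((x : ℂ) - (starRingEnd ℂ) w)⁻¹) :=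
    (continuous_comp_ofReal hc).mul (continuous_poisson hw)
  have htendsto := tendsto_integral_mul_inv_sub_conj hc hd hl hw
  have h := ((tendsto_integral_mul_poisson hc hd hl hw).add htendsto).add
    ((Complex.continuous_conj.tendsto 0).comp htendsto)
  rw [map_zero, add_zero, add_zero] at h
  refine h.congr fun R => ?_
  rw [Function.comp_apply, ← intervalIntegral.intervalIntegral_conj,
    ← intervalIntegral.integral_add (hpoisson.intervalIntegrable _ _)
      (hconj.intervalIntegrable _ _),
    ← intervalIntegral.integral_add ((hpoisson.fun_add hconj).intervalIntegrable _ _)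
      ((Complex.continuous_conj.comp' hconj).intervalIntegrable _ _)]
  refine intervalIntegral.integral_congr fun x _ => ?_
  rw [← Complex.add_conj, map_mul, map_inv₀, map_sub, Complex.conj_conj, Complex.conj_ofReal]
  ring

theorem eq_exp_integral_log_norm {F : ℂ → ℂ} (hc : ContinuousOn F {z | 0 ≤ z.im})
    (hd : DifferentiableOn ℂ F {z | 0 < z.im}) (h0 : ∀ z : ℂ, 0 ≤ z.im → F z ≠ 0)
    (hl : Tendsto F upperInfty (𝓝 1)) (hw : 0 < w.im)
    (hi : Integrable fun x : ℝ => ((2 * Real.log ‖F x‖ : ℝ) : ℂ) / ((x : ℂ) - w)) :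
    F w = Complex.exp ((1 / (2 * Real.pi * Complex.I)) *
      ∫ x : ℝ, ((2 * Real.log ‖F x‖ : ℝ) : ℂ) / ((x : ℂ) - w)) := by
  obtain ⟨G, hGc, hGd, hGF, hGl⟩ := exists_exp_eq_of_tendsto_one hc hd h0 hl
  have hre : ∀ x : ℝ, (G x).re = Real.log ‖F x‖ := fun x => by
    rw [← hGF x (Complex.ofReal_im x).ge, Complex.norm_exp, Real.log_exp]
  have hschwarz := tendsto_schwarz_integral hGc hGd hGl hw
  simp only [hre] at hschwarz
  have hlim := intervalIntegral_tendsto_integral hi tendsto_neg_atTop_atBot tendsto_id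
  rw [tendsto_nhds_unique hlim hschwarz, ← hGF w hw.le, one_div,
    inv_mul_cancel_left₀ Complex.two_pi_I_ne_zero]

end Schwarz

section Zeros

variable {a : ℂ → ℂ}

theorem exists_eq_pow_mul (hc : ContinuousOn a {z | 0 ≤ z.im})
    (hd : DifferentiableOn ℂ a {z | 0 < z.im}) {z₀ : ℂ} (hz₀ : 0 < z₀.im) {n : ℕ}
    (hord : analyticOrderAt a z₀ = n) :
    ∃ b : ℂ → ℂ, ContinuousOn b {z | 0 ≤ z.im} ∧ DifferentiableOn ℂ b {z | 0 < z.im} ∧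
      b z₀ ≠ 0 ∧ a = fun w => (w - z₀) ^ n * b w := by
  have hnhds := (Complex.isOpen_im_gt 0).mem_nhds hz₀
  induction n generalizing a with
  | zero =>
    rw [Nat.cast_zero, (hd.analyticAt hnhds).analyticOrderAt_eq_zero] at hord
    exact ⟨a, hc, hd, hord, by simp⟩
  | succ n ih =>
    have hzero : a z₀ = 0 := apply_eq_zero_of_analyticOrderAt_ne_zero (by simp [hord])
    have hdd := (Complex.differentiableOn_dslope hnhds).2 hd
    have ha : a = (fun w => w - z₀) * dslope a z₀ := funext fun w => by
      simpa [hzero] using (sub_smul_dslope a z₀ w).symm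
    have hord' : analyticOrderAt (dslope a z₀) z₀ = n := by
      rw [ha, analyticOrderAt_mul (by fun_prop) (hdd.analyticAt hnhds),
        analyticOrderAt_id_sub_const_self, Nat.cast_add, Nat.cast_one, add_comm] at hord
      exact WithTop.add_right_cancel ENat.one_ne_top hord
    obtain ⟨b, hbc, hbd, hb0, hb⟩ := ih (continuousOn_dslope_upper hc hd hz₀) hdd hord'
    refine ⟨b, hbc, hbd, hb0, ha.trans (funext fun w => ?_)⟩
    rw [Pi.mul_apply, hb]
    ring

theorem exists_eq_prod_mul {ι : Type*} (hc : ContinuousOn a {z | 0 ≤ z.im})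
    (hd : DifferentiableOn ℂ a {z | 0 < z.im}) {l : ι → ℂ} (hl : Function.Injective l) {m : ι → ℕ}
    (s : Finset ι) (hpos : ∀ i ∈ s, 0 < (l i).im) (hord : ∀ i ∈ s, analyticOrderAt a (l i) = m i) :
    ∃ b : ℂ → ℂ, ContinuousOn b {z | 0 ≤ z.im} ∧ DifferentiableOn ℂ b {z | 0 < z.im} ∧
      (∀ i ∈ s, b (l i) ≠ 0) ∧ a = fun w => (∏ i ∈ s, (w - l i) ^ m i) * b w := by
  classical
  induction s using Finset.induction_on with
  | empty => exact ⟨a, hc, hd, by simp, by simp⟩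
  | insert j s hj ih =>
    rw [Finset.forall_mem_insert] at hpos hord
    obtain ⟨b, hbc, hbd, hb0, hb⟩ := ih hpos.2 hord.2
    have hprod : AnalyticAt ℂ (fun w => ∏ i ∈ s, (w - l i) ^ m i) (l j) := by fun_prop
    have hprod0 : ∏ i ∈ s, (l j - l i) ^ m i ≠ 0 :=
      Finset.prod_ne_zero_iff.2 fun i hi => pow_ne_zero _
        (sub_ne_zero.2 fun h => hj (hl h ▸ hi))
    have hordb : analyticOrderAt b (l j) = m j := by
      have hmul := analyticOrderAt_mul hprod
        (hbd.analyticAt ((Complex.isOpen_im_gt 0).mem_nhds hpos.1))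
      rw [hprod.analyticOrderAt_eq_zero.2 hprod0, zero_add] at hmul
      rw [← hmul, ← hord.1, hb]
      rfl
    obtain ⟨c, hcc, hcd, hc0, hcb⟩ := exists_eq_pow_mul hbc hbd hpos.1 hordb
    refine ⟨c, hcc, hcd, Finset.forall_mem_insert _ _ _ |>.2 ⟨hc0, fun i hi => ?_⟩, ?_⟩
    · have hbi := hb0 i hi
      rw [hcb] at hbi
      exact right_ne_zero_of_mul hbi
    · rw [hb, hcb]
      funext w
      rw [Finset.prod_insert hj]
      ring

end Zeros

section Blaschke

variable {ι : Type*} [Fintype ι] {l : ι → ℂ} {m : ι → ℕ}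

/-- The finite Blaschke product of the upper half-plane with zeros `l i` of multiplicity `m i`,
normalised to be `1` at infinity. -/
def blaschke (l : ι → ℂ) (m : ι → ℕ) (w : ℂ) : ℂ :=
  ∏ i, ((w - l i) / (w - (starRingEnd ℂ) (l i))) ^ m i

theorem norm_blaschke_ofReal (hpos : ∀ i, 0 < (l i).im) (x : ℝ) : ‖blaschke l m x‖ = 1 := by
  rw [blaschke, norm_prod]
  refine Finset.prod_eq_one fun i _ => ?_
  have hconj : (x : ℂ) - (starRingEnd ℂ) (l i) = (starRingEnd ℂ) ((x : ℂ) - l i) := by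
    rw [map_sub, Complex.conj_ofReal]
  rw [norm_pow, norm_div, hconj, RCLike.norm_conj,
    div_self (norm_ne_zero_iff.2 (ofReal_sub_ne_zero (hpos i).ne' x)), one_pow]

theorem conj_blaschke_conj (w : ℂ) :
    (starRingEnd ℂ) (blaschke l m ((starRingEnd ℂ) w)) = (blaschke l m w)⁻¹ := by
  simp only [blaschke, map_prod, map_pow, map_div₀, map_sub, Complex.conj_conj,
    ← Finset.prod_inv_distrib, ← inv_pow, inv_div]

theorem continuousOn_blaschke (hpos : ∀ i, 0 < (l i).im) :
    ContinuousOn (blaschke l m) {z | 0 ≤ z.im} :=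
  continuousOn_finsetProd _ fun i _ => ((continuousOn_id.sub continuousOn_const).div
    (continuousOn_id.sub continuousOn_const) fun _ hz => sub_conj_ne_zero (hpos i) hz).pow _

theorem tendsto_blaschke : Tendsto (blaschke l m) upperInfty (𝓝 1) := by
  have hfactor : ∀ i, Tendsto (fun w => ((w - l i) / (w - (starRingEnd ℂ) (l i))) ^ m i)
      upperInfty (𝓝 1) := fun i => by
    have h := ((tendsto_div_sub_upperInfty ((starRingEnd ℂ) (l i))).sub
      ((tendsto_inv_sub_upperInfty ((starRingEnd ℂ) (l i))).const_mul (l i))).pow (m i)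
    rw [mul_zero, sub_zero, one_pow] at h
    refine h.congr fun w => ?_
    rw [sub_div, div_eq_mul_inv (l i)]
  have hprod := tendsto_finsetProd Finset.univ fun i _ => hfactor i
  rw [Finset.prod_const_one] at hprod
  exact hprod

variable {A : ℂ → ℂ}

theorem exists_eq_mul_blaschke (hc : ContinuousOn A {z | 0 ≤ z.im})
    (hd : DifferentiableOn ℂ A {z | 0 < z.im}) (hl : Function.Injective l)
    (hpos : ∀ i, 0 < (l i).im) (hord : ∀ i, analyticOrderAt A (l i) = m i)
    (hzero : ∀ w : ℂ, 0 ≤ w.im → A w = 0 → ∃ i, l i = w) :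
    ∃ F : ℂ → ℂ, ContinuousOn F {z | 0 ≤ z.im} ∧ DifferentiableOn ℂ F {z | 0 < z.im} ∧
      (∀ z : ℂ, 0 ≤ z.im → F z ≠ 0) ∧ ∀ w : ℂ, 0 ≤ w.im → A w = F w * blaschke l m w := by
  obtain ⟨b, hbc, hbd, hb0, rfl⟩ := exists_eq_prod_mul hc hd hl Finset.univ (fun i _ => hpos i)
    (fun i _ => hord i)
  have hconj : ∀ w : ℂ, 0 ≤ w.im → ∏ i, (w - (starRingEnd ℂ) (l i)) ^ m i ≠ 0 := fun w hw =>
    Finset.prod_ne_zero_iff.2 fun i _ => pow_ne_zero _ (sub_conj_ne_zero (hpos i) hw)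
  refine ⟨fun w => b w * ∏ i, (w - (starRingEnd ℂ) (l i)) ^ m i, hbc.mul (by fun_prop),
    hbd.mul (by fun_prop), fun w hw => mul_ne_zero (fun h0 => ?_) (hconj w hw), fun w hw => ?_⟩
  · obtain ⟨i, rfl⟩ := hzero w hw (by simp only [h0, mul_zero])
    exact hb0 i (Finset.mem_univ i) h0
  · have hne := hconj w hw
    rw [blaschke]
    simp only [div_pow, Finset.prod_div_distrib]
    field_simp

theorem eq_mul_blaschke_mul_exp_integral (hc : ContinuousOn A {z | 0 ≤ z.im})
    (hd : DifferentiableOn ℂ A {z | 0 < z.im}) (hl : Function.Injective l)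
    (hpos : ∀ i, 0 < (l i).im) (hord : ∀ i, analyticOrderAt A (l i) = m i)
    (hzero : ∀ w : ℂ, 0 ≤ w.im → A w = 0 → ∃ i, l i = w) {e : ℂ} (he : ‖e‖ = 1)
    (hlim : Tendsto A upperInfty (𝓝 e)) {w : ℂ} (hw : 0 < w.im)
    (hi : Integrable fun x : ℝ => ((2 * Real.log ‖A x‖ : ℝ) : ℂ) / ((x : ℂ) - w)) :
    A w = Complex.exp ((1 / (2 * Real.pi * Complex.I)) *
      ∫ x : ℝ, ((2 * Real.log ‖A x‖ : ℝ) : ℂ) / ((x : ℂ) - w)) * blaschke l m w * e := by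
  obtain ⟨F, hFc, hFd, hF0, hF⟩ := exists_eq_mul_blaschke hc hd hl hpos hord hzero
  have he0 : e ≠ 0 := norm_ne_zero_iff.1 (he ▸ one_ne_zero)
  have hFlim : Tendsto (fun z => F z / e) upperInfty (𝓝 1) := by
    have h := (hlim.div (tendsto_blaschke (l := l) (m := m)) one_ne_zero).div_const e
    rw [div_one, div_self he0] at h
    refine h.congr' ?_
    filter_upwards [(tendsto_blaschke (l := l) (m := m)).eventually_ne one_ne_zero,
      eventually_inf_principal.2 (Eventually.of_forall fun z hz => hz)] with z hz him
    rw [Pi.div_apply, hF z him, mul_div_cancel_right₀ _ hz]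
  have hnorm : ∀ x : ℝ, ‖F x / e‖ = ‖A x‖ := fun x => by
    rw [hF x (Complex.ofReal_im x).ge, norm_mul, norm_blaschke_ofReal hpos, norm_div, he, mul_one,
      div_one]
  have hFw := eq_exp_integral_log_norm (hFc.div_const e) (hFd.div_const e)
    (fun z hz => div_ne_zero (hF0 z hz) he0) hFlim hw (by simpa only [hnorm] using hi)
  simp only [hnorm] at hFw
  rw [← hFw, hF w hw.le]
  field_simp

theorem eq_blaschke_mul_of_norm_eq_one (hc : ContinuousOn A {z | 0 ≤ z.im})
    (hd : DifferentiableOn ℂ A {z | 0 < z.im}) (hl : Function.Injective l)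
    (hpos : ∀ i, 0 < (l i).im) (hord : ∀ i, analyticOrderAt A (l i) = m i)
    (hzero : ∀ w : ℂ, 0 ≤ w.im → A w = 0 → ∃ i, l i = w) {e : ℂ} (he : ‖e‖ = 1)
    (hlim : Tendsto A upperInfty (𝓝 e)) (hnorm : ∀ x : ℝ, ‖A x‖ = 1) :
    EqOn A (fun w => blaschke l m w * e) {z | 0 ≤ z.im} := by
  have hupper : EqOn A (fun w => blaschke l m w * e) {z | 0 < z.im} := fun w hw => by
    have h := eq_mul_blaschke_mul_exp_integral hc hd hl hpos hord hzero he hlim hw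
      (by simp [hnorm])
    simpa [hnorm] using h
  refine hupper.of_subset_closure hc ((continuousOn_blaschke hpos).mul continuousOn_const)
    (fun z (hz : 0 < z.im) => hz.le) ?_
  rw [Complex.closure_setOfPred_lt_im]

end Blaschke

section Decay

theorem isBigO_log_norm {α : Type*} {s : Filter α} {a : α → ℂ} {e : ℂ} {g : α → ℝ} (he : ‖e‖ = 1)
    (h : (fun x => a x - e) =O[s] g) (hg : Tendsto g s (𝓝 0)) :
    (fun x => Real.log ‖a x‖) =O[s] g := by
  have hnorm : (fun x => ‖a x‖ - 1) =O[s] g :=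
    (Asymptotics.isBigO_of_le s fun x => he ▸ abs_norm_sub_norm_le (a x) e).trans h
  have htend : Tendsto (fun x => ‖a x‖) s (𝓝 1) :=
    tendsto_sub_nhds_zero_iff.1 (hnorm.trans_tendsto hg)
  have hlog := (Real.hasDerivAt_log one_ne_zero).isBigO_sub.comp_tendsto htend
  simp only [Real.log_one, sub_zero, Function.comp_def] at hlog
  exact hlog.trans hnorm

theorem integrable_of_isBigO_inv_sq {f : ℝ → ℂ} (hf : Continuous f)
    (h : f =O[cocompact ℝ] fun x => (x ^ 2)⁻¹) : Integrable f := by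
  have hone : (fun x : ℝ => (x ^ 2)⁻¹) =O[cocompact ℝ] fun x => (1 + x ^ 2)⁻¹ := by
    refine Asymptotics.IsBigO.of_bound 2 ?_
    filter_upwards [tendsto_norm_cocompact_atTop.eventually_ge_atTop 1] with x hx
    have hsq : 1 ≤ x ^ 2 := (one_le_sq_iff_one_le_abs x).2 hx
    rw [Real.norm_of_nonneg (by positivity), Real.norm_of_nonneg (by positivity),
      ← div_eq_mul_inv, inv_eq_one_div, div_le_div_iff₀ (by positivity) (by positivity)]
    linarith
  exact hf.locallyIntegrable.integrable_of_isBigO_cocompact (h.trans hone)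
    (integrable_inv_one_add_sq.integrableAtFilter _)

variable {L : ℝ → ℂ} {z : ℂ}

theorem tendsto_ofReal_upperInfty : Tendsto ((↑) : ℝ → ℂ) (cocompact ℝ) upperInfty :=
  tendsto_inf.2 ⟨by
    rw [← tendsto_norm_atTop_iff_cobounded]
    simpa only [Complex.norm_real] using tendsto_norm_cocompact_atTop (E := ℝ),
    tendsto_principal.2 (Eventually.of_forall fun x => (Complex.ofReal_im x).ge)⟩

theorem isBigO_inv_ofReal_sub (z : ℂ) :
    (fun x : ℝ => ((x : ℂ) - z)⁻¹) =O[cocompact ℝ] fun x => x⁻¹ := by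
  have hdiv := ((tendsto_div_sub_upperInfty z).comp tendsto_ofReal_upperInfty).isBigO_one ℝ
  refine ((Asymptotics.isBigO_refl (fun x : ℝ => x⁻¹) _).smul hdiv).congr' ?_ ?_
  · filter_upwards [tendsto_norm_cocompact_atTop.eventually_ne_atTop 0] with x hx
    have hx0 : (x : ℂ) ≠ 0 := Complex.ofReal_ne_zero.2 (norm_ne_zero_iff.1 hx)
    simp only [Function.comp_apply, Complex.real_smul, Complex.ofReal_inv]
    rw [← mul_div_assoc, inv_mul_cancel₀ hx0, one_div]
  · exact Eventually.of_forall fun x => mul_one _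

theorem integrable_div_ofReal_sub (hL : Continuous L) (hLO : L =O[cocompact ℝ] fun x => x⁻¹)
    (hz : z.im ≠ 0) : Integrable fun x : ℝ => L x / (x - z) := by
  refine integrable_of_isBigO_inv_sq (hL.div (by fun_prop) (ofReal_sub_ne_zero hz)) ?_
  simpa only [div_eq_mul_inv, sq, mul_inv] using hLO.mul (isBigO_inv_ofReal_sub z)

end Decay

section Rays

variable {L : ℝ → ℂ} {z c : ℂ} {ε : ℝ}

theorem mul_ofReal_sub_ne_zero (hc : c ^ 2 = ε) (hz : (z ^ 2).im ≠ 0) (r : ℝ) : c * r - z ≠ 0 :=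
  fun h => hz (by rw [← sub_eq_zero.1 h, mul_pow, hc, ← Complex.ofReal_pow, ← Complex.ofReal_mul,
    Complex.ofReal_im])

theorem integrable_ray (hL : Continuous L) (hLO : L =O[cocompact ℝ] fun x => x⁻¹)
    (hε : ε ≠ 0) (hc : c ^ 2 = ε) (hz : (z ^ 2).im ≠ 0) :
    Integrable fun r : ℝ => L (ε * r ^ 2) / (c * r - z) := by
  have hc0 : c ≠ 0 := fun h => hε (by simpa [h] using hc.symm)
  refine integrable_of_isBigO_inv_sq ((hL.comp (by fun_prop)).div (by fun_prop)
    (mul_ofReal_sub_ne_zero hc hz)) ?_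
  have hray : Tendsto (fun r : ℝ => (c * r - z)⁻¹) (cocompact ℝ) (𝓝 0) :=
    tendsto_inv₀_cobounded.comp ((tendsto_sub_const_cobounded z).comp
      ((tendsto_mul_left_cobounded hc0).comp (tendsto_ofReal_upperInfty.mono_right inf_le_left)))
  have hsq : Tendsto (fun r : ℝ => ε * r ^ 2) (cocompact ℝ) (cocompact ℝ) := by
    rw [← Metric.cobounded_eq_cocompact]
    exact (tendsto_mul_left_cobounded hε).comp (tendsto_pow_cobounded_cobounded two_ne_zero)
  have hbound := (hLO.comp_tendsto hsq).mul (hray.isBigO_one ℝ)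
  simp only [Function.comp_def, mul_one, mul_inv] at hbound
  simpa only [div_eq_mul_inv] using hbound.trans (Asymptotics.isBigO_const_mul_self _ _ _)

theorem integral_two_mul_comp_sq (g : ℝ → ℂ) :
    ∫ r in Ioi (0 : ℝ), (2 * r : ℂ) * g (r ^ 2) = ∫ x in Ioi (0 : ℝ), g x := by
  rw [← integral_comp_rpow_Ioi_of_pos (g := g) two_pos]
  refine setIntegral_congr_fun measurableSet_Ioi fun r _ => ?_
  simp only [Real.rpow_two]
  rw [Complex.real_smul]
  norm_num

theorem mul_integral_ray_sub_integral_ray (hL : Continuous L)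
    (hLO : L =O[cocompact ℝ] fun x => x⁻¹) (hε : ε ≠ 0) (hc : c ^ 2 = ε) (hz : (z ^ 2).im ≠ 0) :
    c * ((∫ r in Ioi (0 : ℝ), L (ε * r ^ 2) / (c * r - z)) -
      ∫ r in Ioi (0 : ℝ), L (ε * r ^ 2) / (-c * r - z)) =
      ε * ∫ x in Ioi (0 : ℝ), L (ε * x) / (((ε * x : ℝ) : ℂ) - z ^ 2) := by
  have hc' : (-c) ^ 2 = ε := by rw [neg_sq, hc]
  rw [← integral_sub (integrable_ray hL hLO hε hc hz).integrableOn
      (integrable_ray hL hLO hε hc' hz).integrableOn, ← integral_const_mul,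
    ← integral_two_mul_comp_sq fun x => L (ε * x) / (((ε * x : ℝ) : ℂ) - z ^ 2),
    ← integral_const_mul]
  refine integral_congr_ae (Eventually.of_forall fun r => ?_)
  have hne := mul_ofReal_sub_ne_zero hc hz r
  have hneg : -c * r - z = -(c * r + z) := by ring
  have hne' := mul_ofReal_sub_ne_zero hc' hz r
  rw [hneg, neg_ne_zero] at hne'
  have hfactor : ((ε * r ^ 2 : ℝ) : ℂ) - z ^ 2 = (c * r - z) * (c * r + z) := by
    push_cast
    rw [← hc]
    ring
  simp only [hneg, hfactor]
  rw [← hc]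
  field_simp
  ring

end Rays

section Contour

theorem ofReal_mem_contour (r : ℝ) : (r : ℂ) ∈ contour := Or.inl (by simp)

theorem I_mul_ofReal_mem_contour (r : ℝ) : Complex.I * (r : ℂ) ∈ contour := Or.inr (by simp)

theorem neg_mem_contour {k : ℂ} (hk : k ∈ contour) : -k ∈ contour := by
  rcases hk with h | h
  · exact Or.inl (by simp [h])
  · exact Or.inr (by simp [h])

theorem exists_mem_contour_sq_eq (x : ℝ) : ∃ ζ ∈ contour, ζ ^ 2 = (x : ℂ) := by
  rcases le_total 0 x with hx | hx
  · refine ⟨(Real.sqrt x : ℝ), ofReal_mem_contour _, ?_⟩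
    rw [← Complex.ofReal_pow, Real.sq_sqrt hx]
  · refine ⟨Complex.I * (Real.sqrt (-x) : ℝ), I_mul_ofReal_mem_contour _, ?_⟩
    rw [mul_pow, ← Complex.ofReal_pow, Real.sq_sqrt (neg_nonneg.2 hx), Complex.I_sq,
      Complex.ofReal_neg, neg_one_mul, neg_neg]

variable {f : ℂ → ℂ} {L : ℝ → ℂ} {z c : ℂ} {ε : ℝ}

theorem apply_ray_eq_div (hf : ∀ ζ ∈ contour, f ζ = L (ζ ^ 2).re / (ζ - z)) (hc : c ^ 2 = ε)
    (hmem : ∀ r : ℝ, c * r ∈ contour) (r : ℝ) : f (c * r) = L (ε * r ^ 2) / (c * r - z) := by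
  rw [hf _ (hmem r), mul_pow, hc, ← Complex.ofReal_pow, ← Complex.ofReal_mul, Complex.ofReal_re]

theorem neg_ray_mem_contour (hmem : ∀ r : ℝ, c * r ∈ contour) (r : ℝ) : -c * r ∈ contour :=
  neg_mul c r ▸ neg_mem_contour (hmem r)

theorem integrable_apply_ray (hL : Continuous L) (hLO : L =O[cocompact ℝ] fun x => x⁻¹)
    (hz : (z ^ 2).im ≠ 0) (hf : ∀ ζ ∈ contour, f ζ = L (ζ ^ 2).re / (ζ - z)) (hε : ε ≠ 0)
    (hc : c ^ 2 = ε) (hmem : ∀ r : ℝ, c * r ∈ contour) : Integrable fun r : ℝ => f (c * r) := by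
  simpa only [apply_ray_eq_div hf hc hmem] using integrable_ray hL hLO hε hc hz

theorem mul_integral_apply_ray_sub_integral_apply_neg_ray (hL : Continuous L)
    (hLO : L =O[cocompact ℝ] fun x => x⁻¹) (hz : (z ^ 2).im ≠ 0)
    (hf : ∀ ζ ∈ contour, f ζ = L (ζ ^ 2).re / (ζ - z)) (hε : ε ≠ 0) (hc : c ^ 2 = ε)
    (hmem : ∀ r : ℝ, c * r ∈ contour) :
    c * ((∫ r in Ioi (0 : ℝ), f (c * r)) - ∫ r in Ioi (0 : ℝ), f (-c * r)) =
      ε * ∫ x in Ioi (0 : ℝ), L (ε * x) / (((ε * x : ℝ) : ℂ) - z ^ 2) := by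
  simpa only [apply_ray_eq_div hf hc hmem,
    apply_ray_eq_div hf ((neg_sq c).trans hc) (neg_ray_mem_contour hmem)]
    using mul_integral_ray_sub_integral_ray hL hLO hε hc hz

theorem one_mul_mem_contour (r : ℝ) : 1 * (r : ℂ) ∈ contour :=
  (one_mul (r : ℂ)).symm ▸ ofReal_mem_contour r

theorem I_sq_eq_ofReal : Complex.I ^ 2 = ((-1 : ℝ) : ℂ) := by
  rw [Complex.I_sq, Complex.ofReal_neg, Complex.ofReal_one]

theorem one_sq_eq_ofReal : (1 : ℂ) ^ 2 = ((1 : ℝ) : ℂ) := by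
  rw [one_pow, Complex.ofReal_one]

theorem contourIntegrable_of_eq_div (hL : Continuous L) (hLO : L =O[cocompact ℝ] fun x => x⁻¹)
    (hz : (z ^ 2).im ≠ 0) (hf : ∀ ζ ∈ contour, f ζ = L (ζ ^ 2).re / (ζ - z)) :
    ContourIntegrable f := by
  have hneg : (-1 : ℝ) ≠ 0 := neg_ne_zero.2 one_ne_zero
  have h₁ := integrable_apply_ray hL hLO hz hf one_ne_zero one_sq_eq_ofReal one_mul_mem_contour
  have h₂ := integrable_apply_ray hL hLO hz hf hneg I_sq_eq_ofReal I_mul_ofReal_mem_contour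
  have h₃ := integrable_apply_ray hL hLO hz hf one_ne_zero ((neg_sq 1).trans one_sq_eq_ofReal)
    (neg_ray_mem_contour one_mul_mem_contour)
  have h₄ := integrable_apply_ray hL hLO hz hf hneg ((neg_sq _).trans I_sq_eq_ofReal)
    (neg_ray_mem_contour I_mul_ofReal_mem_contour)
  simp only [neg_mul, one_mul] at h₁ h₃ h₄
  exact ⟨h₁.integrableOn, h₂.integrableOn, h₃.integrableOn, h₄.integrableOn⟩

theorem contourIntegral_eq_of_eq_div (hL : Continuous L) (hLO : L =O[cocompact ℝ] fun x => x⁻¹)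
    (hz : (z ^ 2).im ≠ 0) (hf : ∀ ζ ∈ contour, f ζ = L (ζ ^ 2).re / (ζ - z)) :
    contourIntegral f = ∫ x : ℝ, L x / (x - z ^ 2) := by
  have hreal := mul_integral_apply_ray_sub_integral_apply_neg_ray hL hLO hz hf one_ne_zero
    one_sq_eq_ofReal one_mul_mem_contour
  have himag := mul_integral_apply_ray_sub_integral_apply_neg_ray hL hLO hz hf
    (neg_ne_zero.2 one_ne_zero) I_sq_eq_ofReal I_mul_ofReal_mem_contour
  have hline := integrable_div_ofReal_sub hL hLO hz
  have hIic := integral_comp_neg_Ioi (0 : ℝ) fun x : ℝ => L x / (x - z ^ 2)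
  rw [neg_zero] at hIic
  rw [← intervalIntegral.integral_Iic_add_Ioi hline.integrableOn hline.integrableOn, ← hIic,
    contourIntegral]
  simp only [neg_mul, one_mul, Complex.ofReal_neg, Complex.ofReal_one] at hreal himag ⊢
  linear_combination hreal - himag

end Contour

section Continuation

variable {q : ℝ → ℝ → ℂ} {t : ℝ} {k : ℂ}

theorem sq_im_pos_of_mem_Dplus (hk : k ∈ Dplus) : 0 < (k ^ 2).im := by
  rw [sq, Complex.mul_im, mul_comm k.im, ← two_mul]
  exact mul_pos two_pos hk

theorem conj_mem_Dplus (hk : k ∈ Dminus) : (starRingEnd ℂ) k ∈ Dplus := by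
  simpa [Dplus, Dminus] using hk

theorem sq_im_neg_of_mem_Dminus (hk : k ∈ Dminus) : (k ^ 2).im < 0 := by
  rw [← neg_pos, ← conj_sq_im]
  exact sq_im_pos_of_mem_Dplus (conj_mem_Dplus hk)

theorem conj_mem_contour (hk : k ∈ contour) : (starRingEnd ℂ) k ∈ contour := by
  simpa [contour] using hk

theorem isOpen_Dplus : IsOpen Dplus :=
  isOpen_lt continuous_const (Complex.continuous_re.mul Complex.continuous_im)

theorem isOpen_Dminus : IsOpen Dminus :=
  isOpen_lt (Complex.continuous_re.mul Complex.continuous_im) continuous_const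

theorem sq_im_nonneg (hk : k ∈ Dplus ∪ contour) : 0 ≤ (k ^ 2).im :=
  hk.elim (fun h => (sq_im_pos_of_mem_Dplus h).le) fun h => (sq_im_eq_zero_of_mem_contour h).ge

theorem conj_mem_Dplus_union_contour (hk : k ∈ Dminus ∪ contour) :
    (starRingEnd ℂ) k ∈ Dplus ∪ contour :=
  hk.imp conj_mem_Dplus conj_mem_contour

theorem s22_eq_conj_s11_conj (hc : Continuous fun x => q x t) (hi : Integrable fun x => q x t)
    (hk : k ∈ Dminus ∪ contour) : s22 q t k = (starRingEnd ℂ) (s11 q t ((starRingEnd ℂ) k)) := by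
  have him := sq_im_nonneg (conj_mem_Dplus_union_contour hk)
  rw [s11_eq_transmission hc hi him]
  rw [conj_sq_im, neg_nonneg] at him
  rw [s22_eq_conj_transmission hc hi him, map_pow]

theorem continuousOn_s11 (hc : Continuous fun x => q x t) (hi : Integrable fun x => q x t) :
    ContinuousOn (s11 q t) (Dplus ∪ contour) :=
  ((continuousOn_transmission hc hi).comp (continuous_pow 2).continuousOn
    fun _ hk => sq_im_nonneg hk).congr fun _ hk => s11_eq_transmission hc hi (sq_im_nonneg hk)

theorem analyticOnNhd_s11 (hc : Continuous fun x => q x t) (hi : Integrable fun x => q x t) :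
    AnalyticOnNhd ℂ (s11 q t) Dplus :=
  DifferentiableOn.analyticOnNhd (((differentiableOn_transmission hc hi).comp
    (differentiable_pow 2).differentiableOn fun _ hk => sq_im_pos_of_mem_Dplus hk).congr
    fun _ hk => s11_eq_transmission hc hi (sq_im_pos_of_mem_Dplus hk).le) isOpen_Dplus

theorem continuousOn_s22 (hc : Continuous fun x => q x t) (hi : Integrable fun x => q x t) :
    ContinuousOn (s22 q t) (Dminus ∪ contour) :=
  (Complex.continuous_conj.comp_continuousOn ((continuousOn_s11 hc hi).comp
    Complex.continuous_conj.continuousOn fun _ hk => conj_mem_Dplus_union_contour hk)).congr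
    fun _ hk => s22_eq_conj_s11_conj hc hi hk

theorem analyticOnNhd_s22 (hc : Continuous fun x => q x t) (hi : Integrable fun x => q x t) :
    AnalyticOnNhd ℂ (s22 q t) Dminus := by
  refine DifferentiableOn.analyticOnNhd (fun k hk => ?_) isOpen_Dminus
  have hconj := ((analyticOnNhd_s11 hc hi _ (conj_mem_Dplus hk)).differentiableAt).conj_conj
  rw [Complex.conj_conj] at hconj
  refine (hconj.congr_of_eventuallyEq ?_).differentiableWithinAt
  filter_upwards [isOpen_Dminus.mem_nhds hk] with z hz
  exact s22_eq_conj_s11_conj hc hi (Or.inl hz)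

theorem s11_zero (hc : Continuous fun x => q x t) (hi : Integrable fun x => q x t) :
    s11 q t 0 = 1 := by
  rw [s11_eq_transmission hc hi (by simp), zero_pow two_ne_zero, transmission_zero]

theorem transmission_ofReal_ne_zero (hc : Continuous fun x => q x t)
    (hi : Integrable fun x => q x t) (hs : ∀ ζ ∈ contour, s11 q t ζ ≠ 0) (x : ℝ) :
    transmission (fun x => q x t) x ≠ 0 := by
  obtain ⟨ζ, hζ, hsq⟩ := exists_mem_contour_sq_eq x
  rw [← hsq, ← s11_eq_transmission hc hi (sq_im_eq_zero_of_mem_contour hζ).ge]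
  exact hs ζ hζ

theorem analyticOrderAt_transmission_sq (hc : Continuous fun x => q x t)
    (hi : Integrable fun x => q x t) (hk : k ∈ Dplus) :
    analyticOrderAt (transmission fun x => q x t) (k ^ 2) = analyticOrderAt (s11 q t) k := by
  have hk0 : k ≠ 0 := by
    rintro rfl
    simp [Dplus] at hk
  have hs11 : s11 q t =ᶠ[𝓝 k] (transmission fun x => q x t) ∘ fun z => z ^ 2 := by
    filter_upwards [isOpen_Dplus.mem_nhds hk] with z hz
    exact s11_eq_transmission hc hi (sq_im_pos_of_mem_Dplus hz).le
  rw [analyticOrderAt_congr hs11]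
  exact (analyticOrderAt_comp_of_deriv_ne_zero (g := fun z => z ^ 2) (by fun_prop)
    (by simpa using hk0)).symm

theorem analyticOrderAt_eq_two {f : ℂ → ℂ} (hf : AnalyticAt ℂ f k) (h0 : f k = 0)
    (h1 : deriv f k = 0) (h2 : iteratedDeriv 2 f k ≠ 0) : analyticOrderAt f k = (2 : ℕ) := by
  refine (analyticOrderAt_eq_nat_iff_iteratedDeriv_eq_zero hf).2 ⟨fun i hi => ?_, h2⟩
  interval_cases i
  · rwa [iteratedDeriv_zero]
  · rwa [iteratedDeriv_one]

end Continuation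

section TransmissionAsymptotics

variable {q : ℝ → ℝ → ℂ} {t : ℝ}

theorem norm_exp_neg_I_mul_ofReal (v : ℝ) : ‖Complex.exp (-(Complex.I * v))‖ = 1 := by
  rw [Complex.norm_exp]
  simp

theorem isBigO_transmission_sub (hq : ContDiff ℝ 1 fun x => q x t)
    (hi : Integrable fun x => q x t) (hi' : Integrable (deriv fun x => q x t)) :
    (fun w => transmission (fun x => q x t) w - Complex.exp (-(Complex.I * v0 q t)))
      =O[upperInfty] fun w => ‖w‖⁻¹ := by
  obtain ⟨C, hC⟩ := exists_norm_transmission_sub_le hq hi hi'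
  refine Asymptotics.IsBigO.of_bound C (eventually_upperInfty_iff.2 ⟨1, one_pos, fun w hw h1 => ?_⟩)
  have hexp : Complex.I / 2 * ((∫ y, ‖q y t‖ ^ 2 : ℝ) : ℂ) = Complex.I * v0 q t := by
    rw [v0]
    push_cast
    ring
  rw [norm_inv, norm_norm, ← div_eq_mul_inv, ← hexp]
  exact hC w hw (norm_pos_iff.1 (one_pos.trans h1))

theorem tendsto_transmission (hq : ContDiff ℝ 1 fun x => q x t)
    (hi : Integrable fun x => q x t) (hi' : Integrable (deriv fun x => q x t)) :
    Tendsto (transmission fun x => q x t) upperInfty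
      (𝓝 (Complex.exp (-(Complex.I * v0 q t)))) :=
  tendsto_sub_nhds_zero_iff.1
    ((isBigO_transmission_sub hq hi hi').trans_tendsto tendsto_norm_upperInfty.inv_tendsto_atTop)

theorem isBigO_log_norm_transmission (hq : ContDiff ℝ 1 fun x => q x t)
    (hi : Integrable fun x => q x t) (hi' : Integrable (deriv fun x => q x t)) :
    (fun x : ℝ => Real.log ‖transmission (fun x => q x t) x‖) =O[cocompact ℝ] fun x => x⁻¹ := by
  have hO := (isBigO_log_norm (norm_exp_neg_I_mul_ofReal (v0 q t))
    (isBigO_transmission_sub hq hi hi') tendsto_norm_upperInfty.inv_tendsto_atTop).comp_tendsto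
    tendsto_ofReal_upperInfty
  exact hO.trans (Asymptotics.isBigO_of_le _ fun x => by simp)

end TransmissionAsymptotics

section DiscreteSpectrum

/-- `s₁₁` has no zero on `Σ`, and its zeros in the open first quadrant are exactly the pairwise
distinct points `k i`, of multiplicity `m i`. -/
structure IsDiscreteSpectrum {ι : Type*} (q : ℝ → ℝ → ℂ) (t : ℝ) (k : ι → ℂ) (m : ι → ℕ) :
    Prop where
  ne_zero : ∀ ζ ∈ contour, s11 q t ζ ≠ 0
  injective : Function.Injective k
  zero_iff : ∀ z : ℂ, (0 < z.re ∧ 0 < z.im ∧ s11 q t z = 0) ↔ ∃ i, k i = z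
  order_eq : ∀ i, analyticOrderAt (s11 q t) (k i) = m i

theorem exists_sq_eq_of_im_pos {w : ℂ} (hw : 0 < w.im) :
    ∃ k : ℂ, 0 < k.re ∧ 0 < k.im ∧ k ^ 2 = w := by
  obtain ⟨k, rfl⟩ := IsAlgClosed.exists_pow_nat_eq w (n := 2) two_pos
  have him : 0 < k.re * k.im := by
    rw [sq, Complex.mul_im] at hw
    linarith
  rcases pos_and_pos_or_neg_and_neg_of_mul_pos him with h | h
  · exact ⟨k, h.1, h.2, rfl⟩
  · exact ⟨-k, neg_pos.2 h.1, neg_pos.2 h.2, neg_sq k⟩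

theorem isDiscreteSpectrum_two {ι : Type*} {q : ℝ → ℝ → ℂ} {t : ℝ} {k : ι → ℂ}
    (hc : Continuous fun x => q x t) (hi : Integrable fun x => q x t)
    (hs : ∀ ζ ∈ contour, scatteringMatrix q t ζ 0 0 ≠ 0) (hk_inj : Function.Injective k)
    (hk : ∀ z : ℂ, (0 < z.re ∧ 0 < z.im ∧ s11 q t z = 0) ↔ ∃ i, k i = z)
    (hk_double : ∀ i, deriv (s11 q t) (k i) = 0 ∧ iteratedDeriv 2 (s11 q t) (k i) ≠ 0) :
    IsDiscreteSpectrum q t k fun _ => 2 where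
  ne_zero ζ hζ := s11_eq_scatteringMatrix hc hi hζ ▸ hs ζ hζ
  injective := hk_inj
  zero_iff := hk
  order_eq i := by
    obtain ⟨hre, him, h0⟩ := (hk (k i)).2 ⟨i, rfl⟩
    exact analyticOrderAt_eq_two (analyticOnNhd_s11 hc hi _ (mul_pos hre him)) h0
      (hk_double i).1 (hk_double i).2

namespace IsDiscreteSpectrum

variable {ι : Type*} {q : ℝ → ℝ → ℂ} {t : ℝ} {k : ι → ℂ} {m : ι → ℕ}

theorem re_pos (h : IsDiscreteSpectrum q t k m) (i : ι) : 0 < (k i).re :=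
  ((h.zero_iff _).2 ⟨i, rfl⟩).1

theorem mem_Dplus (h : IsDiscreteSpectrum q t k m) (i : ι) : k i ∈ Dplus :=
  mul_pos (h.re_pos i) ((h.zero_iff _).2 ⟨i, rfl⟩).2.1

theorem sq_injective (h : IsDiscreteSpectrum q t k m) : Function.Injective fun i => k i ^ 2 :=
  fun i j hij => by
    rcases sq_eq_sq_iff_eq_or_eq_neg.1 hij with heq | hneg
    · exact h.injective heq
    · have hre := congrArg Complex.re hneg
      rw [Complex.neg_re] at hre
      linarith [h.re_pos i, h.re_pos j]

theorem exists_sq_eq_of_transmission_eq_zero (h : IsDiscreteSpectrum q t k m)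
    (hc : Continuous fun x => q x t) (hi : Integrable fun x => q x t) {w : ℂ} (hw : 0 ≤ w.im)
    (h0 : transmission (fun x => q x t) w = 0) : ∃ i, k i ^ 2 = w := by
  rcases hw.eq_or_lt with hreal | hpos
  · have hw' : ((w.re : ℝ) : ℂ) = w := Complex.ext rfl hreal
    exact absurd (hw' ▸ h0) (transmission_ofReal_ne_zero hc hi h.ne_zero w.re)
  · obtain ⟨z, hre, him, rfl⟩ := exists_sq_eq_of_im_pos hpos
    obtain ⟨i, rfl⟩ := (h.zero_iff z).1 ⟨hre, him, by rw [s11_eq_transmission hc hi hw, h0]⟩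
    exact ⟨i, rfl⟩

theorem sq_im_pos (h : IsDiscreteSpectrum q t k m) (i : ι) : 0 < (k i ^ 2).im :=
  sq_im_pos_of_mem_Dplus (h.mem_Dplus i)

theorem analyticOrderAt_transmission (h : IsDiscreteSpectrum q t k m)
    (hc : Continuous fun x => q x t) (hi : Integrable fun x => q x t) (i : ι) :
    analyticOrderAt (transmission fun x => q x t) (k i ^ 2) = m i :=
  (analyticOrderAt_transmission_sq hc hi (h.mem_Dplus i)).trans (h.order_eq i)

end IsDiscreteSpectrum

end DiscreteSpectrum

section TraceIntegral

variable {q : ℝ → ℝ → ℂ} {t : ℝ} {z : ℂ}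

/-- `log (1 - ρ ρ̃)` as a function of the real variable `ζ ^ 2`, `ζ ∈ Σ`. -/
def traceDensity (q : ℝ → ℝ → ℂ) (t x : ℝ) : ℝ :=
  -(2 * Real.log ‖transmission (fun y => q y t) x‖)

theorem continuous_traceDensity (hc : Continuous fun x => q x t) (hi : Integrable fun x => q x t)
    (hs : ∀ ζ ∈ contour, s11 q t ζ ≠ 0) : Continuous fun x => (traceDensity q t x : ℂ) :=
  have hlog := (continuous_comp_ofReal (continuousOn_transmission hc hi)).norm.log fun x =>
    norm_ne_zero_iff.2 (transmission_ofReal_ne_zero hc hi hs x)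
  Complex.continuous_ofReal.comp (hlog.const_mul 2).neg

theorem isBigO_traceDensity (hq : ContDiff ℝ 1 fun x => q x t)
    (hi : Integrable fun x => q x t) (hi' : Integrable (deriv fun x => q x t)) :
    (fun x => (traceDensity q t x : ℂ)) =O[cocompact ℝ] fun x => x⁻¹ :=
  Complex.isBigO_ofReal_left.2
    ((isBigO_log_norm_transmission hq hi hi').const_mul_left 2).neg_left

theorem traceIntegrand_eq (hc : Continuous fun x => q x t) (hi : Integrable fun x => q x t)
    (hs : ∀ ζ ∈ contour, s11 q t ζ ≠ 0) :
    ∀ ζ ∈ contour, traceIntegrand q t z ζ = (traceDensity q t (ζ ^ 2).re : ℂ) / (ζ - z) :=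
  fun ζ hζ => by
    have hsq : (((ζ ^ 2).re : ℝ) : ℂ) = ζ ^ 2 :=
      Complex.ext rfl (sq_im_eq_zero_of_mem_contour hζ).symm
    rw [traceIntegrand, traceDensity, hsq, log_one_sub_rho_mul_rhoTilde hc hi hζ
      (s11_eq_scatteringMatrix hc hi hζ ▸ hs ζ hζ)]

theorem contourIntegrable_traceIntegrand (hq : ContDiff ℝ 1 fun x => q x t)
    (hi : Integrable fun x => q x t) (hi' : Integrable (deriv fun x => q x t))
    (hs : ∀ ζ ∈ contour, s11 q t ζ ≠ 0) (hz : (z ^ 2).im ≠ 0) :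
    ContourIntegrable (traceIntegrand q t z) :=
  contourIntegrable_of_eq_div (continuous_traceDensity hq.continuous hi hs)
    (isBigO_traceDensity hq hi hi') hz (traceIntegrand_eq hq.continuous hi hs)

theorem contourIntegral_traceIntegrand (hq : ContDiff ℝ 1 fun x => q x t)
    (hi : Integrable fun x => q x t) (hi' : Integrable (deriv fun x => q x t))
    (hs : ∀ ζ ∈ contour, s11 q t ζ ≠ 0) (hz : (z ^ 2).im ≠ 0) :
    contourIntegral (traceIntegrand q t z) = ∫ x : ℝ, (traceDensity q t x : ℂ) / (x - z ^ 2) :=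
  contourIntegral_eq_of_eq_div (continuous_traceDensity hq.continuous hi hs)
    (isBigO_traceDensity hq hi hi') hz (traceIntegrand_eq hq.continuous hi hs)

theorem contourIntegral_traceIntegrand_conj (hq : ContDiff ℝ 1 fun x => q x t)
    (hi : Integrable fun x => q x t) (hi' : Integrable (deriv fun x => q x t))
    (hs : ∀ ζ ∈ contour, s11 q t ζ ≠ 0) (hz : (z ^ 2).im ≠ 0) :
    contourIntegral (traceIntegrand q t ((starRingEnd ℂ) z)) =
      (starRingEnd ℂ) (contourIntegral (traceIntegrand q t z)) := by
  rw [contourIntegral_traceIntegrand hq hi hi' hs hz, contourIntegral_traceIntegrand hq hi hi' hs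
    (by rwa [conj_sq_im, neg_ne_zero]), ← integral_conj]
  simp only [map_div₀, map_sub, map_pow, Complex.conj_ofReal]

end TraceIntegral

section TraceFormula

variable {ι : Type*} [Fintype ι] {q : ℝ → ℝ → ℂ} {t : ℝ} {k : ι → ℂ} {m : ι → ℕ} {z : ℂ}

theorem s11_eq_exp_contourIntegral_mul_blaschke (hq : ContDiff ℝ 1 fun x => q x t)
    (hi : Integrable fun x => q x t) (hi' : Integrable (deriv fun x => q x t))
    (h : IsDiscreteSpectrum q t k m) (hz : z ∈ Dplus) :
    s11 q t z = Complex.exp (-(1 / (2 * Real.pi * Complex.I)) *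
        contourIntegral (traceIntegrand q t z)) * blaschke (fun i => k i ^ 2) m (z ^ 2) *
      Complex.exp (-(Complex.I * v0 q t)) := by
  have hc := hq.continuous
  have him := sq_im_pos_of_mem_Dplus hz
  have hneg : ∀ x : ℝ, ((2 * Real.log ‖transmission (fun y => q y t) x‖ : ℝ) : ℂ) / (x - z ^ 2) =
      -((traceDensity q t x : ℂ) / (x - z ^ 2)) := fun x => by
    rw [traceDensity, Complex.ofReal_neg, neg_div, neg_neg]
  have hint := (integrable_div_ofReal_sub (continuous_traceDensity hc hi h.ne_zero)
    (isBigO_traceDensity hq hi hi') him.ne').fun_neg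
  have hfactor := eq_mul_blaschke_mul_exp_integral (continuousOn_transmission hc hi)
    (differentiableOn_transmission hc hi) h.sq_injective
    h.sq_im_pos (h.analyticOrderAt_transmission hc hi)
    (fun w hw => h.exists_sq_eq_of_transmission_eq_zero hc hi hw)
    (norm_exp_neg_I_mul_ofReal (v0 q t)) (tendsto_transmission hq hi hi') him
    (by simpa only [hneg] using hint)
  simp only [hneg] at hfactor
  rw [s11_eq_transmission hc hi him.le, hfactor, integral_neg, mul_neg, ← neg_mul,
    contourIntegral_traceIntegrand hq hi hi' h.ne_zero him.ne']

theorem s22_eq_exp_contourIntegral_mul_inv_blaschke (hq : ContDiff ℝ 1 fun x => q x t)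
    (hi : Integrable fun x => q x t) (hi' : Integrable (deriv fun x => q x t))
    (h : IsDiscreteSpectrum q t k m) (hz : z ∈ Dminus) :
    s22 q t z = Complex.exp ((1 / (2 * Real.pi * Complex.I)) *
        contourIntegral (traceIntegrand q t z)) * (blaschke (fun i => k i ^ 2) m (z ^ 2))⁻¹ *
      Complex.exp (Complex.I * v0 q t) := by
  have hcoeff : (starRingEnd ℂ) (-(1 / (2 * Real.pi * Complex.I))) =
      1 / (2 * Real.pi * Complex.I) := by
    rw [map_neg, map_div₀, map_one, map_mul, map_mul, Complex.conj_ofReal, Complex.conj_I,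
      Complex.conj_ofNat, mul_neg, div_neg, neg_neg]
  rw [s22_eq_conj_s11_conj hq.continuous hi (Or.inl hz),
    s11_eq_exp_contourIntegral_mul_blaschke hq hi hi' h (conj_mem_Dplus hz),
    contourIntegral_traceIntegrand_conj hq hi hi' h.ne_zero (sq_im_neg_of_mem_Dminus hz).ne,
    map_mul, map_mul, ← Complex.exp_conj, map_mul, hcoeff, Complex.conj_conj, ← map_pow,
    conj_blaschke_conj, ← Complex.exp_conj, map_neg, map_mul, Complex.conj_I, Complex.conj_ofReal,
    neg_mul, neg_neg]

theorem norm_transmission_ofReal_of_isReflectionless (hc : Continuous fun x => q x t)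
    (hi : Integrable fun x => q x t) (hs : ∀ ζ ∈ contour, s11 q t ζ ≠ 0)
    (hr : IsReflectionless q t) (x : ℝ) : ‖transmission (fun x => q x t) x‖ = 1 := by
  obtain ⟨ζ, hζ, hsq⟩ := exists_mem_contour_sq_eq x
  have hlog := log_one_sub_rho_mul_rhoTilde hc hi hζ (s11_eq_scatteringMatrix hc hi hζ ▸ hs ζ hζ)
  rw [(hr ζ hζ).1, zero_mul, sub_zero, Complex.log_one, hsq, eq_comm, Complex.ofReal_eq_zero,
    neg_eq_zero, mul_eq_zero, or_iff_right two_ne_zero] at hlog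
  exact Real.eq_one_of_pos_of_log_eq_zero
    (norm_pos_iff.2 (transmission_ofReal_ne_zero hc hi hs x)) hlog

theorem div_conj_eq_exp {w : ℂ} (hw : w ≠ 0) :
    w / (starRingEnd ℂ) w = Complex.exp (2 * Complex.arg w * Complex.I) := by
  have hpolar := Complex.norm_mul_exp_arg_mul_I w
  have hn : (‖w‖ : ℂ) ≠ 0 := Complex.ofReal_ne_zero.2 (norm_ne_zero_iff.2 hw)
  have hconj : (starRingEnd ℂ) w = ‖w‖ * Complex.exp (-(Complex.arg w * Complex.I)) := by
    conv_lhs => rw [← hpolar]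
    rw [map_mul, Complex.conj_ofReal, ← Complex.exp_conj, map_mul, Complex.conj_ofReal,
      Complex.conj_I, mul_neg]
  rw [hconj]
  nth_rewrite 1 [← hpolar]
  rw [mul_div_mul_left _ _ hn, ← Complex.exp_sub]
  ring_nf

theorem blaschke_zero (hk : ∀ i, k i ≠ 0) :
    blaschke (fun i => k i ^ 2) m 0 =
      Complex.exp (((∑ i, 4 * m i * Complex.arg (k i) : ℝ) : ℂ) * Complex.I) := by
  rw [blaschke, Complex.ofReal_sum, Finset.sum_mul, Complex.exp_sum]
  refine Finset.prod_congr rfl fun i _ => ?_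
  rw [zero_sub, zero_sub, neg_div_neg_eq, map_pow, ← div_pow, div_conj_eq_exp (hk i),
    ← Complex.exp_nat_mul, ← Complex.exp_nat_mul]
  push_cast
  ring_nf

theorem exists_v0_eq_of_isReflectionless (hq : ContDiff ℝ 1 fun x => q x t)
    (hi : Integrable fun x => q x t) (hi' : Integrable (deriv fun x => q x t))
    (h : IsDiscreteSpectrum q t k m) (hr : IsReflectionless q t) :
    ∃ j : ℤ, v0 q t = ∑ i, 4 * m i * Complex.arg (k i) + 2 * j * Real.pi := by
  have hc := hq.continuous
  have hzero : transmission (fun x => q x t) 0 =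
      blaschke (fun i => k i ^ 2) m 0 * Complex.exp (-(Complex.I * v0 q t)) :=
    eq_blaschke_mul_of_norm_eq_one (continuousOn_transmission hc hi)
    (differentiableOn_transmission hc hi) h.sq_injective
    h.sq_im_pos (h.analyticOrderAt_transmission hc hi)
    (fun w hw => h.exists_sq_eq_of_transmission_eq_zero hc hi hw)
    (norm_exp_neg_I_mul_ofReal (v0 q t)) (tendsto_transmission hq hi hi')
    (norm_transmission_ofReal_of_isReflectionless hc hi h.ne_zero hr) (le_refl (0 : ℝ))
  have hk0 : ∀ i, k i ≠ 0 := fun i hi0 => (h.re_pos i).ne' (congrArg Complex.re hi0)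
  rw [transmission_zero, blaschke_zero hk0, ← Complex.exp_add] at hzero
  obtain ⟨j, hj⟩ := Complex.exp_eq_one_iff.1 hzero.symm
  refine ⟨-j, ?_⟩
  have hreal : (∑ i, 4 * m i * Complex.arg (k i) - v0 q t : ℝ) = j * (2 * Real.pi) := by
    refine Complex.ofReal_injective (mul_right_cancel₀ Complex.I_ne_zero ?_)
    rw [Complex.ofReal_sub, sub_mul, sub_eq_add_neg, mul_comm (v0 q t : ℂ), hj]
    push_cast
    ring
  push_cast
  linarith

theorem prod_eta_eq_blaschke {N : ℕ} (k : Fin N → ℂ) (m : Fin N → ℕ) (z : ℂ) :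
    ∏ n, ((z - eta k n) / (z - (starRingEnd ℂ) (eta k n))) ^ Fin.append m m n =
      blaschke (fun n => k n ^ 2) m (z ^ 2) := by
  rw [Fin.prod_univ_add, ← Finset.prod_mul_distrib]
  refine Finset.prod_congr rfl fun n _ => ?_
  simp only [eta, Fin.append_left, Fin.append_right]
  rw [← mul_pow, div_mul_div_comm, map_neg, map_pow]
  ring_nf

theorem prod_eta_inv_eq_inv_blaschke {N : ℕ} (k : Fin N → ℂ) (m : Fin N → ℕ) (z : ℂ) :
    ∏ n, ((z - (starRingEnd ℂ) (eta k n)) / (z - eta k n)) ^ Fin.append m m n =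
      (blaschke (fun n => k n ^ 2) m (z ^ 2))⁻¹ := by
  simp only [← prod_eta_eq_blaschke, ← Finset.prod_inv_distrib, ← inv_pow, inv_div]

theorem append_const (N : ℕ) (a : ℕ) :
    (Fin.append (fun _ => a) fun _ => a : Fin (N + N) → ℕ) = fun _ => a :=
  funext <| Fin.addCases (Fin.append_left _ _) (Fin.append_right _ _)

end TraceFormula

end DNLS

end

theorem mainTheorem7_general (q : ℝ → ℝ → ℂ) (t : ℝ)
    (hq : ContDiff ℝ 1 (fun x : ℝ => q x t))
    (hq_int : Integrable (fun x : ℝ => q x t) volume)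
    (hqx_int : Integrable (deriv fun x : ℝ => q x t) volume)
    (N : ℕ) (k : Fin N → ℂ) (m : Fin N → ℕ) (hk : DNLS.IsDiscreteSpectrum q t k m) :
    (ContinuousOn (DNLS.s11 q t) (DNLS.Dplus ∪ DNLS.contour) ∧
      AnalyticOnNhd ℂ (DNLS.s11 q t) DNLS.Dplus ∧
      ∀ ζ ∈ DNLS.contour, DNLS.s11 q t ζ = DNLS.scatteringMatrix q t ζ 0 0) ∧
    (ContinuousOn (DNLS.s22 q t) (DNLS.Dminus ∪ DNLS.contour) ∧
      AnalyticOnNhd ℂ (DNLS.s22 q t) DNLS.Dminus ∧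
      ∀ ζ ∈ DNLS.contour, DNLS.s22 q t ζ = DNLS.scatteringMatrix q t ζ 1 1) ∧
    (∀ z ∈ DNLS.Dplus, DNLS.ContourIntegrable (DNLS.traceIntegrand q t z) ∧
      DNLS.s11 q t z =
        Complex.exp (-(1 / (2 * Real.pi * Complex.I)) *
            DNLS.contourIntegral (DNLS.traceIntegrand q t z)) *
          (∏ n, ((z - DNLS.eta k n) / (z - (starRingEnd ℂ) (DNLS.eta k n))) ^ Fin.append m m n) *
          Complex.exp (-(Complex.I * DNLS.v0 q t))) ∧
    (∀ z ∈ DNLS.Dminus, DNLS.ContourIntegrable (DNLS.traceIntegrand q t z) ∧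
      DNLS.s22 q t z =
        Complex.exp ((1 / (2 * Real.pi * Complex.I)) *
            DNLS.contourIntegral (DNLS.traceIntegrand q t z)) *
          (∏ n, ((z - (starRingEnd ℂ) (DNLS.eta k n)) / (z - DNLS.eta k n)) ^ Fin.append m m n) *
          Complex.exp (Complex.I * DNLS.v0 q t)) ∧
    DNLS.s11 q t 0 = 1 ∧
    (DNLS.IsReflectionless q t →
      ∃ j : ℤ, DNLS.v0 q t = ∑ n, 4 * m n * Complex.arg (k n) + 2 * j * Real.pi) := by
  have hc := hq.continuous
  simp only [DNLS.prod_eta_eq_blaschke, DNLS.prod_eta_inv_eq_inv_blaschke]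
  refine ⟨⟨DNLS.continuousOn_s11 hc hq_int, DNLS.analyticOnNhd_s11 hc hq_int,
      fun ζ hζ => DNLS.s11_eq_scatteringMatrix hc hq_int hζ⟩,
    ⟨DNLS.continuousOn_s22 hc hq_int, DNLS.analyticOnNhd_s22 hc hq_int,
      fun ζ hζ => DNLS.s22_eq_scatteringMatrix hc hq_int hζ⟩,
    fun z hz => ⟨?_, DNLS.s11_eq_exp_contourIntegral_mul_blaschke hq hq_int hqx_int hk hz⟩,
    fun z hz => ⟨?_, DNLS.s22_eq_exp_contourIntegral_mul_inv_blaschke hq hq_int hqx_int hk hz⟩,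
    DNLS.s11_zero hc hq_int, DNLS.exists_v0_eq_of_isReflectionless hq hq_int hqx_int hk⟩
  · exact DNLS.contourIntegrable_traceIntegrand hq hq_int hqx_int hk.ne_zero
      (DNLS.sq_im_pos_of_mem_Dplus hz).ne'
  · exact DNLS.contourIntegrable_traceIntegrand hq hq_int hqx_int hk.ne_zero
      (DNLS.sq_im_neg_of_mem_Dminus hz).ne

theorem mainTheorem7 (q : ℝ → ℝ → ℂ) (t : ℝ)
    (hq : ContDiff ℝ 1 (fun x : ℝ => q x t))
    (hq_int : Integrable (fun x : ℝ => q x t) volume)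
    (hqx_int : Integrable (deriv fun x : ℝ => q x t) volume)
    -- no spectral singularities
    (hsing : ∀ ζ ∈ DNLS.contour, DNLS.scatteringMatrix q t ζ 0 0 ≠ 0)
    -- the zeros of `s₁₁` in the open first quadrant are `k₁, …, k_N`, all of them double
    (N : ℕ) (k : Fin N → ℂ) (hk_inj : Function.Injective k)
    (hk : ∀ z : ℂ, (0 < z.re ∧ 0 < z.im ∧ DNLS.s11 q t z = 0) ↔ ∃ n, k n = z)
    (hk_double : ∀ n, deriv (DNLS.s11 q t) (k n) = 0 ∧
      iteratedDeriv 2 (DNLS.s11 q t) (k n) ≠ 0) :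
    -- `s₁₁`, `s₂₂` are the continuations of the diagonal entries of `S` from `Σ` to `D⁺`, `D⁻`
    (ContinuousOn (DNLS.s11 q t) (DNLS.Dplus ∪ DNLS.contour) ∧
      AnalyticOnNhd ℂ (DNLS.s11 q t) DNLS.Dplus ∧
      ∀ ζ ∈ DNLS.contour, DNLS.s11 q t ζ = DNLS.scatteringMatrix q t ζ 0 0) ∧
    (ContinuousOn (DNLS.s22 q t) (DNLS.Dminus ∪ DNLS.contour) ∧
      AnalyticOnNhd ℂ (DNLS.s22 q t) DNLS.Dminus ∧
      ∀ ζ ∈ DNLS.contour, DNLS.s22 q t ζ = DNLS.scatteringMatrix q t ζ 1 1) ∧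
    -- the trace formula
    (∀ z ∈ DNLS.Dplus, DNLS.ContourIntegrable (DNLS.traceIntegrand q t z) ∧
      DNLS.s11 q t z =
        Complex.exp (-(1 / (2 * Real.pi * Complex.I)) *
            DNLS.contourIntegral (DNLS.traceIntegrand q t z)) *
          (∏ n, ((z - DNLS.eta k n) / (z - (starRingEnd ℂ) (DNLS.eta k n))) ^ 2) *
          Complex.exp (-(Complex.I * DNLS.v0 q t))) ∧
    (∀ z ∈ DNLS.Dminus, DNLS.ContourIntegrable (DNLS.traceIntegrand q t z) ∧
      DNLS.s22 q t z =
        Complex.exp ((1 / (2 * Real.pi * Complex.I)) *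
            DNLS.contourIntegral (DNLS.traceIntegrand q t z)) *
          (∏ n, ((z - (starRingEnd ℂ) (DNLS.eta k n)) / (z - DNLS.eta k n)) ^ 2) *
          Complex.exp (Complex.I * DNLS.v0 q t)) ∧
    -- the value at the origin and the constraint on reflectionless potentials
    DNLS.s11 q t 0 = 1 ∧
    (DNLS.IsReflectionless q t →
      ∃ j : ℤ, DNLS.v0 q t = 8 * (∑ n, Complex.arg (k n)) + 2 * j * Real.pi) := by
  have hspec := DNLS.isDiscreteSpectrum_two hq.continuous hq_int hsing hk_inj hk hk_double
  simpa only [DNLS.append_const, Nat.cast_ofNat, ← Finset.mul_sum, show (4 * 2 : ℝ) = 8 by norm_num]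
    using mainTheorem7_general q t hq hq_int hqx_int N k (fun _ => 2) hspec
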